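/- **Setting.** Let $d\ge 1$ and let $\alpha,R,r,c>0$, $G$, $M$ be real constants. Let $n\ge1$ learners form the node set $V=\{1,\dots,n\}$ of an undirected graph (self-loops allowed) with neighbourhoods $N_i$, and let $P\in\mathbb R^{n\times n}$ be non-negative, symmetric and doubly stochastic, with $P_{ij}>0$ only if $j\in N_i$, whose second largest singular value $\sigma_2(P)$ (read as $0$ if $n=1$) satisfies $\sigma_2(P)<1$. Let $\mathcal K\subset\mathbb R^d$ be closed and convex with $r\mathcal B^d\subseteq\mathcal K\subseteq R\mathcal B^d$, where $\mathcal B^d$ is the closed Euclidean unit ball. Let $T\ge2$, and let the losses $f_{t,i}$ ($1\le t\le T$, $i\in V$) be fixed in advance (oblivious adversary); each is $G$-Lipschitz on $\mathcal K$, $\alpha$-strongly convex on $\mathcal K$ (i.e. $f_{t,i}-\frac\alpha2\|\cdot\|_2^2$ is convex on $\mathcal K$), and bounded by $M$ in absolute value on $\mathcal K$. **Parameters.** $K=L=\lfloor T^{2/3}(\ln T)^{-2/3}\rfloor$, $\delta=cT^{-1/3}(\ln T)^{1/3}$ with $\delta\le r$, and $h=\alpha K$. Let $\mathcal K_\delta=(1-\delta/r)\mathcal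 K$ and fix $\mathbf x_{\mathrm{in}}\in\mathcal K_\delta$. **Algorithm D-BBCG.** The rounds are divided into consecutive blocks $\mathcal T_m=\{(m-1)K+1,\dots,mK\}$ (the last block may be cut off at $T$). Set $\mathbf x_i(1)=\mathbf x_{\mathrm{in}}$ and $\mathbf z_i(1)=\mathbf 0$ for all $i$. In round $t\in\mathcal T_m$ learner $i$ plays $\mathbf y_i(t)=\mathbf x_i(m)+\delta\mathbf u_i(t)$, where the $\mathbf u_i(t)$ are independent over $(t,i)$ and uniform on the unit sphere of $\mathbb R^d$, observes $f_{t,i}(\mathbf y_i(t))$ and forms $\mathbf g_i(t)=\frac d\delta f_{t,i}(\mathbf y_i(t))\mathbf u_i(t)$. For each complete block $m$, $$\mathbf x_i(m+1)=\mathrm{CG}(\mathcal K_\delta,L,F_{m,i},\mathbf x_i(m)),\qquad \mathbf z_i(m+1)=\sum_{j\in N_i}P_{ij}\mathbf z_j(m)+\sum_{t\in\mathcal T_m}\mathbf g_i(t)-\alpha K\mathbf x_i(m),$$ where $F_{m,i}(\mathbf x)=\mathbf z_i(m)^\top\mathbf x+\frac{(m-1)\alpha K}{2}\|\mathbf x\|_2^2+h\|\mathbf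 x-\mathbf x_{\mathrm{in}}\|_2^2$. Here $\mathrm{CG}(S,L,F,\mathbf c_0)$ returns $\mathbf c_L$, where for $\tau=0,\dots,L-1$ one takes $\mathbf v_\tau\in\arg\min_{\mathbf x\in S}\nabla F(\mathbf c_\tau)^\top\mathbf x$, $s_\tau\in\arg\min_{s\in[0,1]}F(\mathbf c_\tau+s(\mathbf v_\tau-\mathbf c_\tau))$ and $\mathbf c_{\tau+1}=\mathbf c_\tau+s_\tau(\mathbf v_\tau-\mathbf c_\tau)$; ties in the choice of $\mathbf v_\tau$ in block $m$ are broken in an arbitrary measurable way depending only on the directions drawn in rounds $1,\dots,mK$. **Claim.** Let $f_t=\sum_{j=1}^nf_{t,j}$ and $$R_{T,i}=\sum_{t=1}^Tf_t(\mathbf y_i(t))-\min_{\mathbf x\in\mathcal K}\sum_{t=1}^Tf_t(\mathbf x).$$ There is a constant $C$ depending only on $d,\alpha,G,M,R,r,c$ (in particular not on $n$, the graph, $P$, $\mathcal K$, the losses, $\mathbf x_{\mathrm{in}}$, $T$ or $i$) such that in the above setting, for every learner $i\in V$, $R_{T,i}$ is integrable and $$\mathbb E[R_{T,i}]\le C\,\frac{n^{3/2}}{1-\sigma_2(P)}\,T^{2/3}(\ln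 T)^{1/3}.$$ -/

import Mathlib

open scoped Pointwise RealInnerProductSpace BigOperators
open MeasureTheory ProbabilityTheory

namespace DBBCG

/-- `ℝ^d` with the Euclidean norm. -/
abbrev Vec (d : ℕ) := EuclideanSpace ℝ (Fin d)

/-- The unit sphere of `ℝ^d`. -/
abbrev UnitSphere (d : ℕ) := Metric.sphere (0 : Vec d) 1

/-- The uniform probability distribution on the unit sphere: normalized surface measure. -/
noncomputable def uniformSphere (d : ℕ) : Measure (UnitSphere d) :=
  ((volume : Measure (Vec d)).toSphere Set.univ)⁻¹ • (volume : Measure (Vec d)).toSphere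

/-- Neighbours of node `i` in the graph with node set `Fin n` and edge set `E`
(self-loops are allowed). -/
noncomputable def neighbors {n : ℕ} (E : Set (Fin n × Fin n)) (i : Fin n) : Finset (Fin n) := by
  classical exact Finset.univ.filter (fun j => (i, j) ∈ E)

/-- `P` is a non-negative, symmetric, doubly stochastic matrix supported on the
undirected graph with edge set `E`. -/
structure IsWeightMatrix {n : ℕ} (E : Set (Fin n × Fin n)) (P : Matrix (Fin n) (Fin n) ℝ) :
    Prop where
  undirected : ∀ i j, (i, j) ∈ E → (j, i) ∈ E
  nonneg : ∀ i j, 0 ≤ P i j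
  symm : P.IsSymm
  support : ∀ i j, 0 < P i j → (i, j) ∈ E
  row_sum : ∀ i, ∑ j, P i j = 1
  col_sum : ∀ j, ∑ i, P i j = 1

/-- The second largest singular value of `P` (singular values are listed in decreasing order,
with multiplicity, from index `0`); it is `0` for a matrix of size one. -/
noncomputable def sigma2 {n : ℕ} (P : Matrix (Fin n) (Fin n) ℝ) : ℝ :=
  (Matrix.toEuclideanLin P).singularValues 1

/-- The shrunk set `(1 - δ / r) 𝒦`. -/
def shrink {d : ℕ} (𝒦 : Set (Vec d)) (δ r : ℝ) : Set (Vec d) := (1 - δ / r) • 𝒦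

/-- `c 0, …, c L` are iterates of the conditional gradient method with exact line search for
minimizing `F` over `S`, started at `x₀`; `v 0, …, v (L - 1)` are the solutions of the linear
optimization steps. The output of the method is `c L`. -/
def IsCG {d : ℕ} (S : Set (Vec d)) (L : ℕ) (F : Vec d → ℝ) (x₀ : Vec d)
    (v c : ℕ → Vec d) : Prop :=
  c 0 = x₀ ∧ ∀ τ < L,
    (v τ ∈ S ∧ IsMinOn (fun x => ⟪gradient F (c τ), x⟫) S (v τ)) ∧
    ∃ s ∈ Set.Icc (0 : ℝ) 1,
      IsMinOn (fun s' : ℝ => F (c τ + s' • (v τ - c τ))) (Set.Icc 0 1) s ∧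
      c (τ + 1) = c τ + s • (v τ - c τ)

/-- The surrogate loss of block `m`. -/
noncomputable def surrogate {d : ℕ} (α h : ℝ) (K : ℕ) (x₀ : Vec d) (m : ℕ) (z : Vec d)
    (x : Vec d) : ℝ :=
  ⟪z, x⟫ + ((m : ℝ) - 1) * α * K / 2 * ‖x‖ ^ 2 + h * ‖x - x₀‖ ^ 2

/-- The one-point gradient estimate from the loss `f` at the centre `x` with direction `u`. -/
noncomputable def onePoint {d : ℕ} (δ : ℝ) (f : Vec d → ℝ) (x u : Vec d) : Vec d :=
  ((d : ℝ) / δ * f (x + δ • u)) • u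

/-- The rounds `(m - 1) K + 1, …, m K` of block `m`. -/
def block (K m : ℕ) : Finset ℕ := Finset.Icc ((m - 1) * K + 1) (m * K)

/-- The block to which round `t ≥ 1` belongs. -/
def blockOf (K t : ℕ) : ℕ := (t - 1) / K + 1

/-- The information revealed by the random directions of all learners in rounds `1, …, t`. -/
@[reducible]
def history {Ω : Type*} {d n : ℕ} (u : ℕ → Fin n → Ω → UnitSphere d) (t : ℕ) :
    MeasurableSpace Ω :=
  ⨆ s ∈ Set.Icc 1 t, ⨆ j, MeasurableSpace.comap (u s j) inferInstance

/-- `x`, `z` (indexed by block, learner, outcome) and the linear optimization solutions `v` and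
iterates `c` (indexed by block, learner, inner iteration, outcome) form an execution over
`T` rounds of D-BBCG on the decision set `𝒦`, with block size `K`, losses `f t i` and
directions `u t i`. Blocks and rounds are numbered from `1`. A last block that is not complete
within the `T` rounds triggers no update. Ties in the linear optimization steps may be broken
arbitrarily, but without knowledge of future random directions. -/
structure IsRun {Ω : Type*} {d n : ℕ} (𝒦 : Set (Vec d)) (E : Set (Fin n × Fin n))
    (P : Matrix (Fin n) (Fin n) ℝ) (r α h δ : ℝ) (K L T : ℕ) (x₀ : Vec d)
    (f : ℕ → Fin n → Vec d → ℝ) (u : ℕ → Fin n → Ω → UnitSphere d)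
    (x z : ℕ → Fin n → Ω → Vec d) (v c : ℕ → Fin n → ℕ → Ω → Vec d) : Prop where
  init_mem : x₀ ∈ shrink 𝒦 δ r
  x_one : ∀ i ω, x 1 i ω = x₀
  z_one : ∀ i ω, z 1 i ω = 0
  cg : ∀ m, 1 ≤ m → m * K ≤ T → ∀ i ω,
    IsCG (shrink 𝒦 δ r) L (surrogate α h K x₀ m (z m i ω)) (x m i ω)
      (fun τ => v m i τ ω) (fun τ => c m i τ ω)
  x_succ : ∀ m, 1 ≤ m → m * K ≤ T → ∀ i ω, x (m + 1) i ω = c m i L ω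
  z_succ : ∀ m, 1 ≤ m → m * K ≤ T → ∀ i ω,
    z (m + 1) i ω = ∑ j ∈ neighbors E i, P i j • z m j ω
      + ∑ t ∈ block K m, onePoint δ (f t i) (x m i ω) (u t i ω)
      - (α * K) • x m i ω
  nonanticipating : ∀ m, 1 ≤ m → m * K ≤ T → ∀ i, ∀ τ < L,
    Measurable[history u (m * K)] (v m i τ)

/-- The point `y_i(t) = x_i(m) + δ u_i(t)` played by learner `i` in round `t` of block `m`. -/
noncomputable def played {Ω : Type*} {d n : ℕ} (δ : ℝ) (K : ℕ)
    (u : ℕ → Fin n → Ω → UnitSphere d) (x : ℕ → Fin n → Ω → Vec d)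
    (i : Fin n) (t : ℕ) (ω : Ω) : Vec d :=
  x (blockOf K t) i ω + δ • (u t i ω : Vec d)

/-- The global loss of round `t`. -/
noncomputable def globalLoss {d n : ℕ} (f : ℕ → Fin n → Vec d → ℝ) (t : ℕ) (x : Vec d) : ℝ :=
  ∑ j, f t j x

/-- The regret over `T` rounds of the decisions `y 1, …, y T`, measured by the global loss. -/
noncomputable def regret {d n : ℕ} (𝒦 : Set (Vec d)) (f : ℕ → Fin n → Vec d → ℝ) (T : ℕ)
    (y : ℕ → Vec d) : ℝ :=
  ∑ t ∈ Finset.Icc 1 T, globalLoss f t (y t)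
    - sInf ((fun x => ∑ t ∈ Finset.Icc 1 T, globalLoss f t x) '' 𝒦)

end DBBCG

/-!
The regret is compared with that of a fictitious central player, the *leader*, who in block `m`
minimizes over the shrunk set `(1 - δ / r) 𝒦` the surrogate loss formed with the average of the
learners' dual variables. All surrogate losses are isotropic quadratics with modulus
`(m + 1) α K`. Four facts carry the proof.

* **One-point estimates.** The mean of `(d / δ) f (x + δ u) u` over the unit sphere satisfies the
  inequality of a subgradient of the strongly convex loss `f` at `x` up to `2 C δ`, where `C` is a
  Lipschitz constant, and has norm at most `C` (`le_inner_meanEstimate`,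
  `inner_meanEstimate_le_norm`). Both follow from a divergence inequality for Lipschitz functions
  (`integral_sphere_mul_inner_le`), proved by integration by parts against a radial cutoff. Since
  the directions are independent and the decisions of a block depend on earlier blocks only, the
  fluctuations of the `K` estimates of a block are uncorrelated, and the second moment of their sum
  is at most `(K C + √K d M / δ) ^ 2` (`RegularRun.integral_norm_sq_partial_le`).
* **Consensus.** Gossip with `P` preserves the average of the dual variables and contracts their
  deviation from it by `sigma2 P` (`IsWeightMatrix.netDev_step`), so that the expected deviation
  stays of order `√n K / (1 - sigma2 P)`. After division by the modulus, the learners' exact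
  surrogate minimizers differ from the leader's by `O(√n / (m (1 - sigma2 P)))`.
* **Conditional gradients.** `K` steps bring the function value within `O(modulus / K)` of the
  minimum (`IsCG.gap_le`), hence the iterate within `O(1 / √K)` of the minimizer
  (`IsCG.norm_sub_metricProj_le`).
* **Follow the leader.** The leader has regret at most `∑ ‖g m‖ ^ 2 / (2 (m + 1) α K)` plus the
  initial regularization, of order `K`, against the linearized, strongly convex block losses
  (`leader_regret_le`), and moves by at most `2 ‖g m‖ / ((m + 1) α K)` in block `m`
  (`leader_step_le`).

Adding these up, the expected regret of a learner is bounded by an explicit expression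
(`RegularRun.integral_sum_loss_sub_le`). With `s = (T / log T) ^ (1 / 3)`, block length of order
`s ^ 2` and `δ = c / s`, each of its terms is `O(n ^ (3 / 2) / (1 - sigma2 P) * s ^ 2 * log T)`
(`regret_bound_of_scale`): the logarithm comes from the harmonic sum over the blocks, and the
optimization and smoothing errors, of order `√K T / K` and `δ T`, are of the same order because
`T / s = s ^ 2 * log T`.

The losses are given on `𝒦` only, in the sense that nothing is assumed outside. They are replaced
by globally Lipschitz extensions, which changes neither the run nor the regret, since all points
played lie in `𝒦` (`IsRun.congr`, `regret_congr`).
-/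

namespace DBBCG

open Filter Topology Metric

/-! ### Spherical averages and the divergence inequality -/

/-- Integration in polar coordinates of a product of a radial and an angular function. -/
theorem integral_radial_mul_angular {E : Type*} [NormedAddCommGroup E] [NormedSpace ℝ E]
    [FiniteDimensional ℝ E] [Nontrivial E] [MeasurableSpace E] [BorelSpace E]
    (μ : Measure E) [μ.IsAddHaarMeasure] (φ : ℝ → ℝ) (H : E → ℝ) :
    ∫ x, φ ‖x‖ * H (‖x‖⁻¹ • x) ∂μ = (∫ u : sphere (0 : E) 1, H u ∂μ.toSphere) *
      ∫ y : Set.Ioi (0 : ℝ), φ y ∂Measure.volumeIoiPow (Module.finrank ℝ E - 1) := by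
  calc
    ∫ x, φ ‖x‖ * H (‖x‖⁻¹ • x) ∂μ
        = ∫ x : ({(0)}ᶜ : Set E), φ ‖x.1‖ * H (‖x.1‖⁻¹ • x.1) ∂(μ.comap (↑)) := by
      rw [integral_subtype_comap (measurableSet_singleton _).compl
        fun x ↦ φ ‖x‖ * H (‖x‖⁻¹ • x), restrict_compl_singleton]
    _ = ∫ x, H x.1 * φ x.2 ∂μ.toSphere.prod (.volumeIoiPow (Module.finrank ℝ E - 1)) := by
      rw [← μ.measurePreserving_homeomorphUnitSphereProd.integral_comp
        (Homeomorph.measurableEmbedding _)]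
      refine integral_congr_ae (Eventually.of_forall fun x => ?_)
      simp [mul_comm]
    _ = _ := integral_prod_mul (fun u : sphere (0 : E) 1 => H u) (fun y : Set.Ioi (0 : ℝ) => φ y)

/-- The normalization of `uniformSphere` is eliminated by comparing with the radial function
alone. -/
theorem integral_radial_mul_angular_eq_uniformSphere {d : ℕ} (hd : 1 ≤ d) (φ : ℝ → ℝ)
    (H : Vec d → ℝ) :
    ∫ x : Vec d, φ ‖x‖ * H (‖x‖⁻¹ • x) = (∫ u, H u ∂uniformSphere d) * ∫ x : Vec d, φ ‖x‖ := by
  have : Nonempty (Fin d) := ⟨⟨0, hd⟩⟩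
  have h1 := integral_radial_mul_angular (volume : Measure (Vec d)) φ H
  have h2 := integral_radial_mul_angular (volume : Measure (Vec d)) φ (fun _ => 1)
  simp only [mul_one, integral_const, smul_eq_mul] at h2
  rw [h1, h2, uniformSphere, integral_smul_measure]
  have h3 : ((volume : Measure (Vec d)).toSphere.real Set.univ) ≠ 0 := by
    rw [Measure.toSphere_real_apply_univ]
    have : 0 < (volume : Measure (Vec d)).real (ball 0 1) :=
      ENNReal.toReal_pos (measure_ball_pos _ _ one_pos).ne' measure_ball_lt_top.ne
    have hd' : (0 : ℝ) < Module.finrank ℝ (Vec d) := by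
      simp; omega
    positivity
  rw [ENNReal.toReal_inv]
  change _ = (((volume : Measure (Vec d)).toSphere.real Set.univ)⁻¹ • _) * _
  rw [smul_eq_mul]
  field_simp

instance isProbabilityMeasure_uniformSphere {d : ℕ} [NeZero d] :
    IsProbabilityMeasure (uniformSphere d) := by
  have : Nonempty (Fin d) := ⟨0⟩
  constructor
  rw [uniformSphere, Measure.smul_apply, smul_eq_mul]
  refine ENNReal.inv_mul_cancel ?_ (measure_ne_top _ _)
  rw [Measure.toSphere_apply_univ]
  have : (volume : Measure (Vec d)) (ball 0 1) ≠ 0 := (measure_ball_pos _ _ one_pos).ne'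
  simp [NeZero.ne d, this]

/-- The radial cutoff: `1` up to radius `1 - ε`, `0` from radius `1` on, affine in between. -/
noncomputable def radialCutoff (ε ρ : ℝ) : ℝ := max 0 (min 1 ((1 - ρ) / ε))

theorem radialCutoff_nonneg (ε ρ : ℝ) : 0 ≤ radialCutoff ε ρ := le_max_left _ _

theorem radialCutoff_le_one (ε ρ : ℝ) : radialCutoff ε ρ ≤ 1 :=
  max_le zero_le_one (min_le_left _ _)

theorem radialCutoff_of_one_le {ε ρ : ℝ} (hε : 0 < ε) (h : 1 ≤ ρ) : radialCutoff ε ρ = 0 :=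
  max_eq_left ((min_le_right _ _).trans (div_nonpos_of_nonpos_of_nonneg (by linarith) hε.le))

theorem radialCutoff_of_le {ε ρ : ℝ} (hε : 0 < ε) (h : ρ ≤ 1 - ε) : radialCutoff ε ρ = 1 := by
  have : 1 ≤ (1 - ρ) / ε := by rw [le_div_iff₀ hε]; linarith
  rw [radialCutoff, min_eq_left this, max_eq_right zero_le_one]

theorem radialCutoff_of_mem {ε ρ : ℝ} (hε : 0 < ε) (h : ρ ∈ Set.Ioo (1 - ε) 1) :
    radialCutoff ε ρ = (1 - ρ) / ε := by
  have h1 : (1 - ρ) / ε ≤ 1 := by rw [div_le_iff₀ hε]; linarith [h.1]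
  have h2 : 0 ≤ (1 - ρ) / ε := div_nonneg (by linarith [h.2]) hε.le
  rw [radialCutoff, min_eq_right h1, max_eq_right h2]

theorem lipschitzWith_radialCutoff_norm {E : Type*} [NormedAddCommGroup E] {ε : ℝ} (hε : 0 < ε) :
    LipschitzWith (ε⁻¹).toNNReal (fun v : E => radialCutoff ε ‖v‖) := by
  have h : LipschitzWith (ε⁻¹).toNNReal (fun v : E => (1 - ‖v‖) / ε) := by
    refine LipschitzWith.of_dist_le_mul fun a b => ?_
    rw [Real.coe_toNNReal _ (inv_nonneg.2 hε.le), Real.dist_eq, ← sub_div, abs_div,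
      abs_of_pos hε, div_eq_inv_mul, dist_eq_norm]
    gcongr
    rw [show (1 - ‖a‖ - (1 - ‖b‖)) = ‖b‖ - ‖a‖ by ring, abs_sub_comm]
    exact abs_norm_sub_norm_le a b
  exact (h.const_min 1).const_max 0

theorem lineDeriv_radialCutoff_norm {E : Type*} [NormedAddCommGroup E] [InnerProductSpace ℝ E]
    {ε : ℝ} (hε : 0 < ε) (hε1 : ε < 1) {v : E} (w : E)
    (h1 : ‖v‖ ≠ 1 - ε) (h2 : ‖v‖ ≠ 1) :
    lineDeriv ℝ (fun v : E => radialCutoff ε ‖v‖) v (-w) =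
      ε⁻¹ * ((Set.Ioo (1 - ε) 1).indicator (fun _ => 1) ‖v‖ * ⟪‖v‖⁻¹ • v, w⟫) := by
  have hcn : Continuous fun v : E => ‖v‖ := continuous_norm
  by_cases hv : ‖v‖ ∈ Set.Ioo (1 - ε) 1
  · have hev : (fun v : E => radialCutoff ε ‖v‖) =ᶠ[𝓝 v] fun v => (1 - ‖v‖) / ε := by
      filter_upwards [(isOpen_Ioo.preimage hcn).mem_nhds hv] with y hy
      exact radialCutoff_of_mem hε hy
    have hv0 : v ≠ 0 := by
      rintro rfl
      simp only [norm_zero, Set.mem_Ioo] at hv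
      linarith [hv.1]
    rw [hev.lineDeriv_eq, Set.indicator_of_mem hv]
    have hn : HasLineDerivAt ℝ (fun v : E => ‖v‖) (⟪‖v‖⁻¹ • v, -w⟫) v (-w) := by
      have := (hasStrictFDerivAt_norm_sq v).hasFDerivAt.sqrt (by simpa using hv0)
      have h3 := this.hasLineDerivAt (-w)
      simp only [Real.sqrt_sq (norm_nonneg _)] at h3
      convert h3 using 1
      simp [real_inner_smul_left]
      ring
    have hn' : HasDerivAt (fun t : ℝ => ‖v + t • -w‖) (⟪‖v‖⁻¹ • v, -w⟫) 0 := hn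
    have h4 : HasLineDerivAt ℝ (fun v : E => (1 - ‖v‖) / ε) (-⟪‖v‖⁻¹ • v, -w⟫ / ε) v (-w) :=
      (hn'.const_sub 1).div_const ε
    rw [h4.lineDeriv, inner_neg_right]
    field_simp
  · rw [Set.indicator_of_notMem hv]
    have hev : ∃ k : ℝ, (fun v : E => radialCutoff ε ‖v‖) =ᶠ[𝓝 v] fun _ => k := by
      rcases lt_or_gt_of_ne h2 with h | h
      · have h' : ‖v‖ < 1 - ε := lt_of_le_of_ne (by
          by_contra! h3; exact hv ⟨h3, h⟩) h1
        refine ⟨1, ?_⟩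
        filter_upwards [(isOpen_Iio.preimage hcn).mem_nhds h'] with y hy
        exact radialCutoff_of_le hε (le_of_lt hy)
      · refine ⟨0, ?_⟩
        filter_upwards [(isOpen_Ioi.preimage hcn).mem_nhds h] with y hy
        exact radialCutoff_of_one_le hε (le_of_lt hy)
    obtain ⟨k, hk⟩ := hev
    rw [hk.lineDeriv_eq]
    simp [lineDeriv]

theorem measureReal_ball_pow {d : ℕ} {ρ : ℝ} (hρ : 0 ≤ ρ) (hd : 1 ≤ d) :
    (volume : Measure (Vec d)).real (closedBall 0 ρ) =
      ρ ^ d * (volume : Measure (Vec d)).real (ball 0 1) := by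
  have : Nonempty (Fin d) := ⟨⟨0, hd⟩⟩
  rw [Measure.real, Measure.addHaar_closedBall _ _ hρ, ENNReal.toReal_mul,
    ENNReal.toReal_ofReal (by positivity)]
  simp [Measure.real]

/-- The divergence inequality before the cutoff width `ε` tends to zero. Integrating by parts
against `radialCutoff ε ‖v‖` leaves an integral over the shell `1 - ε < ‖v‖ < 1`, where the
gradient of the cutoff is `-ε⁻¹ • ‖v‖⁻¹ • v`; up to the Lipschitz error of moving `v` to the sphere,
that integral is the spherical average times the volume of the shell. -/
theorem integral_sphere_mul_inner_le_aux {d : ℕ} (hd : 1 ≤ d) {F : Vec d → ℝ} {C : NNReal}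
    (hF : LipschitzWith C F) (w : Vec d) {A : ℝ}
    (hA : ∀ v, ‖v‖ < 1 → LineDifferentiableAt ℝ F v w → lineDeriv ℝ F v w ≤ A)
    {ε : ℝ} (hε : 0 < ε) (hε1 : ε < 1) :
    (∫ u, F u * ⟪(u : Vec d), w⟫ ∂uniformSphere d) * (ε⁻¹ * (1 - (1 - ε) ^ d)) ≤
      A + (|A| + C * ‖w‖) * (1 - (1 - ε) ^ d) := by
  have : NeZero d := ⟨by omega⟩
  have : Nonempty (Fin d) := ⟨0⟩
  set V := (volume : Measure (Vec d)).real (ball 0 1) with hV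
  have hVpos : 0 < V := ENNReal.toReal_pos (measure_ball_pos _ _ one_pos).ne' measure_ball_lt_top.ne
  set θ : ℝ := 1 - (1 - ε) ^ d with hθ
  set I := ∫ u, F u * ⟪(u : Vec d), w⟫ ∂uniformSphere d with hI
  set ψ : Vec d → ℝ := fun v => radialCutoff ε ‖v‖ with hψ
  have hψL : LipschitzWith (ε⁻¹).toNNReal ψ := lipschitzWith_radialCutoff_norm hε
  have hψc : HasCompactSupport ψ := by
    refine HasCompactSupport.intro (isCompact_closedBall (0 : Vec d) 1) fun v hv => ?_
    exact radialCutoff_of_one_le hε (by simpa using (not_le.1 (fun h => hv (by simpa using h))).le)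
  have hψi : Integrable ψ := hψL.continuous.integrable_of_hasCompactSupport hψc
  set φ : ℝ → ℝ := (Set.Ioo (1 - ε) 1).indicator (fun _ => 1) with hφ
  have hφi : Integrable (fun v : Vec d => φ ‖v‖) := by
    have : (fun v : Vec d => φ ‖v‖) =
        (norm ⁻¹' (Set.Ioo (1 - ε) 1)).indicator (fun _ => (1 : ℝ)) := by
      ext v; simp [hφ, Set.indicator]
    rw [this]
    refine (integrable_indicator_iff (measurable_norm measurableSet_Ioo)).2 ?_
    refine integrableOn_const ?_
    refine (lt_of_le_of_lt (measure_mono ?_) (measure_ball_lt_top (x := (0 : Vec d)) (r := 1))).ne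
    intro v hv
    simpa using hv.2
  have hφint : ∫ v : Vec d, φ ‖v‖ = V * θ := by
    have : (fun v : Vec d => φ ‖v‖) =
        (ball 0 1 \ closedBall 0 (1 - ε)).indicator (fun _ => (1 : ℝ)) := by
      ext v; simp [hφ, Set.indicator, and_comm]
    rw [this, integral_indicator (measurableSet_ball.diff measurableSet_closedBall)]
    simp only [integral_const, smul_eq_mul, mul_one, measureReal_restrict_apply_univ]
    rw [measureReal_sdiff (closedBall_subset_ball (by linarith)) measurableSet_closedBall,
      measureReal_ball_pow (by linarith) hd]
    simp only [hθ, ← hV]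
    ring
  -- integration by parts
  have hparts :=
    LipschitzWith.integral_lineDeriv_mul_eq (μ := (volume : Measure (Vec d))) hF hψL hψc w
  have hright : ∫ v, lineDeriv ℝ ψ v (-w) * F v =
      ε⁻¹ * ∫ v, φ ‖v‖ * (⟪‖v‖⁻¹ • v, w⟫ * F v) := by
    rw [← integral_const_mul]
    refine integral_congr_ae ?_
    have e1 : ∀ᵐ v ∂(volume : Measure (Vec d)), v ∉ sphere (0 : Vec d) (1 - ε) :=
      measure_eq_zero_iff_ae_notMem.1 (Measure.addHaar_sphere _ _ _)
    have e2 : ∀ᵐ v ∂(volume : Measure (Vec d)), v ∉ sphere (0 : Vec d) 1 :=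
      measure_eq_zero_iff_ae_notMem.1 (Measure.addHaar_sphere _ _ _)
    filter_upwards [e1, e2] with v h1 h2
    rw [lineDeriv_radialCutoff_norm hε hε1 w (by simpa using h1) (by simpa using h2)]
    ring
  -- the shell integral with `F` evaluated on the sphere
  have hpolar : ∫ v : Vec d, φ ‖v‖ * (⟪‖v‖⁻¹ • v, w⟫ * F (‖v‖⁻¹ • v)) = I * (V * θ) := by
    rw [integral_radial_mul_angular_eq_uniformSphere hd φ (fun v => ⟪v, w⟫ * F v), hφint, hI]
    simp only [mul_comm]
  have hθ0 : 0 ≤ θ := by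
    have : (1 - ε) ^ d ≤ 1 := pow_le_one₀ (by linarith) (by linarith)
    linarith
  have hφ01 : ∀ ρ, 0 ≤ φ ρ := fun ρ => Set.indicator_nonneg (fun _ _ => zero_le_one) ρ
  have hFb : ∀ v : Vec d, ‖v‖ ≤ 1 → |F v| ≤ |F 0| + C := fun v hv => by
    have h1 := hF.dist_le_mul v 0
    rw [Real.dist_eq, dist_zero_right] at h1
    have h2 : (C : ℝ) * ‖v‖ ≤ C * 1 := by gcongr
    have h3 := abs_sub_abs_le_abs_sub (F v) (F 0)
    linarith
  have hnormalized : ∀ v : Vec d, ‖(‖v‖⁻¹ • v)‖ ≤ 1 := fun v => by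
    rw [norm_smul, norm_inv, norm_norm]
    exact inv_mul_le_one
  have hinner : ∀ v : Vec d, |⟪‖v‖⁻¹ • v, w⟫| ≤ ‖w‖ := fun v =>
    (abs_real_inner_le_norm _ _).trans
      (mul_le_of_le_one_left (norm_nonneg w) (hnormalized v))
  have hFm : Measurable F := hF.continuous.measurable
  have hφm : Measurable φ := measurable_const.indicator measurableSet_Ioo
  have hnm : Measurable fun v : Vec d => ‖v‖⁻¹ • v := measurable_norm.inv.smul measurable_id
  have hint1 : Integrable (fun v : Vec d => φ ‖v‖ * (⟪‖v‖⁻¹ • v, w⟫ * F v)) := by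
    refine (hφi.mul_const (‖w‖ * (|F 0| + C))).mono' ?_ (Eventually.of_forall fun v => ?_)
    · exact ((hφm.comp measurable_norm).mul
        ((hnm.inner_const).mul hFm)).aestronglyMeasurable
    · by_cases hv : ‖v‖ ∈ Set.Ioo (1 - ε) 1
      · rw [norm_mul, norm_mul, Real.norm_of_nonneg (hφ01 _)]
        exact mul_le_mul_of_nonneg_left (mul_le_mul (hinner v) (hFb v hv.2.le) (norm_nonneg _)
          (norm_nonneg _)) (hφ01 _)
      · simp [hφ, Set.indicator_of_notMem hv]
  have hint2 : Integrable (fun v : Vec d => φ ‖v‖ * (⟪‖v‖⁻¹ • v, w⟫ * F (‖v‖⁻¹ • v))) := by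
    refine (hφi.mul_const (‖w‖ * (|F 0| + C))).mono' ?_ (Eventually.of_forall fun v => ?_)
    · exact ((hφm.comp measurable_norm).mul
        ((hnm.inner_const).mul (hFm.comp hnm))).aestronglyMeasurable
    · rw [norm_mul, norm_mul, Real.norm_of_nonneg (hφ01 _)]
      exact mul_le_mul_of_nonneg_left (mul_le_mul (hinner v) (hFb _ (hnormalized v))
          (norm_nonneg _) (norm_nonneg _)) (hφ01 _)
  -- in the shell, moving `v` to `‖v‖⁻¹ • v` changes `F` by at most `C * ε`
  have hcompare : I * (V * θ) ≤ (∫ v : Vec d, φ ‖v‖ * (⟪‖v‖⁻¹ • v, w⟫ * F v)) +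
      (V * θ) * (C * ‖w‖ * ε) := by
    rw [← hpolar, ← hφint, ← integral_mul_const, ← integral_add hint1 (hφi.mul_const _)]
    refine integral_mono hint2 (hint1.add (hφi.mul_const _)) fun v => ?_
    by_cases hv : ‖v‖ ∈ Set.Ioo (1 - ε) 1
    · have hvpos : 0 < ‖v‖ := by linarith [hv.1]
      have hd1 : dist (‖v‖⁻¹ • v) v ≤ ε := by
        have : ‖v‖⁻¹ • v - v = (‖v‖⁻¹ - 1) • v := by rw [sub_smul, one_smul]
        rw [dist_eq_norm, this, norm_smul, Real.norm_eq_abs,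
          abs_of_nonneg (sub_nonneg.2 ((one_le_inv₀ hvpos).2 hv.2.le)), sub_mul,
          inv_mul_cancel₀ hvpos.ne', one_mul]
        linarith [hv.1]
      have h1 : ⟪‖v‖⁻¹ • v, w⟫ * (F (‖v‖⁻¹ • v) - F v) ≤ ‖w‖ * (C * ε) := by
        refine (le_abs_self _).trans ?_
        rw [abs_mul]
        refine mul_le_mul (hinner v) ?_ (abs_nonneg _) (norm_nonneg _)
        have := hF.dist_le_mul (‖v‖⁻¹ • v) v
        rw [Real.dist_eq] at this
        exact this.trans (by gcongr)
      have h2 : φ ‖v‖ = 1 := Set.indicator_of_mem hv _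
      simp only [h2]
      linarith
    · have h2 : φ ‖v‖ = 0 := Set.indicator_of_notMem hv _
      simp [h2]
  have hψV : ∫ v, ψ v ≤ V := by
    have : V = ∫ v : Vec d, (ball 0 1).indicator (fun _ => (1 : ℝ)) v := by
      rw [integral_indicator measurableSet_ball]; simp [hV]
    rw [this]
    refine integral_mono hψi ?_ fun v => ?_
    · exact (integrable_indicator_iff measurableSet_ball).2 (integrableOn_const measure_ball_lt_top.ne)
    · by_cases hv : ‖v‖ < 1
      · rw [Set.indicator_of_mem (by simpa using hv)]
        exact radialCutoff_le_one _ _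
      · rw [Set.indicator_of_notMem (by simpa using hv)]
        exact (radialCutoff_of_one_le hε (not_lt.1 hv)).le
  have hVψ : V * (1 - θ) ≤ ∫ v, ψ v := by
    have : V * (1 - θ) = ∫ v : Vec d, (closedBall 0 (1 - ε)).indicator (fun _ => (1 : ℝ)) v := by
      rw [integral_indicator measurableSet_closedBall]
      simp only [integral_const, smul_eq_mul, mul_one, measureReal_restrict_apply_univ]
      rw [measureReal_ball_pow (by linarith) hd, ← hV, hθ]
      ring
    rw [this]
    refine integral_mono ?_ hψi fun v => ?_
    · exact (integrable_indicator_iff measurableSet_closedBall).2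
        (integrableOn_const measure_closedBall_lt_top.ne)
    · by_cases hv : ‖v‖ ≤ 1 - ε
      · rw [Set.indicator_of_mem (by simpa using hv)]
        exact (radialCutoff_of_le hε hv).ge
      · rw [Set.indicator_of_notMem (by simpa using hv)]
        exact radialCutoff_nonneg _ _
  -- `∫ ψ` lies between `V * (1 - θ)` and `V`; which side matters depends on the sign of `A`
  have hAψ : A * ∫ v, ψ v ≤ V * (A + |A| * θ) := by
    rcases le_total 0 A with h | h
    · rw [abs_of_nonneg h]
      nlinarith [mul_le_mul_of_nonneg_left hψV h, mul_nonneg h (mul_nonneg hVpos.le hθ0)]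
    · rw [abs_of_nonpos h]
      nlinarith [mul_le_mul_of_nonpos_left hVψ h]
  have hleft : ∫ v, lineDeriv ℝ F v w * ψ v ≤ A * ∫ v, ψ v := by
    rw [← integral_const_mul]
    refine integral_mono_ae ?_ (hψi.const_mul A) ?_
    · refine (hψi.const_mul (C * ‖w‖)).mono' ?_ (Eventually.of_forall fun v => ?_)
      · exact ((measurable_lineDeriv hF.continuous).mul
          hψL.continuous.measurable).aestronglyMeasurable
      · rw [norm_mul, Real.norm_of_nonneg (radialCutoff_nonneg ε ‖v‖)]
        exact mul_le_mul_of_nonneg_right (norm_lineDeriv_le_of_lipschitz ℝ hF)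
          (radialCutoff_nonneg ε ‖v‖)
    · filter_upwards [hF.ae_lineDifferentiableAt (μ := (volume : Measure (Vec d))) w] with v hv
      by_cases h : ‖v‖ < 1
      · exact mul_le_mul_of_nonneg_right (hA v h hv) (radialCutoff_nonneg ε ‖v‖)
      · have : ψ v = 0 := radialCutoff_of_one_le hε (not_lt.1 h)
        simp [this]
  have hmain : ε⁻¹ * (I * (V * θ) - (V * θ) * (C * ‖w‖ * ε)) ≤ V * (A + |A| * θ) := by
    refine le_trans ?_ (hleft.trans hAψ)
    rw [hparts, hright]
    exact mul_le_mul_of_nonneg_left (by linarith) (inv_nonneg.2 hε.le)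
  have hexp : ε⁻¹ * (I * (V * θ) - (V * θ) * (C * ‖w‖ * ε)) =
      V * (I * (ε⁻¹ * θ) - C * ‖w‖ * θ) := by
    field_simp
  rw [hexp] at hmain
  have := le_of_mul_le_mul_left hmain hVpos
  linarith

/-- An upper bound for the directional derivatives of `F` inside the unit ball bounds the
spherical average of `d • F u • u` in that direction. This is the form of the divergence theorem
behind the one-point gradient estimate; only line derivatives are involved, because `F` is merely
Lipschitz. -/
theorem integral_sphere_mul_inner_le {d : ℕ} (hd : 1 ≤ d) {F : Vec d → ℝ} {C : NNReal}
    (hF : LipschitzWith C F) (w : Vec d) {A : ℝ}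
    (hA : ∀ v, ‖v‖ < 1 → LineDifferentiableAt ℝ F v w → lineDeriv ℝ F v w ≤ A) :
    d * ∫ u, F u * ⟪(u : Vec d), w⟫ ∂uniformSphere d ≤ A := by
  set I := ∫ u, F u * ⟪(u : Vec d), w⟫ ∂uniformSphere d with hI
  have hder : HasDerivAt (fun ε : ℝ => 1 - (1 - ε) ^ d) d 0 := by
    have h := (((hasDerivAt_id (0 : ℝ)).const_sub 1).pow d).const_sub 1
    simpa using h
  have h1 : Tendsto (fun ε : ℝ => ε⁻¹ * (1 - (1 - ε) ^ d)) (𝓝[>] 0) (𝓝 (d : ℝ)) := by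
    have := hder.tendsto_slope_zero_right
    simpa using this
  have h2 : Tendsto (fun ε : ℝ => 1 - (1 - ε) ^ d) (𝓝[>] 0) (𝓝 0) := by
    have := hder.continuousAt.tendsto
    simp only [sub_zero, one_pow, sub_self] at this
    exact this.mono_left nhdsWithin_le_nhds
  have h3 := h1.const_mul I
  have h4 := (h2.const_mul (|A| + C * ‖w‖)).const_add A
  rw [mul_zero, add_zero] at h4
  rw [mul_comm]
  refine le_of_tendsto_of_tendsto h3 h4 ?_
  filter_upwards [Ioo_mem_nhdsGT (zero_lt_one' ℝ)] with ε hε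
  exact integral_sphere_mul_inner_le_aux hd hF w hA hε.1 hε.2

end DBBCG

namespace DBBCG

open Filter Topology Metric

/-! ### The one-point gradient estimate -/

/-- The expectation of the one-point gradient estimate of `f` at the centre `x`. -/
noncomputable def meanEstimate {d : ℕ} (δ : ℝ) (f : Vec d → ℝ) (x : Vec d) : Vec d :=
  ∫ u, onePoint δ f x (u : Vec d) ∂uniformSphere d

theorem continuous_onePoint {d : ℕ} (δ : ℝ) {F : Vec d → ℝ} (hF : Continuous F) :
    Continuous fun p : Vec d × UnitSphere d => onePoint δ F p.1 (p.2 : Vec d) := by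
  unfold onePoint
  fun_prop

theorem integrable_onePoint {d : ℕ} [NeZero d] (δ : ℝ) {F : Vec d → ℝ} (hF : Continuous F)
    (x : Vec d) : Integrable (fun u : UnitSphere d => onePoint δ F x (u : Vec d))
      (uniformSphere d) := by
  have : Continuous fun u : UnitSphere d => onePoint δ F x (u : Vec d) :=
    (continuous_onePoint δ hF).comp (Continuous.prodMk_right x)
  exact this.integrable_of_hasCompactSupport (HasCompactSupport.of_compactSpace _)

theorem inner_meanEstimate {d : ℕ} [NeZero d] (δ : ℝ) {F : Vec d → ℝ} (hF : Continuous F)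
    (x w : Vec d) :
    ⟪meanEstimate δ F x, w⟫ =
      δ⁻¹ * (d * ∫ u, F (x + δ • (u : Vec d)) * ⟪(u : Vec d), w⟫ ∂uniformSphere d) := by
  rw [meanEstimate, real_inner_comm, ← integral_inner (integrable_onePoint δ hF x) w,
    ← integral_const_mul, ← integral_const_mul]
  refine integral_congr_ae (Eventually.of_forall fun u => ?_)
  simp only [onePoint, inner_smul_right, real_inner_comm w]
  ring

theorem lipschitzWith_comp_add_smul {d : ℕ} {δ : ℝ} (hδ : 0 < δ) {F : Vec d → ℝ} {C : NNReal}
    (hF : LipschitzWith C F) (x : Vec d) :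
    LipschitzWith (C * δ.toNNReal) fun v => F (x + δ • v) := by
  refine hF.comp (LipschitzWith.of_dist_le_mul fun a b => ?_)
  rw [dist_add_left, dist_smul₀, Real.coe_toNNReal _ hδ.le, Real.norm_of_nonneg hδ.le]

/-- The mean of the one-point estimate is bounded by the Lipschitz constant of the loss, although
the estimate itself is of order `1 / δ`. -/
theorem inner_meanEstimate_le_norm {d : ℕ} [NeZero d] {δ : ℝ} (hδ : 0 < δ) {F : Vec d → ℝ}
    {C : NNReal} (hF : LipschitzWith C F) (x w : Vec d) :
    ⟪meanEstimate δ F x, w⟫ ≤ C * ‖w‖ := by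
  rw [inner_meanEstimate δ hF.continuous, inv_mul_le_iff₀ hδ]
  refine integral_sphere_mul_inner_le (NeZero.one_le) (lipschitzWith_comp_add_smul hδ hF x) w
    fun v _ _ => ?_
  refine (le_abs_self _).trans ((norm_lineDeriv_le_of_lipschitz ℝ
    (lipschitzWith_comp_add_smul hδ hF x)).trans (le_of_eq ?_))
  rw [NNReal.coe_mul, Real.coe_toNNReal _ hδ.le]
  ring

/-- The mean of the one-point estimate is, up to an error of order `δ`, a subgradient of a
strongly convex loss, including the quadratic gain. -/
theorem le_inner_meanEstimate {d : ℕ} [NeZero d] {δ α : ℝ} (hδ : 0 < δ) {F : Vec d → ℝ}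
    {C : NNReal} (hF : LipschitzWith C F) {𝒦 : Set (Vec d)} (hsc : StrongConvexOn 𝒦 α F)
    {x y : Vec d} (hx : ∀ v : Vec d, ‖v‖ ≤ 1 → x + δ • v ∈ 𝒦)
    (hy : ∀ v : Vec d, ‖v‖ ≤ 1 → y + δ • v ∈ 𝒦) :
    F x - F y - 2 * C * δ + α / 2 * ‖x - y‖ ^ 2 ≤ ⟪meanEstimate δ F x, x - y⟫ := by
  have key : ⟪meanEstimate δ F x, y - x⟫ ≤ F y - F x + 2 * C * δ - α / 2 * ‖y - x‖ ^ 2 := by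
    rw [inner_meanEstimate δ hF.continuous, inv_mul_le_iff₀ hδ]
    refine integral_sphere_mul_inner_le (NeZero.one_le) (lipschitzWith_comp_add_smul hδ hF x) _
      fun v hv hdiff => ?_
    have h1 := hdiff.hasLineDerivAt.tendsto_slope_zero_right
    have h2 : Tendsto (fun s : ℝ => δ * (F y - F x + 2 * C * δ -
        (1 - s * δ) * (α / 2 * ‖y - x‖ ^ 2))) (𝓝[>] 0)
        (𝓝 (δ * (F y - F x + 2 * C * δ - (1 - 0 * δ) * (α / 2 * ‖y - x‖ ^ 2)))) := by
      refine Tendsto.mono_left ?_ nhdsWithin_le_nhds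
      exact Continuous.tendsto (f := fun s : ℝ => δ * (F y - F x + 2 * C * δ -
        (1 - s * δ) * (α / 2 * ‖y - x‖ ^ 2))) (by fun_prop) 0
    rw [zero_mul, sub_zero, one_mul] at h2
    refine le_of_tendsto_of_tendsto h1 h2 ?_
    -- the point reached from `x + δ • v` after a step `s` is the convex combination of `x + δ • v`
    -- and `y + δ • v` with weight `s * δ`
    filter_upwards [Ioo_mem_nhdsGT (inv_pos.2 hδ)] with s hs
    have hs1 : s * δ ≤ 1 := by
      have := mul_le_mul_of_nonneg_right hs.2.le hδ.le
      rwa [inv_mul_cancel₀ hδ.ne'] at this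
    have hs0 : 0 < s * δ := mul_pos hs.1 hδ
    have hc := hsc.2 (hx v hv.le) (hy v hv.le) (sub_nonneg.2 hs1) hs0.le (by ring)
    have e1 : (1 - s * δ) • (x + δ • v) + (s * δ) • (y + δ • v) =
        x + δ • (v + s • (y - x)) := by
      module
    have e2 : x + δ • v - (y + δ • v) = -(y - x) := by abel
    rw [e1, e2, norm_neg] at hc
    have hbd : ∀ a : Vec d, |F (a + δ • v) - F a| ≤ C * δ := fun a => by
      have := hF.dist_le_mul (a + δ • v) a
      rw [Real.dist_eq, dist_self_add_left, norm_smul, Real.norm_of_nonneg hδ.le] at this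
      refine this.trans ?_
      gcongr
      exact mul_le_of_le_one_right hδ.le hv.le
    have b1 := abs_le.1 (hbd x)
    have b2 := abs_le.1 (hbd y)
    rw [smul_eq_mul, inv_mul_le_iff₀ hs.1]
    simp only [smul_eq_mul] at hc
    have b3 : (s * δ) * (F (y + δ • v) - F (x + δ • v)) ≤
        (s * δ) * (F y - F x + 2 * C * δ) :=
      mul_le_mul_of_nonneg_left (by linarith [b1.1, b2.2]) hs0.le
    linarith
  rw [← neg_sub y x, inner_neg_right, norm_neg]
  linarith

end DBBCG

namespace DBBCG

open Filter Topology Metric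

/-! ### The surrogate losses as isotropic quadratics -/

/-- Completing the square: minimizing a surrogate loss is projecting onto the decision set. -/
theorem surrogate_eq {d : ℕ} {α h : ℝ} {K m : ℕ} (ha : ((m : ℝ) - 1) * α * K + 2 * h ≠ 0)
    (x₀ z : Vec d) : ∃ k : ℝ, ∀ x, surrogate α h K x₀ m z x =
      (((m : ℝ) - 1) * α * K + 2 * h) / 2 *
        ‖x - (((m : ℝ) - 1) * α * K + 2 * h)⁻¹ • ((2 * h) • x₀ - z)‖ ^ 2 + k := by
  set a := ((m : ℝ) - 1) * α * K + 2 * h with hadef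
  have e : ((m : ℝ) - 1) * α * K = a - 2 * h := by rw [hadef]; ring
  refine ⟨h * ‖x₀‖ ^ 2 - a⁻¹ / 2 * ‖(2 * h) • x₀ - z‖ ^ 2, fun x => ?_⟩
  rw [surrogate, e, @norm_sub_sq_real _ _ _ x, @norm_sub_sq_real _ _ _ x, norm_smul, mul_pow,
    Real.norm_eq_abs, sq_abs, inner_smul_right, inner_sub_right, inner_smul_right,
    real_inner_comm x z]
  field_simp
  ring

/-! ### Metric projection -/

/-- The metric projection onto a closed convex set, given by its variational inequality
(and `0` where the inequality has no solution). -/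
noncomputable def metricProj {d : ℕ} (S : Set (Vec d)) (q : Vec d) : Vec d := by
  classical exact if h : ∃ p ∈ S, ∀ y ∈ S, ⟪q - p, y - p⟫ ≤ 0 then h.choose else 0

theorem metricProj_spec {d : ℕ} {S : Set (Vec d)} (hne : S.Nonempty) (hc : Convex ℝ S)
    (hcl : IsClosed S) (q : Vec d) :
    metricProj S q ∈ S ∧ ∀ y ∈ S, ⟪q - metricProj S q, y - metricProj S q⟫ ≤ 0 := by
  have h : ∃ p ∈ S, ∀ y ∈ S, ⟪q - p, y - p⟫ ≤ 0 := by
    obtain ⟨p, hp, hmin⟩ := exists_norm_eq_iInf_of_complete_convex hne hcl.isComplete hc q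
    exact ⟨p, hp, (norm_eq_iInf_iff_real_inner_le_zero hc hp).1 hmin⟩
  rw [metricProj, dif_pos h]
  exact h.choose_spec

theorem dist_metricProj_le {d : ℕ} {S : Set (Vec d)} (hne : S.Nonempty) (hc : Convex ℝ S)
    (hcl : IsClosed S) (q q' : Vec d) :
    ‖metricProj S q - metricProj S q'‖ ≤ ‖q - q'‖ := by
  obtain ⟨h1, h2⟩ := metricProj_spec hne hc hcl q
  obtain ⟨h3, h4⟩ := metricProj_spec hne hc hcl q'
  set p := metricProj S q
  set p' := metricProj S q'
  have i1 := h2 p' h3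
  have i2 := h4 p h1
  have i3 : ‖p - p'‖ ^ 2 ≤ ⟪q - q', p - p'⟫ := by
    have e : ⟪q - q', p - p'⟫ - ⟪p - p', p - p'⟫ =
        -⟪q - p, p' - p⟫ - ⟪q' - p', p - p'⟫ := by
      rw [← neg_sub p p', inner_neg_right, neg_neg, ← inner_sub_left, ← inner_sub_left]
      congr 1
      abel
    rw [real_inner_self_eq_norm_sq] at e
    linarith
  have i4 := real_inner_le_norm (q - q') (p - p')
  rcases (norm_nonneg (p - p')).eq_or_lt with h | h
  · rw [← h]; exact norm_nonneg _
  · nlinarith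

theorem continuous_metricProj {d : ℕ} {S : Set (Vec d)} (hne : S.Nonempty) (hc : Convex ℝ S)
    (hcl : IsClosed S) : Continuous (metricProj S) :=
  (LipschitzWith.mk_one fun a b => by
    rw [dist_eq_norm, dist_eq_norm]; exact dist_metricProj_le hne hc hcl a b).continuous

/-- Quadratic growth of `a / 2 * ‖x - q‖ ^ 2` over a convex set around its minimizer there. -/
theorem sq_dist_metricProj_add_le {d : ℕ} {S : Set (Vec d)} (hne : S.Nonempty) (hc : Convex ℝ S)
    (hcl : IsClosed S) (q : Vec d) {x : Vec d} (hx : x ∈ S) :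
    ‖metricProj S q - q‖ ^ 2 + ‖x - metricProj S q‖ ^ 2 ≤ ‖x - q‖ ^ 2 := by
  have h := (metricProj_spec hne hc hcl q).2 x hx
  set p := metricProj S q
  have e : x - q = (p - q) + (x - p) := by abel
  rw [e, norm_add_sq_real, ← neg_sub q p, norm_neg, inner_neg_left]
  linarith

/-! ### The conditional gradient method on isotropic quadratics -/

theorem gradient_quadratic {d : ℕ} {F : Vec d → ℝ} {a k : ℝ} {q : Vec d}
    (hF : ∀ x, F x = a / 2 * ‖x - q‖ ^ 2 + k) (x : Vec d) : gradient F x = a • (x - q) := by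
  have h1 : F = fun x => a / 2 * ‖x - q‖ ^ 2 + k := funext hF
  have h2 : HasFDerivAt F ((a / 2) • (2 • (innerSL ℝ (x - q)))) x := by
    rw [h1]
    have := ((hasStrictFDerivAt_norm_sq (x - q)).hasFDerivAt.comp x
      ((hasFDerivAt_id x).sub_const q)).const_mul (a / 2)
    simpa using this.add_const k
  refine HasGradientAt.gradient ?_
  rw [hasGradientAt_iff_hasFDerivAt]
  have e : InnerProductSpace.toDual ℝ (Vec d) (a • (x - q)) =
      (a / 2) • (2 • (innerSL ℝ (x - q))) := by
    ext y
    simp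
    ring
  rw [e]
  exact h2

theorem quadratic_segment {d : ℕ} (a : ℝ) (c q w : Vec d) (s : ℝ) :
    a / 2 * ‖c + s • w - q‖ ^ 2 =
      a / 2 * ‖c - q‖ ^ 2 + s * ⟪a • (c - q), w⟫ + a / 2 * s ^ 2 * ‖w‖ ^ 2 := by
  have e : c + s • w - q = (c - q) + s • w := by abel
  rw [e, norm_add_sq_real, inner_smul_right, inner_smul_left, norm_smul, mul_pow,
    Real.norm_eq_abs, sq_abs]
  simp
  ring

theorem IsCG.mem {d : ℕ} {S : Set (Vec d)} (hc : Convex ℝ S) {L : ℕ} {F : Vec d → ℝ}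
    {x₀ : Vec d} {v c : ℕ → Vec d} (h : IsCG S L F x₀ v c) (hx₀ : x₀ ∈ S) :
    ∀ τ ≤ L, c τ ∈ S := by
  intro τ hτ
  induction τ with
  | zero => rw [h.1]; exact hx₀
  | succ τ ih =>
    obtain ⟨⟨hv, _⟩, s, hs, _, hstep⟩ := h.2 τ hτ
    rw [hstep]
    exact hc.add_smul_sub_mem (ih (by omega)) hv hs

/-- The classical `O(1 / τ)` rate: comparing the exact line search with the step
`2 / (τ + 2)`. -/
theorem IsCG.gap_le {d : ℕ} {S : Set (Vec d)} (hc : Convex ℝ S) {L : ℕ} {F : Vec d → ℝ}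
    {x₀ : Vec d} {v c : ℕ → Vec d} (h : IsCG S L F x₀ v c) (hx₀ : x₀ ∈ S) {a k : ℝ} (ha : 0 < a)
    {q : Vec d} (hF : ∀ x, F x = a / 2 * ‖x - q‖ ^ 2 + k) {D : ℝ}
    (hD : ∀ x ∈ S, ∀ y ∈ S, ‖x - y‖ ≤ D) {p : Vec d} (hp : p ∈ S) :
    ∀ τ, τ + 1 ≤ L → F (c (τ + 1)) - F p ≤ 2 * a * D ^ 2 / (τ + 3) := by
  have hstep : ∀ τ < L, ∀ s ∈ Set.Icc (0 : ℝ) 1,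
      F (c (τ + 1)) - F p ≤ (1 - s) * (F (c τ) - F p) + a / 2 * s ^ 2 * D ^ 2 := by
    intro τ hτ s hs
    obtain ⟨⟨hv, hvmin⟩, s', hs', hmin, hnext⟩ := h.2 τ hτ
    have h1 : F (c (τ + 1)) ≤ F (c τ + s • (v τ - c τ)) := by
      rw [hnext]; exact hmin hs
    have h2 : ⟪gradient F (c τ), v τ⟫ ≤ ⟪gradient F (c τ), p⟫ := hvmin hp
    rw [gradient_quadratic hF] at h2
    have h3 : F (c τ) + ⟪a • (c τ - q), p - c τ⟫ ≤ F p := by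
      have := quadratic_segment a (c τ) q (p - c τ) 1
      rw [one_smul, add_sub_cancel] at this
      rw [hF, hF, this]
      nlinarith [sq_nonneg ‖p - c τ‖]
    have h4 : ‖v τ - c τ‖ ^ 2 ≤ D ^ 2 := by
      have := hD _ hv _ (h.mem hc hx₀ τ hτ.le)
      exact pow_le_pow_left₀ (norm_nonneg _) this 2
    have h5 : F (c τ + s • (v τ - c τ)) =
        F (c τ) + s * ⟪a • (c τ - q), v τ - c τ⟫ + a / 2 * s ^ 2 * ‖v τ - c τ‖ ^ 2 := by
      rw [hF, hF, quadratic_segment]; ring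
    have h6 : ⟪a • (c τ - q), v τ - c τ⟫ ≤ F p - F (c τ) := by
      rw [inner_sub_right] at h3 ⊢
      linarith
    have h7 := mul_le_mul_of_nonneg_left h6 hs.1
    have h8 : a / 2 * s ^ 2 * ‖v τ - c τ‖ ^ 2 ≤ a / 2 * s ^ 2 * D ^ 2 := by gcongr
    linarith
  intro τ
  induction τ with
  | zero =>
    intro hτ
    have := hstep 0 (by omega) 1 ⟨zero_le_one, le_rfl⟩
    simp only [zero_add, Nat.cast_zero] at this ⊢
    have h1 : 0 ≤ a * D ^ 2 := by positivity
    linarith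
  | succ τ ih =>
    intro hτ
    have h0 := ih (by omega)
    have hpos : (0 : ℝ) < τ + 3 := by positivity
    have hs : 2 / ((τ : ℝ) + 3) ∈ Set.Icc (0 : ℝ) 1 := by
      refine ⟨by positivity, ?_⟩
      rw [div_le_one hpos]
      have : (0 : ℝ) ≤ τ := Nat.cast_nonneg τ
      linarith
    have h1 := hstep (τ + 1) (by omega) _ hs
    have h2 : (1 - 2 / ((τ : ℝ) + 3)) * (F (c (τ + 1)) - F p) ≤
        (1 - 2 / ((τ : ℝ) + 3)) * (2 * a * D ^ 2 / (τ + 3)) :=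
      mul_le_mul_of_nonneg_left h0 (sub_nonneg.2 hs.2)
    refine (h1.trans (add_le_add_left h2 _)).trans ?_
    have e : (1 - 2 / ((τ : ℝ) + 3)) * (2 * a * D ^ 2 / (τ + 3)) +
        a / 2 * (2 / ((τ : ℝ) + 3)) ^ 2 * D ^ 2 =
        2 * a * D ^ 2 * ((τ + 2) / (τ + 3) ^ 2) := by
      field_simp
      ring
    rw [e, div_eq_mul_inv (2 * a * D ^ 2) (((τ + 1 : ℕ) : ℝ) + 3)]
    refine mul_le_mul_of_nonneg_left ?_ (show 0 ≤ 2 * a * D ^ 2 by positivity)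
    push_cast
    rw [← one_div, div_le_div_iff₀ (by positivity) (by positivity)]
    nlinarith

/-- On a strongly convex quadratic the rate for the values is a rate `O(1 / √L)` for the distance
to the minimizer. -/
theorem IsCG.norm_sub_metricProj_le {d : ℕ} {S : Set (Vec d)} (hne : S.Nonempty)
    (hc : Convex ℝ S) (hcl : IsClosed S) {L : ℕ} (hL : 1 ≤ L) {F : Vec d → ℝ}
    {x₀ : Vec d} {v c : ℕ → Vec d} (h : IsCG S L F x₀ v c) (hx₀ : x₀ ∈ S) {a k : ℝ} (ha : 0 < a)
    {q : Vec d} (hF : ∀ x, F x = a / 2 * ‖x - q‖ ^ 2 + k) {D : ℝ} (hD0 : 0 ≤ D)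
    (hD : ∀ x ∈ S, ∀ y ∈ S, ‖x - y‖ ≤ D) :
    ‖c L - metricProj S q‖ ≤ 2 * D / √L := by
  obtain ⟨L, rfl⟩ : ∃ L', L = L' + 1 := ⟨L - 1, by omega⟩
  have hp := (metricProj_spec hne hc hcl q).1
  have h1 := h.gap_le hc hx₀ ha hF hD hp L le_rfl
  have h2 := sq_dist_metricProj_add_le hne hc hcl q (h.mem hc hx₀ (L + 1) le_rfl)
  rw [hF, hF] at h1
  have h3 : a / 2 * ‖c (L + 1) - metricProj S q‖ ^ 2 ≤ 2 * a * D ^ 2 / (L + 3) := by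
    have := mul_le_mul_of_nonneg_left h2 (half_pos ha).le
    linarith
  have h4 : ‖c (L + 1) - metricProj S q‖ ^ 2 ≤ (2 * D / √((L + 1 : ℕ) : ℝ)) ^ 2 := by
    rw [div_pow, Real.sq_sqrt (Nat.cast_nonneg _)]
    have h5 : 2 * a * D ^ 2 / (L + 3) ≤ a / 2 * ((2 * D) ^ 2 / ((L + 1 : ℕ) : ℝ)) := by
      have e : a / 2 * ((2 * D) ^ 2 / ((L + 1 : ℕ) : ℝ)) = 2 * a * D ^ 2 / ((L + 1 : ℕ) : ℝ) := by
        ring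
      rw [e]
      refine div_le_div_of_nonneg_left (by positivity) (by positivity) ?_
      push_cast
      linarith
    exact le_of_mul_le_mul_left (h3.trans h5) (half_pos ha)
  exact le_of_sq_le_sq h4 (by positivity)

/-- The exact line search on an isotropic quadratic has a closed form; this is what makes the
iterates measurable. -/
theorem lineSearch_smul_eq {d : ℕ} {F : Vec d → ℝ} {a k : ℝ} (ha : 0 < a) {q : Vec d}
    (hF : ∀ x, F x = a / 2 * ‖x - q‖ ^ 2 + k) {c w : Vec d} {s : ℝ} (hs : s ∈ Set.Icc (0 : ℝ) 1)
    (hmin : IsMinOn (fun s' : ℝ => F (c + s' • w)) (Set.Icc 0 1) s) :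
    s • w = (max 0 (min 1 (⟪q - c, w⟫ / ‖w‖ ^ 2))) • w := by
  rcases eq_or_ne w 0 with rfl | hw
  · simp
  congr 1
  have hw2 : 0 < ‖w‖ ^ 2 := by positivity
  set t := ⟪q - c, w⟫ / ‖w‖ ^ 2 with ht
  have hval : ∀ s' : ℝ, F (c + s' • w) = a / 2 * ‖w‖ ^ 2 * (s' - t) ^ 2 +
      (a / 2 * ‖c - q‖ ^ 2 + k - a / 2 * ‖w‖ ^ 2 * t ^ 2) := by
    intro s'
    have e : ⟪a • (c - q), w⟫ = -a * (‖w‖ ^ 2 * t) := by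
      rw [ht, mul_div_cancel₀ _ hw2.ne', ← neg_sub q c, inner_smul_left, inner_neg_left]
      simp
    rw [hF, quadratic_segment, e]
    ring
  have hle : ∀ s' ∈ Set.Icc (0 : ℝ) 1, (s - t) ^ 2 ≤ (s' - t) ^ 2 := by
    intro s' hs'
    have h1 : F (c + s • w) ≤ F (c + s' • w) := hmin hs'
    rw [hval, hval] at h1
    have h2 : a / 2 * ‖w‖ ^ 2 * (s - t) ^ 2 ≤ a / 2 * ‖w‖ ^ 2 * (s' - t) ^ 2 := by linarith
    exact le_of_mul_le_mul_left h2 (by positivity)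
  rcases le_or_gt t 0 with h0 | h0
  · rw [max_eq_left ((min_le_right _ _).trans h0)]
    have := hle 0 ⟨le_rfl, zero_le_one⟩
    nlinarith [hs.1, mul_nonneg hs.1 (neg_nonneg.2 h0), sq_nonneg s]
  rcases le_or_gt 1 t with h1 | h1
  · rw [min_eq_left h1, max_eq_right zero_le_one]
    have := hle 1 ⟨zero_le_one, le_rfl⟩
    nlinarith [hs.2, mul_nonneg (sub_nonneg.2 hs.2) (sub_nonneg.2 h1), sq_nonneg (1 - s)]
  · rw [min_eq_right h1.le, max_eq_right h0.le]
    have := hle t ⟨h0.le, h1.le⟩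
    nlinarith [sq_nonneg (s - t)]

/-! ### Follow the regularized leader -/

section FollowTheLeader

variable {d : ℕ} {S : Set (Vec d)} {a : ℕ → ℝ} {Φ ℓ : ℕ → Vec d → ℝ} {p g : ℕ → Vec d}

/-- Stability of the leader `p m`, the minimizer of `Φ m`, which has growth modulus `a m`, when the
loss `ℓ m` with subgradient `g m` at `p m` is added. -/
theorem leader_step_le {m : ℕ} (ha : 0 < a m)
    (hp' : p (m + 1) ∈ S) (hp : p m ∈ S)
    (hgrowth : ∀ m, ∀ x ∈ S, Φ m (p m) + a m / 2 * ‖x - p m‖ ^ 2 ≤ Φ m x)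
    (hmono : 0 ≤ a (m + 1))
    (hsucc : ∀ x, Φ (m + 1) x = Φ m x + ℓ m x)
    (hgrad : ∀ x ∈ S, ℓ m (p m) + ⟪g m, x - p m⟫ ≤ ℓ m x) :
    ‖p (m + 1) - p m‖ ≤ 2 * ‖g m‖ / a m := by
  have h1 := hgrowth m _ hp'
  have h2 := hgrowth (m + 1) _ hp
  have h3 := hgrad _ hp'
  rw [hsucc, hsucc] at h2
  have h4 : 0 ≤ a (m + 1) / 2 * ‖p m - p (m + 1)‖ ^ 2 := by positivity
  have h5 := neg_le_of_abs_le (abs_real_inner_le_norm (g m) (p (m + 1) - p m))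
  rw [le_div_iff₀ ha]
  rcases (norm_nonneg (p (m + 1) - p m)).eq_or_lt with h | h
  · rw [← h, zero_mul]; positivity
  · have h6 : ‖p (m + 1) - p m‖ * (‖p (m + 1) - p m‖ * a m) ≤
        ‖p (m + 1) - p m‖ * (2 * ‖g m‖) := by nlinarith
    exact le_of_mul_le_mul_left h6 h

/-- Regret of the leaders. The term `‖g m‖ ^ 2 / (2 * a m)` is what the growth of `Φ m` around its
minimizer leaves of the gain from knowing the loss `ℓ m` in advance. -/
theorem leader_regret_le {N : ℕ} (ha : ∀ m, 1 ≤ m → 0 < a m) (hp : ∀ m, p m ∈ S)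
    (hgrowth : ∀ m, 1 ≤ m → ∀ x ∈ S, Φ m (p m) + a m / 2 * ‖x - p m‖ ^ 2 ≤ Φ m x)
    (hsucc : ∀ m, 1 ≤ m → m ≤ N → ∀ x, Φ (m + 1) x = Φ m x + ℓ m x)
    (hgrad : ∀ m, 1 ≤ m → m ≤ N → ∀ x ∈ S, ℓ m (p m) + ⟪g m, x - p m⟫ ≤ ℓ m x)
    {y : Vec d} (hy : y ∈ S) :
    ∑ m ∈ Finset.Icc 1 N, (ℓ m (p m) - ℓ m y) ≤
      Φ 1 y - Φ 1 (p 1) + ∑ m ∈ Finset.Icc 1 N, ‖g m‖ ^ 2 / (2 * a m) := by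
  have key : ∀ M ≤ N, ∑ m ∈ Finset.Icc 1 M, (ℓ m (p m) - ℓ m y) ≤
      Φ (M + 1) (p (M + 1)) - Φ 1 (p 1) - (Φ (M + 1) y - Φ 1 y) +
        ∑ m ∈ Finset.Icc 1 M, ‖g m‖ ^ 2 / (2 * a m) := by
    intro M
    induction M with
    | zero => simp
    | succ M ih =>
      intro hM
      rw [Finset.sum_Icc_succ_top (by omega), Finset.sum_Icc_succ_top (by omega)]
      have h0 := ih (by omega)
      have hM1 : 1 ≤ M + 1 := by omega
      have h1 := hgrowth (M + 1) hM1 _ (hp (M + 1 + 1))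
      have h3 := hgrad (M + 1) hM1 hM _ (hp (M + 1 + 1))
      rw [hsucc (M + 1) hM1 hM, hsucc (M + 1) hM1 hM]
      have h4 := neg_le_of_abs_le (abs_real_inner_le_norm (g (M + 1)) (p (M + 1 + 1) - p (M + 1)))
      have h5 : ‖g (M + 1)‖ * ‖p (M + 1 + 1) - p (M + 1)‖ ≤
          ‖g (M + 1)‖ ^ 2 / (2 * a (M + 1)) +
            a (M + 1) / 2 * ‖p (M + 1 + 1) - p (M + 1)‖ ^ 2 := by
        -- the difference of the two sides is a square
        have hapos := ha (M + 1) hM1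
        have e : ‖g (M + 1)‖ ^ 2 / (2 * a (M + 1)) +
            a (M + 1) / 2 * ‖p (M + 1 + 1) - p (M + 1)‖ ^ 2 -
            ‖g (M + 1)‖ * ‖p (M + 1 + 1) - p (M + 1)‖ =
            (‖g (M + 1)‖ - a (M + 1) * ‖p (M + 1 + 1) - p (M + 1)‖) ^ 2 / (2 * a (M + 1)) := by
          field_simp
          ring
        have : 0 ≤ (‖g (M + 1)‖ - a (M + 1) * ‖p (M + 1 + 1) - p (M + 1)‖) ^ 2 /
          (2 * a (M + 1)) := by positivity
        linarith
      linarith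
  have h1 := key N le_rfl
  have h2 := hgrowth (N + 1) (by omega) y hy
  have h3 : 0 ≤ a (N + 1) / 2 * ‖y - p (N + 1)‖ ^ 2 := by
    have := ha (N + 1) (by omega)
    positivity
  linarith

end FollowTheLeader

end DBBCG

namespace DBBCG

open Filter Topology Metric

/-! ### Averaging over the network -/

/-- On the vectors of mean zero, `P` contracts by its second largest singular value. In an
eigenbasis of `Pᴴ * P`, ordered by decreasing eigenvalue, all vectors but the first have an
eigenvalue below `1`, hence are orthogonal to the constant vector, which `P` fixes; a mean zero
vector therefore has no component along the first one. -/
theorem IsWeightMatrix.sum_sq_le {n : ℕ} {E : Set (Fin n × Fin n)} {P : Matrix (Fin n) (Fin n) ℝ}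
    (hP : IsWeightMatrix E P) (hσ : sigma2 P < 1) (x : EuclideanSpace ℝ (Fin n))
    (hx : ∑ i, x i = 0) :
    ‖Matrix.toEuclideanLin P x‖ ^ 2 ≤ sigma2 P ^ 2 * ‖x‖ ^ 2 := by
  set T := Matrix.toEuclideanLin P with hT
  set A := T.adjoint ∘ₗ T with hA
  have hn : Module.finrank ℝ (EuclideanSpace ℝ (Fin n)) = n := by simp
  set e : EuclideanSpace ℝ (Fin n) := WithLp.toLp 2 (fun _ => 1) with he
  have hTe : T e = e := by
    ext i
    simp [hT, he, Matrix.toLpLin_apply, Matrix.mulVec, dotProduct, hP.row_sum]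
  have hadj : T.adjoint = T := by
    rw [hT, ← Matrix.toEuclideanLin_conjTranspose_eq_adjoint,
      Matrix.conjTranspose_eq_transpose_of_trivial, hP.symm.eq]
  have hAe : A e = e := by simp [hA, hadj, hTe]
  have hsym : A.IsSymmetric := T.isSymmetric_adjoint_comp_self
  set b := hsym.eigenvectorBasis hn with hb
  have hAb : ∀ i, A (b i) = (T.singularValues i ^ 2) • b i := fun i => by
    have := hsym.apply_eigenvectorBasis hn i
    rw [T.sq_singularValues_fin hn i]
    exact this
  have hσ0 : 0 ≤ sigma2 P := T.singularValues_nonneg 1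
  have hle : ∀ i : Fin n, i.val ≠ 0 → T.singularValues i ^ 2 ≤ sigma2 P ^ 2 := fun i hi =>
    pow_le_pow_left₀ (T.singularValues_nonneg _) (T.singularValues_antitone (by omega)) 2
  have hbe : ∀ i : Fin n, i.val ≠ 0 → ⟪b i, e⟫ = 0 := fun i hi => by
    have h1 : ⟪A (b i), e⟫ = ⟪b i, A e⟫ := hsym _ _
    rw [hAb, hAe, inner_smul_left] at h1
    simp only [conj_trivial] at h1
    have h2 : T.singularValues i ^ 2 < 1 := by
      have := hle i hi
      nlinarith
    have h3 : (T.singularValues i ^ 2 - 1) * ⟪b i, e⟫ = 0 := by linarith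
    rcases mul_eq_zero.1 h3 with h | h
    · linarith
    · exact h
  have hb0 : ∀ i : Fin n, i.val = 0 → ⟪b i, x⟫ = 0 := fun i hi => by
    have h1 : ⟪e, x⟫ = 0 := by
      simp [he, PiLp.inner_apply, hx]
    have hothers : ∀ j, j ≠ i → ⟪b j, e⟫ = 0 := fun j hj =>
      hbe j fun h => hj (Fin.ext (h.trans hi.symm))
    have h2 : ⟪e, x⟫ = ⟪e, b i⟫ * ⟪b i, x⟫ := by
      rw [← b.sum_inner_mul_inner e x]
      refine Finset.sum_eq_single i (fun j _ hj => ?_) (by simp)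
      rw [real_inner_comm, hothers j hj, zero_mul]
    have h3 : ⟪e, e⟫ = ⟪e, b i⟫ * ⟪b i, e⟫ := by
      rw [← b.sum_inner_mul_inner e e]
      refine Finset.sum_eq_single i (fun j _ hj => ?_) (by simp)
      rw [real_inner_comm, hothers j hj, zero_mul]
    have h4 : ⟪e, b i⟫ ≠ 0 := by
      intro h
      rw [h, zero_mul, inner_self_eq_zero] at h3
      have := congrArg (fun y : EuclideanSpace ℝ (Fin n) => y i) h3
      simp [he] at this
    rw [h1] at h2
    exact (mul_eq_zero.1 h2.symm).resolve_left h4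
  have hnorm : ‖T x‖ ^ 2 = ∑ i : Fin n, T.singularValues i ^ 2 * ⟪b i, x⟫ ^ 2 := by
    rw [← real_inner_self_eq_norm_sq, ← LinearMap.adjoint_inner_left]
    change ⟪A x, x⟫ = _
    rw [← b.sum_inner_mul_inner]
    refine Finset.sum_congr rfl fun i _ => ?_
    rw [hsym, hAb, inner_smul_right, real_inner_comm]
    ring
  rw [hnorm, ← b.sum_sq_norm_inner_right x, Finset.mul_sum]
  refine Finset.sum_le_sum fun i _ => ?_
  rw [Real.norm_eq_abs, sq_abs]
  by_cases hi : i.val = 0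
  · rw [hb0 i hi]; simp
  · exact mul_le_mul_of_nonneg_right (hle i hi) (sq_nonneg _)

/-- The average of the vectors held by the learners. -/
noncomputable def netAvg {n d : ℕ} (Z : Fin n → Vec d) : Vec d := (n : ℝ)⁻¹ • ∑ i, Z i

/-- The total (Euclidean) deviation of the learners' vectors from their average. -/
noncomputable def netDev {n d : ℕ} (Z : Fin n → Vec d) : ℝ := √(∑ i, ‖Z i - netAvg Z‖ ^ 2)

theorem sum_eq_smul_netAvg {n d : ℕ} (Z : Fin n → Vec d) : ∑ i, Z i = (n : ℝ) • netAvg Z := by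
  rcases Nat.eq_zero_or_pos n with rfl | hn
  · simp
  · rw [netAvg, smul_inv_smul₀ (by positivity)]

theorem sum_sub_netAvg {n d : ℕ} (Z : Fin n → Vec d) : ∑ i, (Z i - netAvg Z) = 0 := by
  rw [Finset.sum_sub_distrib, sum_eq_smul_netAvg]
  simp [Nat.cast_smul_eq_nsmul]

theorem netAvg_add {n d : ℕ} (Z W : Fin n → Vec d) :
    netAvg (fun i => Z i + W i) = netAvg Z + netAvg W := by
  simp [netAvg, Finset.sum_add_distrib]

theorem norm_sub_netAvg_le {n d : ℕ} (Z : Fin n → Vec d) (i : Fin n) :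
    ‖Z i - netAvg Z‖ ≤ netDev Z :=
  Real.le_sqrt_of_sq_le
    (Finset.single_le_sum (f := fun i => ‖Z i - netAvg Z‖ ^ 2) (fun _ _ => sq_nonneg _)
      (Finset.mem_univ i))

theorem sum_sq_sub_netAvg {n d : ℕ} (Z : Fin n → Vec d) :
    ∑ i, ‖Z i - netAvg Z‖ ^ 2 = ∑ i, ‖Z i‖ ^ 2 - n * ‖netAvg Z‖ ^ 2 := by
  simp only [norm_sub_sq_real, Finset.sum_add_distrib, Finset.sum_sub_distrib,
    ← Finset.mul_sum, ← sum_inner, sum_eq_smul_netAvg, inner_smul_left]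
  simp
  ring

theorem sum_sq_sub_netAvg_le {n d : ℕ} (Z : Fin n → Vec d) :
    ∑ i, ‖Z i - netAvg Z‖ ^ 2 ≤ ∑ i, ‖Z i‖ ^ 2 := by
  have h := sum_sq_sub_netAvg Z
  rw [h]
  have : 0 ≤ (n : ℝ) * ‖netAvg Z‖ ^ 2 := by positivity
  linarith

theorem norm_netAvg_sq_le {n d : ℕ} (Z : Fin n → Vec d) :
    n * ‖netAvg Z‖ ^ 2 ≤ ∑ i, ‖Z i‖ ^ 2 := by
  have h := sum_sq_sub_netAvg Z
  have : 0 ≤ ∑ i, ‖Z i - netAvg Z‖ ^ 2 := Finset.sum_nonneg fun _ _ => sq_nonneg _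
  linarith

/-- The contraction for vector-valued data, applied coordinate by coordinate. -/
theorem IsWeightMatrix.sum_norm_sq_le {n d : ℕ} {E : Set (Fin n × Fin n)}
    {P : Matrix (Fin n) (Fin n) ℝ} (hP : IsWeightMatrix E P) (hσ : sigma2 P < 1)
    (Z : Fin n → Vec d) (hZ : ∑ i, Z i = 0) :
    ∑ i, ‖∑ j, P i j • Z j‖ ^ 2 ≤ sigma2 P ^ 2 * ∑ i, ‖Z i‖ ^ 2 := by
  have swap : ∀ Y : Fin n → Vec d, ∑ i, ‖Y i‖ ^ 2 = ∑ k, ∑ i, Y i k ^ 2 := fun Y => by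
    simp only [EuclideanSpace.real_norm_sq_eq]
    exact Finset.sum_comm
  rw [swap fun i => ∑ j, P i j • Z j, swap Z, Finset.mul_sum]
  refine Finset.sum_le_sum fun k _ => ?_
  have hk : ∑ i, (Z i) k = 0 := by
    have := congrArg (fun y : Vec d => y k) hZ
    simpa using this
  have h := hP.sum_sq_le hσ (WithLp.toLp 2 fun i => Z i k) hk
  simp only [EuclideanSpace.real_norm_sq_eq] at h
  refine le_trans (le_of_eq (Finset.sum_congr rfl fun i _ => ?_)) h
  simp [Matrix.toLpLin_apply, Matrix.mulVec, dotProduct]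

theorem IsWeightMatrix.netAvg_sum {n d : ℕ} {E : Set (Fin n × Fin n)}
    {P : Matrix (Fin n) (Fin n) ℝ} (hP : IsWeightMatrix E P) (Z : Fin n → Vec d) :
    netAvg (fun i => ∑ j, P i j • Z j) = netAvg Z := by
  rw [netAvg, netAvg, Finset.sum_comm]
  congr 1
  refine Finset.sum_congr rfl fun j _ => ?_
  rw [← Finset.sum_smul, hP.col_sum, one_smul]

/-- One round of gossip contracts the deviation by the factor `sigma2 P`. -/
theorem IsWeightMatrix.netDev_step {n d : ℕ} {E : Set (Fin n × Fin n)}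
    {P : Matrix (Fin n) (Fin n) ℝ} (hP : IsWeightMatrix E P) (hσ : sigma2 P < 1)
    (Z W : Fin n → Vec d) :
    netDev (fun i => ∑ j, P i j • Z j + W i) ≤ sigma2 P * netDev Z + √(∑ i, ‖W i‖ ^ 2) := by
  have hσ0 : 0 ≤ sigma2 P := (Matrix.toEuclideanLin P).singularValues_nonneg 1
  set X : PiLp 2 (fun _ : Fin n => Vec d) :=
    WithLp.toLp 2 fun i => ∑ j, P i j • (Z j - netAvg Z) with hX
  set Y : PiLp 2 (fun _ : Fin n => Vec d) := WithLp.toLp 2 fun i => W i - netAvg W with hY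
  have h1 : netDev (fun i => ∑ j, P i j • Z j + W i) = ‖X + Y‖ := by
    rw [netDev, netAvg_add, hP.netAvg_sum, PiLp.norm_eq_of_L2]
    congr 1
    refine Finset.sum_congr rfl fun i _ => ?_
    congr 2
    simp only [hX, hY, PiLp.add_apply, smul_sub, Finset.sum_sub_distrib, ← Finset.sum_smul,
      hP.row_sum, one_smul]
    abel
  have h2 : ‖X‖ ≤ sigma2 P * netDev Z := by
    rw [PiLp.norm_eq_of_L2, netDev, ← Real.sqrt_sq hσ0, ← Real.sqrt_mul (sq_nonneg _)]
    exact Real.sqrt_le_sqrt (hP.sum_norm_sq_le hσ _ (sum_sub_netAvg Z))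
  have h3 : ‖Y‖ ≤ √(∑ i, ‖W i‖ ^ 2) := by
    rw [PiLp.norm_eq_of_L2]
    exact Real.sqrt_le_sqrt (sum_sq_sub_netAvg_le W)
  rw [h1]
  exact (norm_add_le X Y).trans (add_le_add h2 h3)

/-- The weights vanish off the graph, so that the sum over the neighbours is the full sum. -/
theorem IsWeightMatrix.sum_neighbors {n d : ℕ} {E : Set (Fin n × Fin n)}
    {P : Matrix (Fin n) (Fin n) ℝ} (hP : IsWeightMatrix E P) (Z : Fin n → Vec d) (i : Fin n) :
    ∑ j ∈ neighbors E i, P i j • Z j = ∑ j, P i j • Z j := by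
  refine Finset.sum_subset (Finset.subset_univ _) fun j _ hj => ?_
  have : ¬ 0 < P i j := fun h => hj (by simpa [neighbors] using hP.support i j h)
  rw [le_antisymm (not_lt.1 this) (hP.nonneg i j), zero_smul]

end DBBCG

namespace DBBCG

open Filter Topology Metric

/-! ### The history and independence of the future directions -/

section History

variable {Ω : Type*} {d n : ℕ}

theorem history_mono (u : ℕ → Fin n → Ω → UnitSphere d) {s t : ℕ} (h : s ≤ t) :
    history u s ≤ history u t :=
  biSup_mono fun _ hk => ⟨hk.1, hk.2.trans h⟩

theorem measurable_history (u : ℕ → Fin n → Ω → UnitSphere d) {s t : ℕ} (hs : 1 ≤ s)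
    (hst : s ≤ t) (j : Fin n) : Measurable[history u t] (u s j) := by
  rw [measurable_iff_comap_le]
  exact le_iSup₂_of_le s ⟨hs, hst⟩
    (le_iSup (fun j => MeasurableSpace.comap (u s j) inferInstance) j)

theorem history_le [mΩ : MeasurableSpace Ω] {u : ℕ → Fin n → Ω → UnitSphere d} {T t : ℕ}
    (hu : ∀ t ∈ Finset.Icc 1 T, ∀ i, Measurable (u t i)) (ht : t ≤ T) : history u t ≤ mΩ :=
  iSup₂_le fun s hs => iSup_le fun j =>
    measurable_iff_comap_le.1 (hu s (Finset.mem_Icc.2 ⟨hs.1, hs.2.trans ht⟩) j)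

theorem indep_history [mΩ : MeasurableSpace Ω] {μ : Measure Ω}
    {u : ℕ → Fin n → Ω → UnitSphere d} {T t : ℕ}
    (hu : ∀ t ∈ Finset.Icc 1 T, ∀ i, Measurable (u t i))
    (hind : iIndepFun (fun (p : Finset.Icc 1 T × Fin n) => u p.1 p.2) μ)
    (ht1 : 1 ≤ t) (htT : t ≤ T) (j : Fin n) :
    Indep (history u (t - 1)) (MeasurableSpace.comap (u t j) inferInstance) μ := by
  set mm : (Finset.Icc 1 T × Fin n) → MeasurableSpace Ω :=
    fun p => MeasurableSpace.comap (u p.1 p.2) inferInstance with hmm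
  have hind' : iIndep mm μ := hind
  have hle : ∀ p, mm p ≤ mΩ := fun p => measurable_iff_comap_le.1 (hu p.1 p.1.2 p.2)
  set p₀ : Finset.Icc 1 T × Fin n := (⟨t, Finset.mem_Icc.2 ⟨ht1, htT⟩⟩, j) with hp₀
  have hdisj : Disjoint {p : Finset.Icc 1 T × Fin n | p.1.1 ≤ t - 1} {p₀} := by
    rw [Set.disjoint_singleton_right]
    simp only [Set.mem_ofPred_eq, hp₀]
    omega
  have h := indep_iSup_of_disjoint hle hind' hdisj
  refine indep_of_indep_of_le_left (indep_of_indep_of_le_right h ?_) ?_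
  · exact le_iSup₂_of_le p₀ (Set.mem_singleton _) le_rfl
  · refine iSup₂_le fun s hs => iSup_le fun i => ?_
    have hs2 : s ≤ t - 1 := hs.2
    exact le_iSup₂_of_le (f := fun p (_ : p ∈ {p : Finset.Icc 1 T × Fin n | p.1.1 ≤ t - 1}) => mm p)
      (⟨s, Finset.mem_Icc.2 ⟨hs.1, by omega⟩⟩, i) hs2 le_rfl

/-- Freezing lemma: a function of the past and of an independent uniform direction has the same
expectation as its average over the direction. -/
theorem integral_eq_integral_uniformSphere {m : MeasurableSpace Ω}
    [mΩ : MeasurableSpace Ω] [NeZero d] {μ : Measure Ω}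
    [IsProbabilityMeasure μ] (hm : m ≤ mΩ) {U : Ω → UnitSphere d}
    (hU : Measurable U) (hlaw : μ.map U = uniformSphere d)
    (hind : Indep m (MeasurableSpace.comap U inferInstance) μ)
    {X W : Ω → Vec d} (hX : Measurable[m] X) (hW : Measurable[m] W)
    {Ψ : Vec d × Vec d → UnitSphere d → ℝ}
    (hΨ : Continuous fun p : (Vec d × Vec d) × UnitSphere d => Ψ p.1 p.2)
    (hint : Integrable (fun ω => Ψ (X ω, W ω) (U ω)) μ) :
    Integrable (fun ω => ∫ s, Ψ (X ω, W ω) s ∂uniformSphere d) μ ∧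
      ∫ ω, Ψ (X ω, W ω) (U ω) ∂μ = ∫ ω, ∫ s, Ψ (X ω, W ω) s ∂uniformSphere d ∂μ := by
  have hXW : Measurable[m] fun ω => (X ω, W ω) := hX.prodMk hW
  have hXW' : Measurable fun ω => (X ω, W ω) := hXW.mono hm le_rfl
  have hindF : IndepFun (fun ω => (X ω, W ω)) U μ := by
    rw [IndepFun_iff_Indep]
    exact indep_of_indep_of_le_left hind (measurable_iff_comap_le.1 hXW)
  have hprod := (indepFun_iff_map_prod_eq_prod_map_map hXW'.aemeasurable hU.aemeasurable).1 hindF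
  rw [hlaw] at hprod
  have hpair : Measurable fun ω => ((X ω, W ω), U ω) := hXW'.prodMk hU
  have hprob : IsProbabilityMeasure (μ.map fun ω => (X ω, W ω)) :=
    Measure.isProbabilityMeasure_map hXW'.aemeasurable
  have hmeas : AEStronglyMeasurable (fun p : (Vec d × Vec d) × UnitSphere d => Ψ p.1 p.2)
      (μ.map fun ω => ((X ω, W ω), U ω)) := hΨ.measurable.aestronglyMeasurable
  have hint' : Integrable (fun p : (Vec d × Vec d) × UnitSphere d => Ψ p.1 p.2)
      ((μ.map fun ω => (X ω, W ω)).prod (uniformSphere d)) := by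
    rw [← hprod]
    exact (integrable_map_measure hmeas hpair.aemeasurable).2 hint
  have hleft := hint'.integral_prod_left
  refine ⟨(integrable_map_measure hleft.aestronglyMeasurable hXW'.aemeasurable).1 hleft, ?_⟩
  have e1 : ∫ ω, Ψ (X ω, W ω) (U ω) ∂μ =
      ∫ p, Ψ p.1 p.2 ∂(μ.map fun ω => ((X ω, W ω), U ω)) :=
    (integral_map hpair.aemeasurable hmeas).symm
  rw [e1, hprod, integral_prod _ hint', integral_map hXW'.aemeasurable hleft.aestronglyMeasurable]

/-- Conditionally on the past, the one-point estimate may be replaced by its mean. -/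
theorem integral_inner_onePoint {m : MeasurableSpace Ω}
    [mΩ : MeasurableSpace Ω] [NeZero d] {μ : Measure Ω}
    [IsProbabilityMeasure μ] (hm : m ≤ mΩ) {U : Ω → UnitSphere d}
    (hU : Measurable U) (hlaw : μ.map U = uniformSphere d)
    (hind : Indep m (MeasurableSpace.comap U inferInstance) μ)
    {X W : Ω → Vec d} (hX : Measurable[m] X) (hW : Measurable[m] W)
    (δ : ℝ) {F : Vec d → ℝ} (hF : Continuous F)
    (hint : Integrable (fun ω => ⟪onePoint δ F (X ω) (U ω : Vec d), W ω⟫) μ) :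
    Integrable (fun ω => ⟪meanEstimate δ F (X ω), W ω⟫) μ ∧
      ∫ ω, ⟪onePoint δ F (X ω) (U ω : Vec d), W ω⟫ ∂μ =
        ∫ ω, ⟪meanEstimate δ F (X ω), W ω⟫ ∂μ := by
  have hcont : Continuous fun p : (Vec d × Vec d) × UnitSphere d =>
      ⟪onePoint δ F p.1.1 (p.2 : Vec d), p.1.2⟫ := by
    refine Continuous.inner ?_ (by fun_prop)
    exact (continuous_onePoint δ hF).comp ((continuous_fst.fst).prodMk continuous_snd)
  have h := integral_eq_integral_uniformSphere
    (Ψ := fun p s => ⟪onePoint δ F p.1 (s : Vec d), p.2⟫) hm hU hlaw hind hX hW hcont hint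
  have e : ∀ ω, ∫ s, ⟪onePoint δ F (X ω) (s : Vec d), W ω⟫ ∂uniformSphere d =
      ⟪meanEstimate δ F (X ω), W ω⟫ := fun ω => by
    rw [meanEstimate, real_inner_comm, ← integral_inner (integrable_onePoint δ hF (X ω)) (W ω)]
    simp only [real_inner_comm]
  simpa only [e] using h

end History

theorem measurable_onePoint {Ω : Type*} [MeasurableSpace Ω] {d : ℕ} (δ : ℝ) {F : Vec d → ℝ}
    (hF : Continuous F) {X : Ω → Vec d} {U : Ω → UnitSphere d} (hX : Measurable X)
    (hU : Measurable U) : Measurable fun ω => onePoint δ F (X ω) (U ω : Vec d) :=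
  (continuous_onePoint δ hF).measurable.comp (hX.prodMk hU)

/-- The iterates inherit measurability from the linear optimization solutions: the line search, whose
minimizer is not assumed measurable, enters through its closed form only. -/
theorem IsCG.measurable {Ω : Type*} [MeasurableSpace Ω] {d L : ℕ} {S : Set (Vec d)}
    {F : Ω → Vec d → ℝ} {x q : Ω → Vec d} {v c : ℕ → Ω → Vec d} {a : ℝ} (ha : 0 < a)
    (hF : ∀ ω, ∃ k, ∀ y, F ω y = a / 2 * ‖y - q ω‖ ^ 2 + k)
    (h : ∀ ω, IsCG S L (F ω) (x ω) (fun τ => v τ ω) (fun τ => c τ ω))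
    (hx : Measurable x) (hq : Measurable q) (hv : ∀ τ < L, Measurable (v τ)) :
    ∀ τ ≤ L, Measurable (c τ) := by
  intro τ
  induction τ with
  | zero =>
    intro _
    have : c 0 = x := funext fun ω => (h ω).1
    rwa [this]
  | succ τ ih =>
    intro hτ
    have hc := ih (by omega)
    have hv' := hv τ (by omega)
    have e : c (τ + 1) = fun ω => c τ ω +
        (max 0 (min 1 (⟪q ω - c τ ω, v τ ω - c τ ω⟫ / ‖v τ ω - c τ ω‖ ^ 2))) •
          (v τ ω - c τ ω) := by
      funext ω
      obtain ⟨_, s, hs, hmin, hstep⟩ := (h ω).2 τ (by omega)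
      obtain ⟨k, hk⟩ := hF ω
      simp only [hstep, lineSearch_smul_eq ha hk hs hmin]
    rw [e]
    have hw : Measurable fun ω => v τ ω - c τ ω := hv'.sub hc
    have hi : Measurable fun ω => ⟪q ω - c τ ω, v τ ω - c τ ω⟫ := (hq.sub hc).inner hw
    exact hc.add ((measurable_const.max (measurable_const.min
      (hi.div (hw.norm.pow_const 2)))).smul hw)

end DBBCG

namespace DBBCG

open Filter Topology Metric

/-! ### The shrunk decision set and the blocks -/

section Shrink

variable {d : ℕ} {𝒦 : Set (Vec d)} {δ r R : ℝ}

theorem convex_shrink (hc : Convex ℝ 𝒦) : Convex ℝ (shrink 𝒦 δ r) := hc.smul _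

theorem isClosed_shrink (hcl : IsClosed 𝒦) (hne : 𝒦.Nonempty) : IsClosed (shrink 𝒦 δ r) := by
  rcases eq_or_ne (1 - δ / r) 0 with h | h
  · rw [shrink, h, Set.zero_smul_set hne]
    exact isClosed_singleton
  · exact hcl.smul_of_ne_zero h

theorem smul_mem_shrink {k : Vec d} (hk : k ∈ 𝒦) : (1 - δ / r) • k ∈ shrink 𝒦 δ r :=
  Set.smul_mem_smul_set hk

/-- Points played from the shrunk set stay in `𝒦`: a point of `(1 - δ / r) • 𝒦` plus
`δ • v = (δ / r) • (r • v)` is a convex combination of points of `𝒦`. -/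
theorem add_smul_mem_of_mem_shrink (hc : Convex ℝ 𝒦) (hr : 0 < r) (hδ : 0 ≤ δ) (hδr : δ ≤ r)
    (hball : closedBall 0 r ⊆ 𝒦) {y : Vec d} (hy : y ∈ shrink 𝒦 δ r) {v : Vec d} (hv : ‖v‖ ≤ 1) :
    y + δ • v ∈ 𝒦 := by
  obtain ⟨k, hk, rfl⟩ := hy
  have h1 : r • v ∈ 𝒦 := hball (by
    rw [mem_closedBall_zero_iff, norm_smul, Real.norm_of_nonneg hr.le]
    exact mul_le_of_le_one_right hr.le hv)
  have h2 : δ / r ≤ 1 := (div_le_one hr).2 hδr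
  have h3 := hc hk h1 (sub_nonneg.2 h2) (div_nonneg hδ hr.le) (by ring)
  rwa [smul_smul, div_mul_cancel₀ _ hr.ne'] at h3

theorem shrink_subset (hc : Convex ℝ 𝒦) (hr : 0 < r) (hδ : 0 ≤ δ) (hδr : δ ≤ r)
    (hball : closedBall 0 r ⊆ 𝒦) : shrink 𝒦 δ r ⊆ 𝒦 := fun y hy => by
  simpa using add_smul_mem_of_mem_shrink hc hr hδ hδr hball hy (v := 0) (by simp)

end Shrink

theorem mem_block {K m t : ℕ} : t ∈ block K (m + 1) ↔ m * K + 1 ≤ t ∧ t ≤ m * K + K := by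
  simp [block, add_mul]

theorem blockOf_eq {K m t : ℕ} (ht : t ∈ block K (m + 1)) : blockOf K t = m + 1 := by
  rw [mem_block] at ht
  rw [blockOf, Nat.div_eq_of_lt_le (k := m) (by omega) (by rw [add_mul]; omega)]

theorem card_block (K m : ℕ) : (block K (m + 1)).card = K := by
  simp [block, add_mul]

theorem sum_Icc_eq_sum_block {M : Type*} [AddCommMonoid M] (K N : ℕ) (a : ℕ → M) :
    ∑ t ∈ Finset.Icc 1 (N * K), a t = ∑ m ∈ Finset.Icc 1 N, ∑ t ∈ block K m, a t := by
  induction N with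
  | zero => simp
  | succ N ih =>
    rw [Finset.sum_Icc_succ_top (by omega), ← ih]
    have : Finset.Icc 1 ((N + 1) * K) = Finset.Icc 1 (N * K) ∪ block K (N + 1) := by
      ext t
      rw [Finset.mem_union, mem_block, Finset.mem_Icc, Finset.mem_Icc, add_mul]
      omega
    rw [this, Finset.sum_union]
    rw [Finset.disjoint_left]
    intro t h1 h2
    rw [mem_block] at h2
    rw [Finset.mem_Icc] at h1
    omega

/-! ### Runs with globally Lipschitz losses -/

theorem IsRun.x_mem {Ω : Type*} {d n : ℕ} {𝒦 : Set (Vec d)} {E : Set (Fin n × Fin n)}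
    {P : Matrix (Fin n) (Fin n) ℝ} {r α h δ : ℝ} {K L T : ℕ} {x₀ : Vec d}
    {f : ℕ → Fin n → Vec d → ℝ} {u : ℕ → Fin n → Ω → UnitSphere d}
    {x z : ℕ → Fin n → Ω → Vec d} {v w : ℕ → Fin n → ℕ → Ω → Vec d}
    (H : IsRun 𝒦 E P r α h δ K L T x₀ f u x z v w) (hc : Convex ℝ 𝒦) {m : ℕ} (hm : m * K ≤ T)
    (i : Fin n) (ω : Ω) : x (m + 1) i ω ∈ shrink 𝒦 δ r := by
  induction m with
  | zero => rw [zero_add, H.x_one]; exact H.init_mem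
  | succ m ih =>
    rw [H.x_succ (m + 1) (by omega) hm]
    refine (H.cg (m + 1) (by omega) hm i ω).mem (convex_shrink hc) (ih ?_) L le_rfl
    exact le_trans (Nat.mul_le_mul_right K (Nat.le_succ m)) hm

/-- A run of the algorithm in the setting of the theorem, with each loss replaced by a globally
Lipschitz function: losses are evaluated in `𝒦` only, so that a Lipschitz extension changes
nothing, and it removes all measurability issues. -/
structure RegularRun {Ω : Type*} {_ : MeasurableSpace Ω} {d n : ℕ} (𝒦 : Set (Vec d))
    (E : Set (Fin n × Fin n)) (P : Matrix (Fin n) (Fin n) ℝ) (α : ℝ) (C : NNReal) (M R r : ℝ)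
    (K T : ℕ) (δ : ℝ) (x₀ : Vec d) (μ : Measure Ω) (f : ℕ → Fin n → Vec d → ℝ)
    (u : ℕ → Fin n → Ω → UnitSphere d) (x z : ℕ → Fin n → Ω → Vec d)
    (v w : ℕ → Fin n → ℕ → Ω → Vec d) : Prop where
  run : IsRun 𝒦 E P r α (α * K) δ K K T x₀ f u x z v w
  weight : IsWeightMatrix E P
  sigma2_lt : sigma2 P < 1
  convex : Convex ℝ 𝒦
  closed : IsClosed 𝒦
  ball_subset : closedBall 0 r ⊆ 𝒦
  subset_ball : 𝒦 ⊆ closedBall 0 R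
  block_pos : 1 ≤ K
  alpha_pos : 0 < α
  delta_pos : 0 < δ
  radius_pos : 0 < r
  delta_le : δ ≤ r
  lipschitz : ∀ t i, LipschitzWith C (f t i)
  strongConvex : ∀ t ∈ Finset.Icc 1 T, ∀ i, StrongConvexOn 𝒦 α (f t i)
  bounded : ∀ t ∈ Finset.Icc 1 T, ∀ i, ∀ a ∈ 𝒦, |f t i a| ≤ M
  measurable_dir : ∀ t ∈ Finset.Icc 1 T, ∀ i, Measurable (u t i)
  law_dir : ∀ t ∈ Finset.Icc 1 T, ∀ i, μ.map (u t i) = uniformSphere d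
  indep_dir : iIndepFun (fun (p : Finset.Icc 1 T × Fin n) => u p.1 p.2) μ

/-- The sum over block `m` of the gradient estimates of learner `i`. -/
noncomputable def blockGrad {Ω : Type*} {d n : ℕ} (δ : ℝ) (K : ℕ) (f : ℕ → Fin n → Vec d → ℝ)
    (u : ℕ → Fin n → Ω → UnitSphere d) (x : ℕ → Fin n → Ω → Vec d) (m : ℕ) (i : Fin n) (ω : Ω) :
    Vec d :=
  ∑ t ∈ block K m, onePoint δ (f t i) (x m i ω) (u t i ω)

/-- The minimizer over the shrunk set of the surrogate loss of block `m` with the average of the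
dual variables `z`: the decision of a central follow-the-regularized-leader player. As that loss is
an isotropic quadratic, its minimizer is a metric projection. -/
noncomputable def leader {Ω : Type*} {d n : ℕ} (𝒦 : Set (Vec d)) (α δ r : ℝ) (K : ℕ) (x₀ : Vec d)
    (z : ℕ → Fin n → Ω → Vec d) (m : ℕ) (ω : Ω) : Vec d :=
  metricProj (shrink 𝒦 δ r)
    ((((m : ℝ) + 1) * α * K)⁻¹ • ((2 * (α * K)) • x₀ - netAvg fun i => z m i ω))

/-- The gradient at the leader of the loss that block `m` contributes to the central player. -/
noncomputable def leaderGrad {Ω : Type*} {d n : ℕ} (𝒦 : Set (Vec d)) (α δ r : ℝ) (K : ℕ)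
    (x₀ : Vec d) (f : ℕ → Fin n → Vec d → ℝ) (u : ℕ → Fin n → Ω → UnitSphere d)
    (x z : ℕ → Fin n → Ω → Vec d) (m : ℕ) (ω : Ω) : Vec d :=
  netAvg fun i => blockGrad δ K f u x m i ω - (α * K) • x m i ω +
    (α * K) • leader 𝒦 α δ r K x₀ z m ω

namespace RegularRun

variable {Ω : Type*} {mΩ : MeasurableSpace Ω} {d n : ℕ} {𝒦 : Set (Vec d)}
  {E : Set (Fin n × Fin n)} {P : Matrix (Fin n) (Fin n) ℝ} {α : ℝ} {C : NNReal} {M R r : ℝ}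
  {K T : ℕ} {δ : ℝ} {x₀ : Vec d} {μ : Measure Ω} {f : ℕ → Fin n → Vec d → ℝ}
  {u : ℕ → Fin n → Ω → UnitSphere d} {x z : ℕ → Fin n → Ω → Vec d}
  {v w : ℕ → Fin n → ℕ → Ω → Vec d}

section Deterministic

variable (H : RegularRun 𝒦 E P α C M R r K T δ x₀ μ f u x z v w)
include H

theorem convex_set : Convex ℝ (shrink 𝒦 δ r) := convex_shrink H.convex

theorem nonempty_set : (shrink 𝒦 δ r).Nonempty := ⟨x₀, H.run.init_mem⟩

theorem closed_set : IsClosed (shrink 𝒦 δ r) :=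
  isClosed_shrink H.closed ⟨0, H.ball_subset (by simp [H.radius_pos.le])⟩

theorem subset_set : shrink 𝒦 δ r ⊆ 𝒦 :=
  shrink_subset H.convex H.radius_pos H.delta_pos.le H.delta_le H.ball_subset

theorem norm_le_of_mem {y : Vec d} (hy : y ∈ 𝒦) : ‖y‖ ≤ R := by
  simpa using H.subset_ball hy

theorem norm_le_of_mem_set {y : Vec d} (hy : y ∈ shrink 𝒦 δ r) : ‖y‖ ≤ R :=
  H.norm_le_of_mem (H.subset_set hy)

theorem R_nonneg : 0 ≤ R := (norm_nonneg x₀).trans (H.norm_le_of_mem_set H.run.init_mem)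

theorem diam_le {y y' : Vec d} (hy : y ∈ 𝒦) (hy' : y' ∈ 𝒦) : ‖y - y'‖ ≤ 2 * R := by
  have h1 := norm_sub_le y y'
  have h2 := H.norm_le_of_mem hy
  have h3 := H.norm_le_of_mem hy'
  linarith

theorem add_smul_mem {y : Vec d} (hy : y ∈ shrink 𝒦 δ r) {e : Vec d} (he : ‖e‖ ≤ 1) :
    y + δ • e ∈ 𝒦 :=
  add_smul_mem_of_mem_shrink H.convex H.radius_pos H.delta_pos.le H.delta_le H.ball_subset hy he

theorem add_dir_mem {y : Vec d} (hy : y ∈ shrink 𝒦 δ r) (e : UnitSphere d) :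
    y + δ • (e : Vec d) ∈ 𝒦 :=
  H.add_smul_mem hy (by simp)

theorem alpha_block_pos : 0 < α * K :=
  mul_pos H.alpha_pos (by exact_mod_cast H.block_pos)

theorem modulus_pos (m : ℕ) : 0 < ((m : ℝ) + 1) * α * K := by
  have h1 := H.alpha_pos
  have h2 : (0 : ℝ) < K := by exact_mod_cast H.block_pos
  positivity

/-- With `h = α K` the modulus of the surrogate loss of block `m` is `(m + 1) α K`. -/
theorem exists_surrogate_eq (m : ℕ) (ζ : Vec d) :
    ∃ k, ∀ y, surrogate α (α * K) K x₀ m ζ y = ((m : ℝ) + 1) * α * K / 2 *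
      ‖y - (((m : ℝ) + 1) * α * K)⁻¹ • ((2 * (α * K)) • x₀ - ζ)‖ ^ 2 + k := by
  have e : ((m : ℝ) - 1) * α * K + 2 * (α * K) = ((m : ℝ) + 1) * α * K := by ring
  have h := surrogate_eq (α := α) (h := α * K) (K := K) (m := m)
    (by rw [e]; exact (H.modulus_pos m).ne') x₀ ζ
  rwa [e] at h

theorem x_mem {m : ℕ} (hm : m * K ≤ T) (i : Fin n) (ω : Ω) : x (m + 1) i ω ∈ shrink 𝒦 δ r :=
  H.run.x_mem H.convex hm i ω

theorem leader_mem (m : ℕ) (ω : Ω) : leader 𝒦 α δ r K x₀ z m ω ∈ shrink 𝒦 δ r :=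
  (metricProj_spec H.nonempty_set H.convex_set H.closed_set _).1

theorem z_succ {m : ℕ} (hm : (m + 1) * K ≤ T) (i : Fin n) (ω : Ω) :
    z (m + 2) i ω = ∑ j, P i j • z (m + 1) j ω +
      (blockGrad δ K f u x (m + 1) i ω - (α * K) • x (m + 1) i ω) := by
  rw [H.run.z_succ (m + 1) (by omega) hm, H.weight.sum_neighbors fun j => z (m + 1) j ω, blockGrad,
    add_sub_assoc]

/-- Gossip with a doubly stochastic matrix preserves the average, so that the averaged dual variable
obeys a centralized update. -/
theorem netAvg_z_succ {m : ℕ} (hm : (m + 1) * K ≤ T) (ω : Ω) :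
    (netAvg fun i => z (m + 2) i ω) = (netAvg fun i => z (m + 1) i ω) +
      netAvg fun i => blockGrad δ K f u x (m + 1) i ω - (α * K) • x (m + 1) i ω := by
  simp only [H.z_succ hm]
  rw [netAvg_add, H.weight.netAvg_sum fun j => z (m + 1) j ω]

theorem leader_one (ω : Ω) : leader 𝒦 α δ r K x₀ z 1 ω = x₀ := by
  have h0 : (netAvg fun i => z 1 i ω) = 0 := by simp [netAvg, H.run.z_one]
  have h1 := H.alpha_block_pos
  have e : (((1 : ℕ) : ℝ) + 1) * α * K = 2 * (α * K) := by push_cast; ring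
  rw [leader, h0, sub_zero, e, inv_smul_smul₀ (by positivity)]
  have h2 := sq_dist_metricProj_add_le H.nonempty_set H.convex_set H.closed_set x₀ H.run.init_mem
  rw [sub_self, norm_zero] at h2
  have h3 : ‖x₀ - metricProj (shrink 𝒦 δ r) x₀‖ ^ 2 ≤ 0 := by
    nlinarith [sq_nonneg ‖metricProj (shrink 𝒦 δ r) x₀ - x₀‖]
  have h4 : ‖x₀ - metricProj (shrink 𝒦 δ r) x₀‖ = 0 := by
    nlinarith [norm_nonneg (x₀ - metricProj (shrink 𝒦 δ r) x₀)]
  exact (sub_eq_zero.1 (norm_eq_zero.1 h4)).symm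

/-- The central surrogate loss grows quadratically around the leader. -/
theorem leader_growth (m : ℕ) (ω : Ω) {y : Vec d} (hy : y ∈ shrink 𝒦 δ r) :
    surrogate α (α * K) K x₀ m (netAvg fun i => z m i ω) (leader 𝒦 α δ r K x₀ z m ω) +
      ((m : ℝ) + 1) * α * K / 2 * ‖y - leader 𝒦 α δ r K x₀ z m ω‖ ^ 2 ≤
      surrogate α (α * K) K x₀ m (netAvg fun i => z m i ω) y := by
  obtain ⟨k, hk⟩ := H.exists_surrogate_eq m (netAvg fun i => z m i ω)
  rw [hk, hk]
  have h := sq_dist_metricProj_add_le H.nonempty_set H.convex_set H.closed_set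
    ((((m : ℝ) + 1) * α * K)⁻¹ • ((2 * (α * K)) • x₀ - netAvg fun i => z m i ω)) hy
  have h2 := mul_le_mul_of_nonneg_left h (half_pos (H.modulus_pos m)).le
  simp only [leader]
  linarith

/-- The central surrogate losses accumulate the block losses, linearized at the learners' decisions,
with their strong convexity. -/
theorem surrogate_succ {m : ℕ} (hm : (m + 1) * K ≤ T) (ω : Ω) (y : Vec d) :
    surrogate α (α * K) K x₀ (m + 2) (netAvg fun i => z (m + 2) i ω) y =
      surrogate α (α * K) K x₀ (m + 1) (netAvg fun i => z (m + 1) i ω) y +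
      (⟪netAvg fun i => blockGrad δ K f u x (m + 1) i ω - (α * K) • x (m + 1) i ω, y⟫ +
        α * K / 2 * ‖y‖ ^ 2) := by
  rw [surrogate, surrogate, H.netAvg_z_succ hm, inner_add_left]
  push_cast
  ring

end Deterministic

omit mΩ in
theorem leaderGrad_eq [NeZero n] (m : ℕ) (ω : Ω) : leaderGrad 𝒦 α δ r K x₀ f u x z m ω =
    (netAvg fun i => blockGrad δ K f u x m i ω - (α * K) • x m i ω) +
      (α * K) • leader 𝒦 α δ r K x₀ z m ω := by
  have hn : (n : ℝ) ≠ 0 := by exact_mod_cast NeZero.ne n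
  rw [leaderGrad, netAvg_add]
  congr 1
  simp [netAvg, ← Nat.cast_smul_eq_nsmul ℝ, smul_smul, hn]

omit mΩ in
/-- `leaderGrad` is a subgradient at the leader of the loss added by block `m`. -/
theorem block_loss_gradient_le [NeZero n] (hαK : 0 ≤ α * K) (m : ℕ) (ω : Ω) (y : Vec d) :
    ⟪netAvg fun i => blockGrad δ K f u x m i ω - (α * K) • x m i ω,
        leader 𝒦 α δ r K x₀ z m ω⟫ + α * K / 2 * ‖leader 𝒦 α δ r K x₀ z m ω‖ ^ 2 +
      ⟪leaderGrad 𝒦 α δ r K x₀ f u x z m ω, y - leader 𝒦 α δ r K x₀ z m ω⟫ ≤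
    ⟪netAvg fun i => blockGrad δ K f u x m i ω - (α * K) • x m i ω, y⟫ +
      α * K / 2 * ‖y‖ ^ 2 := by
  rw [leaderGrad_eq]
  set p := leader 𝒦 α δ r K x₀ z m ω
  have h : ‖y‖ ^ 2 = ‖p‖ ^ 2 + 2 * ⟪p, y - p⟫ + ‖y - p‖ ^ 2 := by
    have := norm_add_sq_real p (y - p)
    rwa [add_sub_cancel] at this
  rw [h, inner_add_left, inner_smul_left, inner_sub_right]
  simp only [conj_trivial]
  have : 0 ≤ α * K * ‖y - p‖ ^ 2 := by positivity
  linarith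

end RegularRun

end DBBCG

namespace DBBCG

open Filter Topology Metric

/-! ### Pathwise bounds -/

namespace RegularRun

variable {Ω : Type*} {mΩ : MeasurableSpace Ω} {d n : ℕ} {𝒦 : Set (Vec d)}
  {E : Set (Fin n × Fin n)} {P : Matrix (Fin n) (Fin n) ℝ} {α : ℝ} {C : NNReal} {M R r : ℝ}
  {K T : ℕ} {δ : ℝ} {x₀ : Vec d} {μ : Measure Ω} {f : ℕ → Fin n → Vec d → ℝ}
  {u : ℕ → Fin n → Ω → UnitSphere d} {x z : ℕ → Fin n → Ω → Vec d}
  {v w : ℕ → Fin n → ℕ → Ω → Vec d}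

section Deterministic

variable (H : RegularRun 𝒦 E P α C M R r K T δ x₀ μ f u x z v w)
include H

/-- The regret of the linearized, strongly convex block losses is controlled by the distances of
the learners to the central leader and the size of the block gradients. -/
theorem sum_linearized_le [NeZero n] (ω : Ω) {y : Vec d} (hy : y ∈ shrink 𝒦 δ r) :
    ∑ m ∈ Finset.Icc 1 (T / K), ∑ j, (⟪blockGrad δ K f u x m j ω, x m j ω - y⟫ -
        α * K / 2 * ‖x m j ω - y‖ ^ 2) ≤
      ∑ m ∈ Finset.Icc 1 (T / K), ∑ j,
        ⟪blockGrad δ K f u x m j ω, x m j ω - leader 𝒦 α δ r K x₀ z m ω⟫ +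
      n * (4 * (α * K) * R ^ 2) +
      ∑ m ∈ Finset.Icc 1 (T / K),
        n * (‖leaderGrad 𝒦 α δ r K x₀ f u x z m ω‖ ^ 2 / (2 * (((m : ℝ) + 1) * α * K))) := by
  have hαK := H.alpha_block_pos
  set p : ℕ → Vec d := fun m => leader 𝒦 α δ r K x₀ z m ω with hp
  set g : ℕ → Vec d := fun m => leaderGrad 𝒦 α δ r K x₀ f u x z m ω with hg
  set ℓ : ℕ → Vec d → ℝ := fun m y =>
    ⟪netAvg fun i => blockGrad δ K f u x m i ω - (α * K) • x m i ω, y⟫ +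
      α * K / 2 * ‖y‖ ^ 2 with hℓ
  set Φ : ℕ → Vec d → ℝ := fun m => surrogate α (α * K) K x₀ m (netAvg fun i => z m i ω) with hΦ
  have hreg : ∑ m ∈ Finset.Icc 1 (T / K), (ℓ m (p m) - ℓ m y) ≤
      Φ 1 y - Φ 1 (p 1) + ∑ m ∈ Finset.Icc 1 (T / K),
        ‖g m‖ ^ 2 / (2 * (((m : ℝ) + 1) * α * K)) := by
    refine leader_regret_le (S := shrink 𝒦 δ r) (fun m _ => H.modulus_pos m)
      (fun m => H.leader_mem m ω) (fun m _ y hy => H.leader_growth m ω hy) ?_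
      (fun m _ _ y _ => block_loss_gradient_le hαK.le m ω y) hy
    intro m h1 h2 y
    obtain ⟨m, rfl⟩ : ∃ m', m = m' + 1 := ⟨m - 1, by omega⟩
    exact H.surrogate_succ (Nat.mul_le_of_le_div _ _ _ h2) ω y
  have hΦ1 : Φ 1 y - Φ 1 (p 1) ≤ 4 * (α * K) * R ^ 2 := by
    have h0 : (netAvg fun i => z 1 i ω) = 0 := by simp [netAvg, H.run.z_one]
    have h1 : p 1 = x₀ := H.leader_one ω
    simp only [hΦ, h0, h1, surrogate, inner_zero_left, sub_self, norm_zero]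
    have h2 := pow_le_pow_left₀ (norm_nonneg _)
      (H.diam_le (H.subset_set hy) (H.subset_set H.run.init_mem)) 2
    have h3 := mul_le_mul_of_nonneg_left h2 hαK.le
    simp
    linarith
  -- the two sides differ by `α K / 2 * ∑ j, ‖x m j - p m‖ ^ 2`
  have hterm : ∀ m, ∑ j, (⟪blockGrad δ K f u x m j ω, x m j ω - y⟫ -
        α * K / 2 * ‖x m j ω - y‖ ^ 2) ≤
      ∑ j, ⟪blockGrad δ K f u x m j ω, x m j ω - p m⟫ + n * (ℓ m (p m) - ℓ m y) := by
    intro m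
    have hn : ∀ y, n * ℓ m y = ∑ j, (⟪blockGrad δ K f u x m j ω - (α * K) • x m j ω, y⟫ +
        α * K / 2 * ‖y‖ ^ 2) := by
      intro y
      have e := sum_eq_smul_netAvg fun i => blockGrad δ K f u x m i ω - (α * K) • x m i ω
      rw [Finset.sum_add_distrib, ← sum_inner, e, inner_smul_left]
      simp [hℓ]
      ring
    rw [mul_sub, hn, hn, ← Finset.sum_sub_distrib, ← Finset.sum_add_distrib]
    refine Finset.sum_le_sum fun j _ => ?_
    have h1 : 0 ≤ α * K / 2 * ‖x m j ω - p m‖ ^ 2 := by positivity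
    rw [norm_sub_sq_real] at h1
    rw [norm_sub_sq_real]
    simp only [inner_sub_left, inner_sub_right, inner_smul_left, conj_trivial]
    linarith
  refine (Finset.sum_le_sum fun m _ => hterm m).trans ?_
  rw [Finset.sum_add_distrib, ← Finset.mul_sum, ← Finset.mul_sum, add_assoc, ← mul_add]
  gcongr
  linarith

/-- Distance between a learner and the central leader: the optimization error of the conditional
gradient method, the consensus error, and the drift of the leader, which is one block ahead. -/
theorem norm_sub_leader_le [NeZero n] {m : ℕ} (hm : (m + 1) * K ≤ T) (j : Fin n) (ω : Ω) :
    ‖x (m + 2) j ω - leader 𝒦 α δ r K x₀ z (m + 2) ω‖ ≤ 4 * R / √K +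
      (netDev (fun i => z (m + 1) i ω) + 2 * ‖leaderGrad 𝒦 α δ r K x₀ f u x z (m + 1) ω‖) /
        (((m : ℝ) + 2) * α * K) := by
  have hm' : m * K ≤ T := le_trans (Nat.mul_le_mul_right K (Nat.le_succ m)) hm
  have ha := H.modulus_pos (m + 1)
  have ea : (((m + 1 : ℕ) : ℝ) + 1) * α * K = ((m : ℝ) + 2) * α * K := by push_cast; ring
  set q : Vec d → Vec d := fun ζ =>
    ((((m + 1 : ℕ) : ℝ) + 1) * α * K)⁻¹ • ((2 * (α * K)) • x₀ - ζ) with hq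
  have h1 : ‖x (m + 2) j ω - metricProj (shrink 𝒦 δ r) (q (z (m + 1) j ω))‖ ≤ 4 * R / √K := by
    obtain ⟨k, hk⟩ := H.exists_surrogate_eq (m + 1) (z (m + 1) j ω)
    rw [H.run.x_succ (m + 1) (by omega) hm]
    have := (H.run.cg (m + 1) (by omega) hm j ω).norm_sub_metricProj_le H.nonempty_set
      H.convex_set H.closed_set H.block_pos (H.x_mem hm' j ω) ha hk (D := 2 * R)
      (by linarith [H.R_nonneg])
      (fun a ha b hb => H.diam_le (H.subset_set ha) (H.subset_set hb))
    refine this.trans (le_of_eq ?_)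
    ring
  have h2 : ‖metricProj (shrink 𝒦 δ r) (q (z (m + 1) j ω)) - leader 𝒦 α δ r K x₀ z (m + 1) ω‖ ≤
      netDev (fun i => z (m + 1) i ω) / (((m : ℝ) + 2) * α * K) := by
    refine (dist_metricProj_le H.nonempty_set H.convex_set H.closed_set _ _).trans ?_
    rw [← smul_sub, sub_sub_sub_cancel_left, norm_smul, norm_inv, Real.norm_of_nonneg ha.le, ea,
      inv_mul_eq_div, norm_sub_rev]
    rw [ea] at ha
    gcongr
    exact norm_sub_netAvg_le (fun i => z (m + 1) i ω) j
  have h3 : ‖leader 𝒦 α δ r K x₀ z (m + 2) ω - leader 𝒦 α δ r K x₀ z (m + 1) ω‖ ≤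
      2 * ‖leaderGrad 𝒦 α δ r K x₀ f u x z (m + 1) ω‖ / (((m : ℝ) + 2) * α * K) := by
    rw [← ea]
    refine leader_step_le (S := shrink 𝒦 δ r) (m := m + 1)
      (a := fun m : ℕ => ((m : ℝ) + 1) * α * K)
      (p := fun m => leader 𝒦 α δ r K x₀ z m ω)
      (g := fun m => leaderGrad 𝒦 α δ r K x₀ f u x z m ω)
      (Φ := fun m => surrogate α (α * K) K x₀ m (netAvg fun i => z m i ω))
      (ℓ := fun m y => ⟪netAvg fun i => blockGrad δ K f u x m i ω - (α * K) • x m i ω, y⟫ +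
        α * K / 2 * ‖y‖ ^ 2) ha (H.leader_mem _ ω) (H.leader_mem _ ω)
      (fun m y hy => H.leader_growth m ω hy) (H.modulus_pos _).le
      (fun y => H.surrogate_succ hm ω y)
      (fun y _ => block_loss_gradient_le H.alpha_block_pos.le (m + 1) ω y)
  rw [norm_sub_rev] at h3
  rw [add_div]
  calc _ = ‖(x (m + 2) j ω - metricProj (shrink 𝒦 δ r) (q (z (m + 1) j ω))) +
        (metricProj (shrink 𝒦 δ r) (q (z (m + 1) j ω)) - leader 𝒦 α δ r K x₀ z (m + 1) ω) +
        (leader 𝒦 α δ r K x₀ z (m + 1) ω - leader 𝒦 α δ r K x₀ z (m + 2) ω)‖ := by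
          congr 1; abel
    _ ≤ _ := (norm_add₃_le).trans (by linarith)

theorem abs_sub_le (t : ℕ) (j : Fin n) (a b : Vec d) : |f t j a - f t j b| ≤ C * ‖a - b‖ := by
  have := (H.lipschitz t j).dist_le_mul a b
  rwa [Real.dist_eq, dist_eq_norm] at this

theorem played_mem {m t : ℕ} (hm : m * K ≤ T) (ht : t ∈ block K (m + 1)) (i : Fin n)
    (ω : Ω) : played δ K u x i t ω ∈ 𝒦 := by
  rw [played, blockOf_eq ht]
  exact H.add_dir_mem (H.x_mem hm i ω) _

theorem exists_block {t : ℕ} (h1 : 1 ≤ t) (h2 : t ≤ T) :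
    ∃ m, m * K ≤ T ∧ t ∈ block K (m + 1) := by
  have hK := H.block_pos
  refine ⟨(t - 1) / K, ?_, ?_⟩
  · have := Nat.div_mul_le_self (t - 1) K
    omega
  · rw [mem_block]
    have h3 := Nat.div_add_mod (t - 1) K
    have h4 := Nat.mod_lt (t - 1) (show 0 < K by omega)
    rw [mul_comm] at h3
    omega

/-- Pathwise, the regret against a fixed point is the regret of the learners' own block decisions
for their own losses, up to disagreement, smoothing and shrinking errors and a partial block. -/
theorem sum_loss_sub_le (i : Fin n) (ω : Ω) {y : Vec d} (hy : y ∈ 𝒦) :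
    ∑ t ∈ Finset.Icc 1 T, (globalLoss f t (played δ K u x i t ω) - globalLoss f t y) ≤
      ∑ m ∈ Finset.Icc 1 (T / K), ∑ j, (∑ t ∈ block K m,
          (f t j (x m j ω) - f t j ((1 - δ / r) • y)) +
        K * C * (‖x m i ω - leader 𝒦 α δ r K x₀ z m ω‖ +
          ‖x m j ω - leader 𝒦 α δ r K x₀ z m ω‖)) +
      n * T * (C * δ * (1 + R / r)) + n * K * (2 * C * R) := by
  have hK := H.block_pos
  set N := T / K with hN
  have hNK : N * K ≤ T := Nat.div_mul_le_self T K
  have hTK : T ≤ N * K + K := by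
    have h1 := Nat.div_add_mod T K
    have h2 := Nat.mod_lt T (show 0 < K by omega)
    rw [mul_comm, ← hN] at h1
    omega
  have hsplit : Finset.Icc 1 T = Finset.Icc 1 (N * K) ∪ Finset.Ioc (N * K) T := by
    ext t
    rw [Finset.mem_union, Finset.mem_Icc, Finset.mem_Icc, Finset.mem_Ioc]
    omega
  have hdisj : Disjoint (Finset.Icc 1 (N * K)) (Finset.Ioc (N * K) T) := by
    rw [Finset.disjoint_left]
    intro t h1 h2
    rw [Finset.mem_Icc] at h1
    rw [Finset.mem_Ioc] at h2
    omega
  rw [hsplit, Finset.sum_union hdisj, sum_Icc_eq_sum_block]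
  have hCR : 0 ≤ 2 * (C : ℝ) * R := by have := H.R_nonneg; positivity
  have hCδ : 0 ≤ (C : ℝ) * δ * (1 + R / r) := by
    have h1 := H.R_nonneg; have h2 := H.radius_pos; have h3 := H.delta_pos
    positivity
  -- the incomplete last block has fewer than `K` rounds
  have hpartial : ∑ t ∈ Finset.Ioc (N * K) T,
      (globalLoss f t (played δ K u x i t ω) - globalLoss f t y) ≤ n * K * (2 * C * R) := by
    have hone : ∀ t ∈ Finset.Ioc (N * K) T,
        globalLoss f t (played δ K u x i t ω) - globalLoss f t y ≤ n * (2 * C * R) := by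
      intro t ht
      rw [Finset.mem_Ioc] at ht
      obtain ⟨m, hm, htm⟩ := H.exists_block (t := t) (by omega) ht.2
      rw [globalLoss, globalLoss, ← Finset.sum_sub_distrib]
      have : ∀ j ∈ (Finset.univ : Finset (Fin n)),
          f t j (played δ K u x i t ω) - f t j y ≤ 2 * C * R := fun j _ => by
        refine (le_abs_self _).trans ((H.abs_sub_le t j _ _).trans ?_)
        have := H.diam_le (H.played_mem hm htm i ω) hy
        have h2 := mul_le_mul_of_nonneg_left this C.coe_nonneg
        linarith
      refine (Finset.sum_le_card_nsmul _ _ _ this).trans (le_of_eq ?_)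
      simp
    refine (Finset.sum_le_card_nsmul _ _ _ hone).trans ?_
    rw [nsmul_eq_mul, Nat.card_Ioc]
    have : ((T - N * K : ℕ) : ℝ) ≤ K := by
      exact_mod_cast (show T - N * K ≤ K by omega)
    calc ((T - N * K : ℕ) : ℝ) * (n * (2 * C * R)) ≤ K * (n * (2 * C * R)) := by gcongr
      _ = _ := by ring
  have hblock : ∀ m ∈ Finset.Icc 1 N, ∑ t ∈ block K m,
      (globalLoss f t (played δ K u x i t ω) - globalLoss f t y) ≤
      ∑ j, (∑ t ∈ block K m, (f t j (x m j ω) - f t j ((1 - δ / r) • y)) +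
        K * C * (‖x m i ω - leader 𝒦 α δ r K x₀ z m ω‖ +
          ‖x m j ω - leader 𝒦 α δ r K x₀ z m ω‖)) + n * K * (C * δ * (1 + R / r)) := by
    intro m hm
    rw [Finset.mem_Icc] at hm
    obtain ⟨m, rfl⟩ : ∃ m', m = m' + 1 := ⟨m - 1, by omega⟩
    have hmK : m * K ≤ T := Nat.mul_le_of_le_div _ _ _ (by omega)
    set e : Fin n → ℝ := fun j => ‖x (m + 1) j ω - leader 𝒦 α δ r K x₀ z (m + 1) ω‖ with he
    have hone : ∀ t ∈ block K (m + 1), ∀ j,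
        f t j (played δ K u x i t ω) - f t j y ≤
        (f t j (x (m + 1) j ω) - f t j ((1 - δ / r) • y)) + C * (e i + e j) +
          C * δ * (1 + R / r) := by
      intro t ht j
      have h1 := (abs_le.1 (H.abs_sub_le t j (played δ K u x i t ω) (x (m + 1) j ω))).2
      have h2 := (abs_le.1 (H.abs_sub_le t j ((1 - δ / r) • y) y)).2
      have h3 : ‖(1 - δ / r) • y - y‖ ≤ δ / r * R := by
        have : (1 - δ / r) • y - y = -((δ / r) • y) := by module
        rw [this, norm_neg, norm_smul, Real.norm_of_nonneg
          (div_nonneg H.delta_pos.le H.radius_pos.le)]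
        exact mul_le_mul_of_nonneg_left (H.norm_le_of_mem hy)
          (div_nonneg H.delta_pos.le H.radius_pos.le)
      have h4 : ‖played δ K u x i t ω - x (m + 1) j ω‖ ≤ δ + (e i + e j) := by
        rw [played, blockOf_eq ht]
        have e1 : x (m + 1) i ω + δ • (u t i ω : Vec d) - x (m + 1) j ω =
            δ • (u t i ω : Vec d) + (x (m + 1) i ω - leader 𝒦 α δ r K x₀ z (m + 1) ω) -
              (x (m + 1) j ω - leader 𝒦 α δ r K x₀ z (m + 1) ω) := by abel
        rw [e1]
        refine (norm_sub_le _ _).trans ?_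
        have h5 := norm_add_le (δ • (u t i ω : Vec d))
          (x (m + 1) i ω - leader 𝒦 α δ r K x₀ z (m + 1) ω)
        have h6 : ‖δ • (u t i ω : Vec d)‖ = δ := by
          rw [norm_smul, Real.norm_of_nonneg H.delta_pos.le]; simp
        simp only [he]
        linarith
      have h7 := mul_le_mul_of_nonneg_left h3 C.coe_nonneg
      have h8 := mul_le_mul_of_nonneg_left h4 C.coe_nonneg
      have h9 : (C : ℝ) * δ * (1 + R / r) = C * δ + C * (δ / r * R) := by ring
      linarith
    calc ∑ t ∈ block K (m + 1), (globalLoss f t (played δ K u x i t ω) - globalLoss f t y)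
        = ∑ j, ∑ t ∈ block K (m + 1), (f t j (played δ K u x i t ω) - f t j y) := by
          rw [Finset.sum_comm]
          refine Finset.sum_congr rfl fun t _ => ?_
          rw [globalLoss, globalLoss, Finset.sum_sub_distrib]
      _ ≤ ∑ j, ∑ t ∈ block K (m + 1), ((f t j (x (m + 1) j ω) - f t j ((1 - δ / r) • y)) +
            C * (e i + e j) + C * δ * (1 + R / r)) :=
          Finset.sum_le_sum fun j _ => Finset.sum_le_sum fun t ht => hone t ht j
      _ = _ := by
          simp only [Finset.sum_add_distrib, Finset.sum_const, card_block, nsmul_eq_mul,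
            Finset.card_univ, Fintype.card_fin, ← Finset.mul_sum, he]
          ring
  refine (add_le_add (Finset.sum_le_sum hblock) hpartial).trans ?_
  rw [Finset.sum_add_distrib, Finset.sum_const, Nat.card_Icc, nsmul_eq_mul, Nat.add_sub_cancel]
  have : (N : ℝ) * (n * K * (C * δ * (1 + R / r))) ≤ n * T * (C * δ * (1 + R / r)) := by
    have h1 : (N : ℝ) * K ≤ T := by exact_mod_cast hNK
    calc (N : ℝ) * (n * K * (C * δ * (1 + R / r))) = n * (N * K) * (C * δ * (1 + R / r)) := by ring
      _ ≤ _ := by gcongr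
  linarith

end Deterministic

end RegularRun

end DBBCG

namespace DBBCG

open Filter Topology Metric

/-! ### Measurability and second moments -/

/-- Jensen's inequality `E X ≤ √(E X²)`. -/
theorem integral_le_of_integral_sq_le {Ω : Type*} [MeasurableSpace Ω] {μ : Measure Ω}
    [IsProbabilityMeasure μ] {X : Ω → ℝ} (hX : Integrable X μ)
    (hX2 : Integrable (fun ω => X ω ^ 2) μ) {q : ℝ} (hq : 0 ≤ q)
    (h : ∫ ω, X ω ^ 2 ∂μ ≤ q ^ 2) : ∫ ω, X ω ∂μ ≤ q := by
  have h1 : 0 ≤ ∫ ω, (X ω - ∫ ω, X ω ∂μ) ^ 2 ∂μ := integral_nonneg fun _ => sq_nonneg _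
  set e := ∫ ω, X ω ∂μ with he
  have h2 : ∫ ω, (X ω - e) ^ 2 ∂μ = ∫ ω, X ω ^ 2 ∂μ - e ^ 2 := by
    have : ∀ ω, (X ω - e) ^ 2 = X ω ^ 2 - (2 * e * X ω - e ^ 2) := fun ω => by ring
    have hlin : Integrable (fun ω => 2 * e * X ω - e ^ 2) μ :=
      (hX.const_mul _).sub (integrable_const _)
    simp only [this]
    rw [integral_sub hX2 hlin, integral_sub (hX.const_mul _) (integrable_const _),
      integral_const_mul, ← he]
    simp
    ring
  exact le_of_sq_le_sq (by linarith) hq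

theorem integrable_of_norm_le {Ω F : Type*} [MeasurableSpace Ω] {μ : Measure Ω}
    [IsFiniteMeasure μ] [NormedAddCommGroup F] [MeasurableSpace F] [BorelSpace F]
    [SecondCountableTopology F] {X : Ω → F} (hX : Measurable X) {B : ℝ} (hB : ∀ ω, ‖X ω‖ ≤ B) :
    Integrable X μ :=
  Integrable.of_bound hX.aestronglyMeasurable B (Eventually.of_forall hB)

theorem measurable_blockGrad {Ω : Type*} [MeasurableSpace Ω] {d n : ℕ} {δ : ℝ} {K : ℕ}
    {f : ℕ → Fin n → Vec d → ℝ} {u : ℕ → Fin n → Ω → UnitSphere d} {x : ℕ → Fin n → Ω → Vec d}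
    {m : ℕ} {i : Fin n} (hf : ∀ t, Continuous (f t i)) (hx : Measurable (x m i))
    (hu : ∀ t ∈ block K m, Measurable (u t i)) : Measurable (blockGrad δ K f u x m i) := by
  unfold blockGrad
  exact Finset.measurable_sum _ fun t ht => measurable_onePoint δ (hf t) hx (hu t ht)

theorem measurable_netAvg {Ω : Type*} [MeasurableSpace Ω] {d n : ℕ} {Z : Fin n → Ω → Vec d}
    (hZ : ∀ i, Measurable (Z i)) : Measurable fun ω => netAvg fun i => Z i ω := by
  unfold netAvg
  exact (Finset.measurable_sum _ fun i _ => hZ i).const_smul (n : ℝ)⁻¹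

theorem mem_Icc_of_mem_block {K T m t : ℕ} (hm : (m + 1) * K ≤ T) (ht : t ∈ block K (m + 1)) :
    t ∈ Finset.Icc 1 T := by
  rw [mem_block] at ht
  rw [add_mul] at hm
  rw [Finset.mem_Icc]
  omega

namespace RegularRun

variable {Ω : Type*} {mΩ : MeasurableSpace Ω} {d n : ℕ} {𝒦 : Set (Vec d)}
  {E : Set (Fin n × Fin n)} {P : Matrix (Fin n) (Fin n) ℝ} {α : ℝ} {C : NNReal} {M R r : ℝ}
  {K T : ℕ} {δ : ℝ} {x₀ : Vec d} {μ : Measure Ω} {f : ℕ → Fin n → Vec d → ℝ}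
  {u : ℕ → Fin n → Ω → UnitSphere d} {x z : ℕ → Fin n → Ω → Vec d}
  {v w : ℕ → Fin n → ℕ → Ω → Vec d}

section Measurability

variable (H : RegularRun 𝒦 E P α C M R r K T δ x₀ μ f u x z v w)
include H

theorem continuous_loss (t : ℕ) (i : Fin n) : Continuous (f t i) := (H.lipschitz t i).continuous

/-- The decisions and dual variables of a block are determined by the directions of the preceding
blocks. -/
theorem measurable_iterates {m : ℕ} (hm : m * K ≤ T) (i : Fin n) :
    Measurable[history u (m * K)] (x (m + 1) i) ∧
      Measurable[history u (m * K)] (z (m + 1) i) := by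
  induction m generalizing i with
  | zero =>
    have e1 : x 1 i = fun _ => x₀ := funext (H.run.x_one i)
    have e2 : z 1 i = fun _ => 0 := funext (H.run.z_one i)
    rw [e1, e2]
    exact ⟨measurable_const, measurable_const⟩
  | succ m ih =>
    have hle : m * K ≤ (m + 1) * K := Nat.mul_le_mul_right K (Nat.le_succ m)
    have hm' : m * K ≤ T := hle.trans hm
    have hx : ∀ j, Measurable[history u ((m + 1) * K)] (x (m + 1) j) := fun j =>
      (ih hm' j).1.mono (history_mono u hle) le_rfl
    have hz : ∀ j, Measurable[history u ((m + 1) * K)] (z (m + 1) j) := fun j =>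
      (ih hm' j).2.mono (history_mono u hle) le_rfl
    let _ : MeasurableSpace Ω := history u ((m + 1) * K)
    constructor
    · have e : x (m + 1 + 1) i = w (m + 1) i K :=
        funext fun ω => H.run.x_succ (m + 1) (by omega) hm i ω
      rw [e]
      refine IsCG.measurable (S := shrink 𝒦 δ r) (H.modulus_pos (m + 1))
        (q := fun ω => ((((m + 1 : ℕ) : ℝ) + 1) * α * K)⁻¹ •
          ((2 * (α * K)) • x₀ - z (m + 1) i ω))
        (fun ω => H.exists_surrogate_eq (m + 1) (z (m + 1) i ω))
        (fun ω => H.run.cg (m + 1) (by omega) hm i ω) (hx i) ?_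
        (fun τ hτ => H.run.nonanticipating (m + 1) (by omega) hm i τ hτ) K le_rfl
      exact (measurable_const.sub (hz i)).const_smul ((((m + 1 : ℕ) : ℝ) + 1) * α * K)⁻¹
    · have e : z (m + 1 + 1) i = fun ω => ∑ j, P i j • z (m + 1) j ω +
          (blockGrad δ K f u x (m + 1) i ω - (α * K) • x (m + 1) i ω) :=
        funext fun ω => H.z_succ hm i ω
      rw [e]
      refine Measurable.add (Finset.measurable_sum _ fun j _ => (hz j).const_smul (P i j)) ?_
      refine Measurable.sub ?_ ((hx i).const_smul (α * K))
      refine measurable_blockGrad (fun t => H.continuous_loss t i) (hx i) fun t ht => ?_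
      rw [mem_block] at ht
      exact measurable_history u (by omega) (by rw [add_mul]; omega) i

theorem history_le_ambient {t : ℕ} (ht : t ≤ T) : history u t ≤ mΩ :=
  history_le H.measurable_dir ht

theorem measurable_x {m : ℕ} (hm : m * K ≤ T) (i : Fin n) : Measurable (x (m + 1) i) :=
  (H.measurable_iterates hm i).1.mono (H.history_le_ambient hm) le_rfl

theorem measurable_z {m : ℕ} (hm : m * K ≤ T) (i : Fin n) : Measurable (z (m + 1) i) :=
  (H.measurable_iterates hm i).2.mono (H.history_le_ambient hm) le_rfl

theorem measurable_leader_history {m : ℕ} (hm : m * K ≤ T) :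
    Measurable[history u (m * K)] (leader 𝒦 α δ r K x₀ z (m + 1)) := by
  have hz := fun j => (H.measurable_iterates hm j).2
  let _ : MeasurableSpace Ω := history u (m * K)
  unfold leader
  exact (continuous_metricProj H.nonempty_set H.convex_set H.closed_set).measurable.comp
    ((measurable_const.sub (measurable_netAvg hz)).const_smul ((((m + 1 : ℕ) : ℝ) + 1) * α * K)⁻¹)

theorem measurable_leader {m : ℕ} (hm : m * K ≤ T) :
    Measurable (leader 𝒦 α δ r K x₀ z (m + 1)) :=
  (H.measurable_leader_history hm).mono (H.history_le_ambient hm) le_rfl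

theorem measurable_grad {m : ℕ} (hm : (m + 1) * K ≤ T) (i : Fin n) :
    Measurable (blockGrad δ K f u x (m + 1) i) :=
  measurable_blockGrad (fun t => H.continuous_loss t i)
    (H.measurable_x (le_trans (Nat.mul_le_mul_right K (Nat.le_succ m)) hm) i)
    fun t ht => H.measurable_dir t (mem_Icc_of_mem_block hm ht) i

theorem norm_onePoint_le {m t : ℕ} (hm : (m + 1) * K ≤ T) (ht : t ∈ block K (m + 1)) (i : Fin n)
    (ω : Ω) : ‖onePoint δ (f t i) (x (m + 1) i ω) (u t i ω)‖ ≤ d / δ * M := by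
  have hd := H.delta_pos
  have h1 := H.bounded t (mem_Icc_of_mem_block hm ht) i _ (H.add_dir_mem
    (H.x_mem (le_trans (Nat.mul_le_mul_right K (Nat.le_succ m)) hm) i ω) (u t i ω))
  rw [onePoint, norm_smul, Real.norm_eq_abs, abs_mul, abs_of_nonneg (by positivity)]
  have h2 : ‖(u t i ω : Vec d)‖ = 1 := by simp
  rw [h2, mul_one]
  gcongr

theorem norm_blockGrad_le {m : ℕ} (hm : (m + 1) * K ≤ T) (i : Fin n) (ω : Ω) :
    ‖blockGrad δ K f u x (m + 1) i ω‖ ≤ K * (d / δ * M) := by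
  refine (norm_sum_le_of_le _ fun t ht => H.norm_onePoint_le hm ht i ω).trans (le_of_eq ?_)
  simp [card_block]

variable [NeZero d] [IsProbabilityMeasure μ]

/-- A gradient estimate tested against a bounded vector known before its round may be replaced by
its conditional mean. -/
theorem integral_inner_grad {m t : ℕ} (hm : (m + 1) * K ≤ T) (ht : t ∈ block K (m + 1))
    (i : Fin n) {W : Ω → Vec d} (hW : Measurable[history u (t - 1)] W) {B : ℝ}
    (hB : ∀ ω, ‖W ω‖ ≤ B) :
    Integrable (fun ω => ⟪onePoint δ (f t i) (x (m + 1) i ω) (u t i ω), W ω⟫) μ ∧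
    Integrable (fun ω => ⟪meanEstimate δ (f t i) (x (m + 1) i ω), W ω⟫) μ ∧
      ∫ ω, ⟪onePoint δ (f t i) (x (m + 1) i ω) (u t i ω), W ω⟫ ∂μ =
        ∫ ω, ⟪meanEstimate δ (f t i) (x (m + 1) i ω), W ω⟫ ∂μ := by
  have hm' : m * K ≤ T := le_trans (Nat.mul_le_mul_right K (Nat.le_succ m)) hm
  have htT := mem_Icc_of_mem_block hm ht
  have htT' := Finset.mem_Icc.1 htT
  have hle : history u (t - 1) ≤ mΩ := H.history_le_ambient (by omega)
  rw [mem_block] at ht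
  have hX : Measurable[history u (t - 1)] (x (m + 1) i) :=
    (H.measurable_iterates hm' i).1.mono (history_mono u (by omega)) le_rfl
  have hu := H.measurable_dir t htT i
  have hint : Integrable (fun ω => ⟪onePoint δ (f t i) (x (m + 1) i ω) (u t i ω), W ω⟫) μ := by
    refine integrable_of_norm_le (B := d / δ * M * B)
      ((measurable_onePoint δ (H.continuous_loss t i) (H.measurable_x hm' i) hu).inner
        (hW.mono hle le_rfl)) fun ω => ?_
    have h1 := H.norm_onePoint_le hm (mem_block.2 ht) i ω
    exact (norm_inner_le_norm _ _).trans
      (mul_le_mul h1 (hB ω) (norm_nonneg _) ((norm_nonneg _).trans h1))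
  exact ⟨hint, integral_inner_onePoint hle hu (H.law_dir t htT i)
    (indep_history H.measurable_dir H.indep_dir htT'.1 htT'.2 i) hX hW δ
    (H.continuous_loss t i) hint⟩

theorem integral_inner_grad_le {m t : ℕ} (hm : (m + 1) * K ≤ T) (ht : t ∈ block K (m + 1))
    (i : Fin n) {W : Ω → Vec d} (hW : Measurable[history u (t - 1)] W) {B : ℝ}
    (hB : ∀ ω, ‖W ω‖ ≤ B) :
    ∫ ω, ⟪onePoint δ (f t i) (x (m + 1) i ω) (u t i ω), W ω⟫ ∂μ ≤ C * ∫ ω, ‖W ω‖ ∂μ := by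
  obtain ⟨_, h2, h3⟩ := H.integral_inner_grad hm ht i hW hB
  have htT := Finset.mem_Icc.1 (mem_Icc_of_mem_block hm ht)
  have hW' : Measurable W := hW.mono (H.history_le_ambient (by omega)) le_rfl
  rw [h3, ← integral_const_mul]
  refine integral_mono h2 ((integrable_of_norm_le hW' hB).norm.const_mul _) fun ω => ?_
  exact inner_meanEstimate_le_norm H.delta_pos (H.lipschitz t i) _ _

/-- The gradient estimates of one block are conditionally uncorrelated up to their bounded
means: the second moment grows like `s * (d * M / δ) ^ 2 + (s * C) ^ 2` in the number `s` of
rounds, so that blocks of length `K ≈ 1 / δ ^ 2` make the noise comparable to the mean. -/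
theorem integral_norm_sq_partial_le {m : ℕ} (hm : (m + 1) * K ≤ T) (i : Fin n) (hM : 0 ≤ M) :
    ∀ s ≤ K, ∫ ω, ‖∑ t ∈ Finset.Icc (m * K + 1) (m * K + s),
      onePoint δ (f t i) (x (m + 1) i ω) (u t i ω)‖ ^ 2 ∂μ ≤
        (s * C + √s * (d / δ * M)) ^ 2 := by
  have hm' : m * K ≤ T := le_trans (Nat.mul_le_mul_right K (Nat.le_succ m)) hm
  have hb : 0 ≤ d / δ * M := by have := H.delta_pos; positivity
  set b := d / δ * M with hbdef
  intro s
  induction s with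
  | zero => simp
  | succ s ih =>
    intro hs
    have h0 := ih (by omega)
    set S : Ω → Vec d := fun ω => ∑ t ∈ Finset.Icc (m * K + 1) (m * K + s),
      onePoint δ (f t i) (x (m + 1) i ω) (u t i ω) with hS
    set g : Ω → Vec d := fun ω =>
      onePoint δ (f (m * K + s + 1) i) (x (m + 1) i ω) (u (m * K + s + 1) i ω) with hg
    have hmem : m * K + s + 1 ∈ block K (m + 1) := mem_block.2 (by omega)
    have hSb : ∀ ω, ‖S ω‖ ≤ s * b := fun ω => by
      refine (norm_sum_le_of_le _ fun t ht => H.norm_onePoint_le hm ?_ i ω).trans (le_of_eq ?_)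
      · rw [Finset.mem_Icc] at ht
        exact mem_block.2 (by omega)
      · simp [hbdef]
    have hSm : Measurable[history u (m * K + s)] S := by
      have hX : Measurable[history u (m * K + s)] (x (m + 1) i) :=
        (H.measurable_iterates hm' i).1.mono (history_mono u (by omega)) le_rfl
      let _ : MeasurableSpace Ω := history u (m * K + s)
      refine Finset.measurable_sum _ fun t ht => ?_
      rw [Finset.mem_Icc] at ht
      exact measurable_onePoint δ (H.continuous_loss t i) hX
        (measurable_history u (by omega) ht.2 i)
    have hSm' : Measurable S :=
      hSm.mono (H.history_le_ambient (by rw [add_mul] at hm; omega)) le_rfl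
    have hgm : Measurable g := measurable_onePoint δ (H.continuous_loss _ i) (H.measurable_x hm' i)
      (H.measurable_dir _ (mem_Icc_of_mem_block hm hmem) i)
    have hgb : ∀ ω, ‖g ω‖ ≤ b := fun ω => H.norm_onePoint_le hm hmem i ω
    have hcross : ∫ ω, ⟪g ω, S ω⟫ ∂μ ≤ C * ∫ ω, ‖S ω‖ ∂μ :=
      H.integral_inner_grad_le hm hmem i hSm hSb
    have hcrossI : Integrable (fun ω => ⟪g ω, S ω⟫) μ :=
      (H.integral_inner_grad hm hmem i hSm hSb).1
    have hS2 : Integrable (fun ω => ‖S ω‖ ^ 2) μ :=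
      integrable_of_norm_le (B := (s * b) ^ 2) (hSm'.norm.pow_const 2) fun ω => by
        rw [Real.norm_of_nonneg (by positivity)]
        exact pow_le_pow_left₀ (norm_nonneg _) (hSb ω) 2
    have hg2 : Integrable (fun ω => ‖g ω‖ ^ 2) μ :=
      integrable_of_norm_le (B := b ^ 2) (hgm.norm.pow_const 2) fun ω => by
        rw [Real.norm_of_nonneg (by positivity)]
        exact pow_le_pow_left₀ (norm_nonneg _) (hgb ω) 2
    have hES : ∫ ω, ‖S ω‖ ∂μ ≤ s * C + √s * b :=
      integral_le_of_integral_sq_le (integrable_of_norm_le hSm' hSb).norm hS2 (by positivity) h0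
    have hEg : ∫ ω, ‖g ω‖ ^ 2 ∂μ ≤ b ^ 2 := by
      refine (integral_mono hg2 (integrable_const (b ^ 2)) fun ω =>
        pow_le_pow_left₀ (norm_nonneg _) (hgb ω) 2).trans (le_of_eq ?_)
      simp
    have hexpand : ∀ ω, ‖∑ t ∈ Finset.Icc (m * K + 1) (m * K + (s + 1)),
        onePoint δ (f t i) (x (m + 1) i ω) (u t i ω)‖ ^ 2 =
        ‖S ω‖ ^ 2 + 2 * ⟪g ω, S ω⟫ + ‖g ω‖ ^ 2 := fun ω => by
      rw [← add_assoc, Finset.sum_Icc_succ_top (by omega), norm_add_sq_real, real_inner_comm]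
    have hI : Integrable (fun ω => ‖S ω‖ ^ 2 + 2 * ⟪g ω, S ω⟫) μ := hS2.add (hcrossI.const_mul 2)
    simp only [hexpand]
    rw [integral_add hI hg2, integral_add hS2 (hcrossI.const_mul 2),
      integral_const_mul]
    have h1 : (C : ℝ) * ∫ ω, ‖S ω‖ ∂μ ≤ C * (s * C + √s * b) :=
      mul_le_mul_of_nonneg_left hES C.coe_nonneg
    have hsq : √(s : ℝ) ^ 2 = s := Real.sq_sqrt (Nat.cast_nonneg _)
    have hsq' : √((s + 1 : ℕ) : ℝ) ^ 2 = s + 1 := by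
      rw [Real.sq_sqrt (Nat.cast_nonneg _)]; push_cast; ring
    have hmono : √(s : ℝ) ≤ √((s + 1 : ℕ) : ℝ) := Real.sqrt_le_sqrt (by push_cast; linarith)
    have h2 : 2 * (((s : ℝ) + 1) * C) * (√(s : ℝ) * b) ≤
        2 * (((s : ℝ) + 1) * C) * (√((s + 1 : ℕ) : ℝ) * b) := by gcongr
    have e1 : (s * (C : ℝ) + √s * b) ^ 2 =
        (s * (C : ℝ)) ^ 2 + 2 * (s * C) * (√s * b) + s * b ^ 2 := by
      rw [add_sq, mul_pow (√(s : ℝ)), hsq]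
    have e2 : (((s + 1 : ℕ) : ℝ) * (C : ℝ) + √((s + 1 : ℕ) : ℝ) * b) ^ 2 =
        (((s : ℝ) + 1) * C) ^ 2 + 2 * (((s : ℝ) + 1) * C) * (√((s + 1 : ℕ) : ℝ) * b) +
          (s + 1) * b ^ 2 := by
      rw [add_sq, mul_pow (√((s + 1 : ℕ) : ℝ)), hsq']; push_cast; ring
    rw [e1] at h0
    rw [e2]
    nlinarith [sq_nonneg (C : ℝ)]

theorem integral_norm_sq_blockGrad_le {m : ℕ} (hm : (m + 1) * K ≤ T) (i : Fin n) (hM : 0 ≤ M) :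
    ∫ ω, ‖blockGrad δ K f u x (m + 1) i ω‖ ^ 2 ∂μ ≤ (K * C + √K * (d / δ * M)) ^ 2 := by
  have h := H.integral_norm_sq_partial_le hm i hM K le_rfl
  have e : block K (m + 1) = Finset.Icc (m * K + 1) (m * K + K) := by
    ext t; rw [mem_block, Finset.mem_Icc]
  simpa only [blockGrad, e] using h

/-- Adding a vector of norm at most `β` to the block gradient: Minkowski's inequality. -/
theorem integral_norm_sq_add_le {m : ℕ} (hm : (m + 1) * K ≤ T) (i : Fin n) (hM : 0 ≤ M)
    {V : Ω → Vec d} (hV : Measurable V) {β : ℝ} (hβ : 0 ≤ β) (hVb : ∀ ω, ‖V ω‖ ≤ β) :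
    Integrable (fun ω => ‖blockGrad δ K f u x (m + 1) i ω + V ω‖ ^ 2) μ ∧
    ∫ ω, ‖blockGrad δ K f u x (m + 1) i ω + V ω‖ ^ 2 ∂μ ≤
      (K * C + √K * (d / δ * M) + β) ^ 2 := by
  have hb : 0 ≤ d / δ * M := by have := H.delta_pos; positivity
  have hG := H.measurable_grad hm i
  have hGb := H.norm_blockGrad_le hm i
  have hI : Integrable (fun ω => ‖blockGrad δ K f u x (m + 1) i ω‖) μ :=
    (integrable_of_norm_le hG hGb).norm
  have hI2 : Integrable (fun ω => ‖blockGrad δ K f u x (m + 1) i ω‖ ^ 2) μ :=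
    integrable_of_norm_le (B := (K * (d / δ * M)) ^ 2) (hG.norm.pow_const 2) fun ω => by
      rw [Real.norm_of_nonneg (by positivity)]
      exact pow_le_pow_left₀ (norm_nonneg _) (hGb ω) 2
  have hbd : ∀ ω, ‖blockGrad δ K f u x (m + 1) i ω + V ω‖ ^ 2 ≤
      ‖blockGrad δ K f u x (m + 1) i ω‖ ^ 2 + 2 * β * ‖blockGrad δ K f u x (m + 1) i ω‖ +
        β ^ 2 := fun ω => by
    have h1 : ‖blockGrad δ K f u x (m + 1) i ω + V ω‖ ≤
        ‖blockGrad δ K f u x (m + 1) i ω‖ + β :=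
      (norm_add_le _ _).trans (by linarith [hVb ω])
    have h2 := pow_le_pow_left₀ (norm_nonneg _) h1 2
    linarith
  have hdom' : Integrable (fun ω => ‖blockGrad δ K f u x (m + 1) i ω‖ ^ 2 +
      2 * β * ‖blockGrad δ K f u x (m + 1) i ω‖) μ := hI2.add (hI.const_mul _)
  have hdom : Integrable (fun ω => ‖blockGrad δ K f u x (m + 1) i ω‖ ^ 2 +
      2 * β * ‖blockGrad δ K f u x (m + 1) i ω‖ + β ^ 2) μ := hdom'.add (integrable_const _)
  have hint : Integrable (fun ω => ‖blockGrad δ K f u x (m + 1) i ω + V ω‖ ^ 2) μ :=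
    hdom.mono' ((hG.add hV).norm.pow_const 2).aestronglyMeasurable
      (Eventually.of_forall fun ω => by
        rw [Real.norm_of_nonneg (by positivity)]; exact hbd ω)
  refine ⟨hint, (integral_mono hint hdom hbd).trans ?_⟩
  rw [integral_add hdom' (integrable_const _), integral_add hI2 (hI.const_mul _), integral_const_mul]
  have h2 := H.integral_norm_sq_blockGrad_le hm i hM
  have h1 := integral_le_of_integral_sq_le hI hI2 (by positivity) h2
  have h3 := mul_le_mul_of_nonneg_left h1 (show 0 ≤ 2 * β by positivity)
  simp only [integral_const, probReal_univ, smul_eq_mul, one_mul]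
  nlinarith

end Measurability

end RegularRun

end DBBCG

namespace DBBCG

open Filter Topology Metric

/-! ### Expected consensus error and expected block losses -/

theorem netDev_nonneg {n d : ℕ} (Z : Fin n → Vec d) : 0 ≤ netDev Z := Real.sqrt_nonneg _

theorem measurable_netDev {Ω : Type*} [MeasurableSpace Ω] {d n : ℕ} {Z : Fin n → Ω → Vec d}
    (hZ : ∀ i, Measurable (Z i)) : Measurable fun ω => netDev fun i => Z i ω := by
  unfold netDev
  exact (Finset.measurable_sum _ fun i _ =>
    ((hZ i).sub (measurable_netAvg hZ)).norm.pow_const 2).sqrt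

namespace RegularRun

variable {Ω : Type*} {mΩ : MeasurableSpace Ω} {d n : ℕ} {𝒦 : Set (Vec d)}
  {E : Set (Fin n × Fin n)} {P : Matrix (Fin n) (Fin n) ℝ} {α : ℝ} {C : NNReal} {M R r : ℝ}
  {K T : ℕ} {δ : ℝ} {x₀ : Vec d} {μ : Measure Ω} {f : ℕ → Fin n → Vec d → ℝ}
  {u : ℕ → Fin n → Ω → UnitSphere d} {x z : ℕ → Fin n → Ω → Vec d}
  {v w : ℕ → Fin n → ℕ → Ω → Vec d}

section Expectation

variable (H : RegularRun 𝒦 E P α C M R r K T δ x₀ μ f u x z v w)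
include H

/-- The quantity in question bounds the root mean square of the vectors `blockGrad - α K x` that the
learners add to their dual variables. -/
theorem gradScale_nonneg (hM : 0 ≤ M) : 0 ≤ K * C + √K * (d / δ * M) + α * K * (2 * R) := by
  have h1 := H.delta_pos
  have h2 := H.alpha_pos
  have h3 := H.R_nonneg
  positivity

variable [NeZero d] [IsProbabilityMeasure μ]

theorem integral_leaderGrad_le [NeZero n] {m : ℕ} (hm : (m + 1) * K ≤ T) (hM : 0 ≤ M) :
    Integrable (fun ω => ‖leaderGrad 𝒦 α δ r K x₀ f u x z (m + 1) ω‖ ^ 2) μ ∧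
    ∫ ω, ‖leaderGrad 𝒦 α δ r K x₀ f u x z (m + 1) ω‖ ^ 2 ∂μ ≤
      (K * C + √K * (d / δ * M) + α * K * (2 * R)) ^ 2 ∧
    Integrable (fun ω => ‖leaderGrad 𝒦 α δ r K x₀ f u x z (m + 1) ω‖) μ ∧
    ∫ ω, ‖leaderGrad 𝒦 α δ r K x₀ f u x z (m + 1) ω‖ ∂μ ≤
      K * C + √K * (d / δ * M) + α * K * (2 * R) := by
  have hm' : m * K ≤ T := le_trans (Nat.mul_le_mul_right K (Nat.le_succ m)) hm
  have hαK := H.alpha_block_pos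
  have hn : (0 : ℝ) < n := by exact_mod_cast NeZero.pos n
  set ρ := K * C + √K * (d / δ * M) + α * K * (2 * R) with hρ
  set V : Fin n → Ω → Vec d := fun j ω =>
    (α * K) • (leader 𝒦 α δ r K x₀ z (m + 1) ω - x (m + 1) j ω) with hV
  have hVm : ∀ j, Measurable (V j) := fun j =>
    ((H.measurable_leader hm').sub (H.measurable_x hm' j)).const_smul (α * K)
  have hVb : ∀ j ω, ‖V j ω‖ ≤ α * K * (2 * R) := fun j ω => by
    rw [norm_smul, Real.norm_of_nonneg hαK.le]
    exact mul_le_mul_of_nonneg_left (H.diam_le (H.subset_set (H.leader_mem _ ω))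
      (H.subset_set (H.x_mem hm' j ω))) hαK.le
  have hβ : 0 ≤ α * K * (2 * R) := by have := H.R_nonneg; positivity
  have hY := fun j => H.integral_norm_sq_add_le hm j hM (hVm j) hβ (hVb j)
  have hlg : ∀ ω, leaderGrad 𝒦 α δ r K x₀ f u x z (m + 1) ω =
      netAvg fun j => blockGrad δ K f u x (m + 1) j ω + V j ω := fun ω => by
    rw [leaderGrad]
    congr 1
    funext j
    simp only [hV, smul_sub]
    abel
  have hmeas : Measurable (leaderGrad 𝒦 α δ r K x₀ f u x z (m + 1)) := by
    rw [funext hlg]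
    exact measurable_netAvg fun j => (H.measurable_grad hm j).add (hVm j)
  have hbd : ∀ ω, ‖leaderGrad 𝒦 α δ r K x₀ f u x z (m + 1) ω‖ ^ 2 ≤
      (n : ℝ)⁻¹ * ∑ j, ‖blockGrad δ K f u x (m + 1) j ω + V j ω‖ ^ 2 := fun ω => by
    rw [hlg, le_inv_mul_iff₀ hn]
    exact norm_netAvg_sq_le _
  have hsum : Integrable (fun ω => (n : ℝ)⁻¹ *
      ∑ j, ‖blockGrad δ K f u x (m + 1) j ω + V j ω‖ ^ 2) μ :=
    (integrable_finsetSum _ fun j _ => (hY j).1).const_mul _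
  have hI2 : Integrable (fun ω => ‖leaderGrad 𝒦 α δ r K x₀ f u x z (m + 1) ω‖ ^ 2) μ :=
    hsum.mono' (hmeas.norm.pow_const 2).aestronglyMeasurable (Eventually.of_forall fun ω => by
      rw [Real.norm_of_nonneg (by positivity)]; exact hbd ω)
  have hE2 : ∫ ω, ‖leaderGrad 𝒦 α δ r K x₀ f u x z (m + 1) ω‖ ^ 2 ∂μ ≤ ρ ^ 2 := by
    refine (integral_mono hI2 hsum hbd).trans ?_
    rw [integral_const_mul, integral_finsetSum _ fun j _ => (hY j).1, inv_mul_le_iff₀ hn]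
    refine (Finset.sum_le_sum fun j _ => (hY j).2).trans (le_of_eq ?_)
    simp [hρ]
  have hI : Integrable (fun ω => ‖leaderGrad 𝒦 α δ r K x₀ f u x z (m + 1) ω‖) μ := by
    refine ((hI2.add (integrable_const 1))).mono' hmeas.norm.aestronglyMeasurable
      (Eventually.of_forall fun ω => ?_)
    simp only [norm_norm, Pi.add_apply]
    nlinarith [sq_nonneg (‖leaderGrad 𝒦 α δ r K x₀ f u x z (m + 1) ω‖ - 1)]
  exact ⟨hI2, hE2, hI, integral_le_of_integral_sq_le hI hI2 (H.gradScale_nonneg hM) hE2⟩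

/-- The consensus error is the sum of a geometric series with ratio `sigma2 P`. -/
theorem integral_netDev_le {m : ℕ} (hm : m * K ≤ T) (hM : 0 ≤ M) :
    Integrable (fun ω => netDev fun i => z (m + 1) i ω) μ ∧
    ∫ ω, (netDev fun i => z (m + 1) i ω) ∂μ ≤
      √n * (K * C + √K * (d / δ * M) + α * K * (2 * R)) * (1 - sigma2 P)⁻¹ := by
  have hσ0 : 0 ≤ sigma2 P := (Matrix.toEuclideanLin P).singularValues_nonneg 1
  have hσ1 : 0 < 1 - sigma2 P := sub_pos.2 H.sigma2_lt
  have hρ0 := H.gradScale_nonneg hM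
  set ρ := K * C + √K * (d / δ * M) + α * K * (2 * R) with hρ
  induction m with
  | zero =>
    have h0 : ∀ ω, (netDev fun i => z (0 + 1) i ω) = 0 := fun ω => by
      simp [netDev, netAvg, H.run.z_one]
    simp only [h0, integral_zero]
    exact ⟨integrable_zero _ _ _, by positivity⟩
  | succ m ih =>
    have hm' : m * K ≤ T := le_trans (Nat.mul_le_mul_right K (Nat.le_succ m)) hm
    obtain ⟨ih1, ih2⟩ := ih hm'
    have hαK := H.alpha_block_pos
    set V : Fin n → Ω → Vec d := fun j ω => -((α * K) • x (m + 1) j ω) with hV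
    have hVm : ∀ j, Measurable (V j) := fun j => ((H.measurable_x hm' j).const_smul (α * K)).neg
    have hVb : ∀ j ω, ‖V j ω‖ ≤ α * K * (2 * R) := fun j ω => by
      rw [hV, norm_neg, norm_smul, Real.norm_of_nonneg hαK.le]
      refine mul_le_mul_of_nonneg_left ?_ hαK.le
      have h1 := H.norm_le_of_mem_set (H.x_mem hm' j ω)
      linarith [H.R_nonneg]
    have hβ : 0 ≤ α * K * (2 * R) := by have := H.R_nonneg; positivity
    have hY := fun j => H.integral_norm_sq_add_le hm j hM (hVm j) hβ (hVb j)
    set S : Ω → ℝ := fun ω => ∑ j, ‖blockGrad δ K f u x (m + 1) j ω + V j ω‖ ^ 2 with hS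
    have hS0 : ∀ ω, 0 ≤ S ω := fun ω => Finset.sum_nonneg fun _ _ => sq_nonneg _
    have hSm : Measurable S := Finset.measurable_sum _ fun j _ =>
      ((H.measurable_grad hm j).add (hVm j)).norm.pow_const 2
    have hSI : Integrable S μ := integrable_finsetSum _ fun j _ => (hY j).1
    have hSE : ∫ ω, S ω ∂μ ≤ (√n * ρ) ^ 2 := by
      rw [hS, integral_finsetSum _ fun j _ => (hY j).1, mul_pow,
        Real.sq_sqrt (Nat.cast_nonneg n)]
      refine (Finset.sum_le_sum fun j _ => (hY j).2).trans (le_of_eq ?_)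
      simp [hρ]
    have hsq : ∀ ω, √(S ω) ^ 2 = S ω := fun ω => Real.sq_sqrt (hS0 ω)
    have hsI : Integrable (fun ω => √(S ω)) μ := by
      refine ((hSI.add (integrable_const 1))).mono' hSm.sqrt.aestronglyMeasurable
        (Eventually.of_forall fun ω => ?_)
      rw [Real.norm_of_nonneg (Real.sqrt_nonneg _), Pi.add_apply]
      have := hsq ω
      nlinarith [sq_nonneg (√(S ω) - 1)]
    have hsE : ∫ ω, √(S ω) ∂μ ≤ √n * ρ :=
      integral_le_of_integral_sq_le hsI (by simpa only [hsq] using hSI) (by positivity)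
        (by simpa only [hsq] using hSE)
    have hstep : ∀ ω, (netDev fun i => z (m + 1 + 1) i ω) ≤
        sigma2 P * (netDev fun i => z (m + 1) i ω) + √(S ω) := fun ω => by
      simp only [H.z_succ hm]
      refine (H.weight.netDev_step H.sigma2_lt (fun j => z (m + 1) j ω) _).trans (le_of_eq ?_)
      simp [hS, hV, sub_eq_add_neg]
    have hdom : Integrable (fun ω => sigma2 P * (netDev fun i => z (m + 1) i ω) + √(S ω)) μ :=
      (ih1.const_mul _).add hsI
    have hint : Integrable (fun ω => netDev fun i => z (m + 1 + 1) i ω) μ :=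
      hdom.mono' (measurable_netDev fun i => H.measurable_z hm i).aestronglyMeasurable
        (Eventually.of_forall fun ω => by
          rw [Real.norm_of_nonneg (netDev_nonneg _)]; exact hstep ω)
    refine ⟨hint, (integral_mono hint hdom hstep).trans ?_⟩
    rw [integral_add (ih1.const_mul _) hsI, integral_const_mul]
    have h1 := mul_le_mul_of_nonneg_left ih2 hσ0
    have h2 : √n * ρ = (√n * ρ * (1 - sigma2 P)⁻¹) * (1 - sigma2 P) := by
      field_simp
    nlinarith

/-- Expected distance of a learner to the leader of the same block. In the first block both are
`x₀`. -/
theorem integral_norm_sub_leader_le [NeZero n] {m : ℕ} (hm : m * K ≤ T) (hM : 0 ≤ M)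
    (j : Fin n) :
    Integrable (fun ω => ‖x (m + 1) j ω - leader 𝒦 α δ r K x₀ z (m + 1) ω‖) μ ∧
    ∫ ω, ‖x (m + 1) j ω - leader 𝒦 α δ r K x₀ z (m + 1) ω‖ ∂μ ≤ 4 * R / √K +
      (√n * (1 - sigma2 P)⁻¹ + 2) * (K * C + √K * (d / δ * M) + α * K * (2 * R)) /
        (((m : ℝ) + 1) * α * K) := by
  have hint : ∀ {m : ℕ}, m * K ≤ T →
      Integrable (fun ω => ‖x (m + 1) j ω - leader 𝒦 α δ r K x₀ z (m + 1) ω‖) μ := fun hm =>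
    (integrable_of_norm_le ((H.measurable_x hm j).sub (H.measurable_leader hm)) fun ω =>
      H.diam_le (H.subset_set (H.x_mem hm j ω)) (H.subset_set (H.leader_mem _ ω))).norm
  refine ⟨hint hm, ?_⟩
  have hσ1 : 0 < 1 - sigma2 P := sub_pos.2 H.sigma2_lt
  have hρ0 := H.gradScale_nonneg hM
  have hR := H.R_nonneg
  have ha := H.modulus_pos m
  set ρ := K * C + √K * (d / δ * M) + α * K * (2 * R) with hρ
  cases m with
  | zero =>
    have h0 : ∀ ω, ‖x (0 + 1) j ω - leader 𝒦 α δ r K x₀ z (0 + 1) ω‖ = 0 := fun ω => by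
      rw [zero_add, H.leader_one, H.run.x_one, sub_self, norm_zero]
    simp only [h0, integral_zero]
    positivity
  | succ m =>
    have hm' : m * K ≤ T := le_trans (Nat.mul_le_mul_right K (Nat.le_succ m)) hm
    obtain ⟨hD1, hD2⟩ := H.integral_netDev_le hm' hM
    obtain ⟨_, _, hL1, hL2⟩ := H.integral_leaderGrad_le hm hM
    have ea : (((m + 1 : ℕ) : ℝ) + 1) * α * K = ((m : ℝ) + 2) * α * K := by push_cast; ring
    rw [ea] at ha ⊢
    have hDL : Integrable (fun ω => (netDev fun i => z (m + 1) i ω) +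
        2 * ‖leaderGrad 𝒦 α δ r K x₀ f u x z (m + 1) ω‖) μ := hD1.add (hL1.const_mul 2)
    refine (integral_mono (hint hm) ((integrable_const (4 * R / √K)).add
      (hDL.div_const (((m : ℝ) + 2) * α * K))) fun ω => H.norm_sub_leader_le hm j ω).trans ?_
    simp only [Pi.add_apply]
    rw [integral_add (integrable_const _) (hDL.div_const _),
      integral_div (((m : ℝ) + 2) * α * K),
      integral_add hD1 (hL1.const_mul 2), integral_const_mul]
    simp only [integral_const, probReal_univ, smul_eq_mul, one_mul]
    gcongr
    linarith

/-- Both decisions are fixed before the block, so that the noise of the estimates averages out and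
only their means, bounded by `C`, contribute. -/
theorem integral_inner_leader_le {m : ℕ} (hm : (m + 1) * K ≤ T) (j : Fin n) :
    Integrable (fun ω => ⟪blockGrad δ K f u x (m + 1) j ω,
      x (m + 1) j ω - leader 𝒦 α δ r K x₀ z (m + 1) ω⟫) μ ∧
    ∫ ω, ⟪blockGrad δ K f u x (m + 1) j ω,
      x (m + 1) j ω - leader 𝒦 α δ r K x₀ z (m + 1) ω⟫ ∂μ ≤
      K * C * ∫ ω, ‖x (m + 1) j ω - leader 𝒦 α δ r K x₀ z (m + 1) ω‖ ∂μ := by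
  have hm' : m * K ≤ T := le_trans (Nat.mul_le_mul_right K (Nat.le_succ m)) hm
  have hW : Measurable[history u (m * K)]
      fun ω => x (m + 1) j ω - leader 𝒦 α δ r K x₀ z (m + 1) ω :=
    (H.measurable_iterates hm' j).1.sub (H.measurable_leader_history hm')
  have hWt : ∀ t ∈ block K (m + 1), Measurable[history u (t - 1)]
      fun ω => x (m + 1) j ω - leader 𝒦 α δ r K x₀ z (m + 1) ω := fun t ht =>
    hW.mono (history_mono u (by rw [mem_block] at ht; omega)) le_rfl
  have hWb : ∀ ω, ‖x (m + 1) j ω - leader 𝒦 α δ r K x₀ z (m + 1) ω‖ ≤ 2 * R := fun ω =>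
    H.diam_le (H.subset_set (H.x_mem hm' j ω)) (H.subset_set (H.leader_mem _ ω))
  have hI := fun t ht => (H.integral_inner_grad hm ht j (hWt t ht) hWb).1
  simp only [blockGrad, sum_inner]
  refine ⟨integrable_finsetSum _ hI, ?_⟩
  rw [integral_finsetSum _ hI]
  refine (Finset.sum_le_card_nsmul _ _ _ fun t ht =>
    H.integral_inner_grad_le hm ht j (hWt t ht) hWb).trans (le_of_eq ?_)
  rw [card_block, nsmul_eq_mul, mul_assoc]

/-- In expectation, the loss differences of one block are dominated by their linearizations with
the one-point estimates, minus the strong convexity gain. -/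
theorem integral_block_loss_le {m : ℕ} (hm : (m + 1) * K ≤ T) (j : Fin n) {y : Vec d}
    (hy : y ∈ shrink 𝒦 δ r) :
    Integrable (fun ω => ∑ t ∈ block K (m + 1), (f t j (x (m + 1) j ω) - f t j y)) μ ∧
    Integrable (fun ω => ⟪blockGrad δ K f u x (m + 1) j ω, x (m + 1) j ω - y⟫ -
      α * K / 2 * ‖x (m + 1) j ω - y‖ ^ 2) μ ∧
    ∫ ω, ∑ t ∈ block K (m + 1), (f t j (x (m + 1) j ω) - f t j y) ∂μ ≤
      ∫ ω, (⟪blockGrad δ K f u x (m + 1) j ω, x (m + 1) j ω - y⟫ -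
        α * K / 2 * ‖x (m + 1) j ω - y‖ ^ 2) ∂μ + K * (2 * C * δ) := by
  have hm' : m * K ≤ T := le_trans (Nat.mul_le_mul_right K (Nat.le_succ m)) hm
  have hx := H.measurable_x hm' j
  have hW : Measurable[history u (m * K)] fun ω => x (m + 1) j ω - y :=
    (H.measurable_iterates hm' j).1.sub measurable_const
  have hWt : ∀ t ∈ block K (m + 1), Measurable[history u (t - 1)]
      fun ω => x (m + 1) j ω - y := fun t ht =>
    hW.mono (history_mono u (by rw [mem_block] at ht; omega)) le_rfl
  have hWb : ∀ ω, ‖x (m + 1) j ω - y‖ ≤ 2 * R := fun ω =>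
    H.diam_le (H.subset_set (H.x_mem hm' j ω)) (H.subset_set hy)
  have hI := fun t ht => (H.integral_inner_grad hm ht j (hWt t ht) hWb)
  have hf : ∀ t, Integrable (fun ω => f t j (x (m + 1) j ω) - f t j y) μ := fun t =>
    integrable_of_norm_le (B := C * (2 * R))
      (((H.continuous_loss t j).measurable.comp hx).sub measurable_const) fun ω =>
        (H.abs_sub_le t j _ _).trans (mul_le_mul_of_nonneg_left (hWb ω) C.coe_nonneg)
  have hsq : Integrable (fun ω => ‖x (m + 1) j ω - y‖ ^ 2) μ :=
    integrable_of_norm_le (B := (2 * R) ^ 2) ((hx.sub measurable_const).norm.pow_const 2)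
      fun ω => by
        rw [Real.norm_of_nonneg (by positivity)]
        exact pow_le_pow_left₀ (norm_nonneg _) (hWb ω) 2
  have hlin : Integrable (fun ω => ⟪blockGrad δ K f u x (m + 1) j ω, x (m + 1) j ω - y⟫) μ := by
    simp only [blockGrad, sum_inner]
    exact integrable_finsetSum _ fun t ht => (hI t ht).1
  refine ⟨integrable_finsetSum _ fun t _ => hf t, hlin.sub (hsq.const_mul _), ?_⟩
  rw [integral_finsetSum _ fun t _ => hf t, integral_sub hlin (hsq.const_mul _),
    integral_const_mul]
  have hlinE : ∫ ω, ⟪blockGrad δ K f u x (m + 1) j ω, x (m + 1) j ω - y⟫ ∂μ =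
      ∑ t ∈ block K (m + 1), ∫ ω, ⟪meanEstimate δ (f t j) (x (m + 1) j ω),
        x (m + 1) j ω - y⟫ ∂μ := by
    simp only [blockGrad, sum_inner]
    rw [integral_finsetSum _ fun t ht => (hI t ht).1]
    exact Finset.sum_congr rfl fun t ht => (hI t ht).2.2
  have hone : ∀ t ∈ block K (m + 1), ∫ ω, (f t j (x (m + 1) j ω) - f t j y) ∂μ ≤
      ∫ ω, ⟪meanEstimate δ (f t j) (x (m + 1) j ω), x (m + 1) j ω - y⟫ ∂μ +
        (2 * C * δ - α / 2 * ∫ ω, ‖x (m + 1) j ω - y‖ ^ 2 ∂μ) := by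
    intro t ht
    have h1 : Integrable (fun ω => f t j (x (m + 1) j ω) - f t j y - 2 * C * δ) μ :=
      (hf t).sub (integrable_const _)
    have h2 : Integrable (fun ω => f t j (x (m + 1) j ω) - f t j y - 2 * C * δ +
        α / 2 * ‖x (m + 1) j ω - y‖ ^ 2) μ := h1.add (hsq.const_mul _)
    have hmono := integral_mono h2 (hI t ht).2.1 fun ω =>
      le_inner_meanEstimate H.delta_pos (H.lipschitz t j)
        (H.strongConvex t (mem_Icc_of_mem_block hm ht) j)
        (fun e he => H.add_smul_mem (H.x_mem hm' j ω) he) (fun e he => H.add_smul_mem hy he)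
    rw [integral_add h1 (hsq.const_mul _), integral_sub (hf t) (integrable_const _),
      integral_const_mul (α / 2)] at hmono
    simp only [integral_const, probReal_univ, smul_eq_mul, one_mul] at hmono
    linarith
  refine (Finset.sum_le_sum hone).trans (le_of_eq ?_)
  rw [Finset.sum_add_distrib, hlinE, Finset.sum_const, card_block, nsmul_eq_mul]
  ring

end Expectation

end RegularRun

end DBBCG

namespace DBBCG

open Filter Topology Metric

/-! ### The expected regret -/

namespace RegularRun

variable {Ω : Type*} {mΩ : MeasurableSpace Ω} {d n : ℕ} {𝒦 : Set (Vec d)}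
  {E : Set (Fin n × Fin n)} {P : Matrix (Fin n) (Fin n) ℝ} {α : ℝ} {C : NNReal} {M R r : ℝ}
  {K T : ℕ} {δ : ℝ} {x₀ : Vec d} {μ : Measure Ω} {f : ℕ → Fin n → Vec d → ℝ}
  {u : ℕ → Fin n → Ω → UnitSphere d} {x z : ℕ → Fin n → Ω → Vec d}
  {v w : ℕ → Fin n → ℕ → Ω → Vec d}

section Regret

variable (H : RegularRun 𝒦 E P α C M R r K T δ x₀ μ f u x z v w)
  [IsProbabilityMeasure μ]
include H

theorem integrable_sum_loss_sub (i : Fin n) {y : Vec d} (hy : y ∈ 𝒦) :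
    Integrable (fun ω => ∑ t ∈ Finset.Icc 1 T,
      (globalLoss f t (played δ K u x i t ω) - globalLoss f t y)) μ := by
  refine integrable_finsetSum _ fun t ht => ?_
  have ht' := Finset.mem_Icc.1 ht
  obtain ⟨m, hm, htm⟩ := H.exists_block ht'.1 ht'.2
  have hp : Measurable (played δ K u x i t) := by
    unfold played
    rw [blockOf_eq htm]
    exact (H.measurable_x hm i).add
      ((measurable_subtype_coe.comp (H.measurable_dir t ht i)).const_smul δ)
  have e : (fun ω => globalLoss f t (played δ K u x i t ω) - globalLoss f t y) =
      fun ω => ∑ j, (f t j (played δ K u x i t ω) - f t j y) := by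
    funext ω
    rw [globalLoss, globalLoss, Finset.sum_sub_distrib]
  rw [e]
  refine integrable_finsetSum _ fun j _ => ?_
  exact integrable_of_norm_le (B := C * (2 * R))
    (((H.continuous_loss t j).measurable.comp hp).sub measurable_const) fun ω =>
      (H.abs_sub_le t j _ _).trans (mul_le_mul_of_nonneg_left
        (H.diam_le (H.played_mem hm htm i ω) hy) C.coe_nonneg)

/-- The expected regret, with all parameters explicit. The distance to the leader is counted three
times per learner: twice for the disagreement between learners `i` and `j`, once in the linearized
regret. -/
theorem integral_sum_loss_sub_le [NeZero d] [NeZero n] (hM : 0 ≤ M) (i : Fin n) {y : Vec d}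
    (hy : y ∈ 𝒦) :
    ∫ ω, ∑ t ∈ Finset.Icc 1 T,
        (globalLoss f t (played δ K u x i t ω) - globalLoss f t y) ∂μ ≤
      ∑ m ∈ Finset.Icc 1 (T / K), (3 * n * (K * C * (4 * R / √K +
        (√n * (1 - sigma2 P)⁻¹ + 2) * (K * C + √K * (d / δ * M) + α * K * (2 * R)) /
          ((m : ℝ) * α * K))) +
        n * ((K * C + √K * (d / δ * M) + α * K * (2 * R)) ^ 2 / (2 * ((m : ℝ) * α * K)))) +
      n * (4 * (α * K) * R ^ 2) + n * T * (C * δ * (3 + R / r)) + n * K * (2 * C * R) := by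
  have hρ0 := H.gradScale_nonneg hM
  set ρ := K * C + √K * (d / δ * M) + α * K * (2 * R) with hρ
  set X := (√n * (1 - sigma2 P)⁻¹ + 2) * ρ with hX
  set N := T / K with hN
  have hNK : N * K ≤ T := Nat.div_mul_le_self T K
  set y' := (1 - δ / r) • y with hy'
  have hy'S : y' ∈ shrink 𝒦 δ r := smul_mem_shrink hy
  -- the blockwise quantities, blocks being numbered from one
  set A : ℕ → Fin n → Ω → ℝ := fun m j ω =>
    ∑ t ∈ block K m, (f t j (x m j ω) - f t j y') with hA
  set B : ℕ → Fin n → Ω → ℝ := fun m j ω =>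
    ⟪blockGrad δ K f u x m j ω, x m j ω - y'⟫ - α * K / 2 * ‖x m j ω - y'‖ ^ 2 with hB
  set D : ℕ → Fin n → Ω → ℝ := fun m j ω =>
    ⟪blockGrad δ K f u x m j ω, x m j ω - leader 𝒦 α δ r K x₀ z m ω⟫ with hD
  set e : ℕ → Fin n → Ω → ℝ := fun m j ω => ‖x m j ω - leader 𝒦 α δ r K x₀ z m ω‖ with he
  set g : ℕ → Ω → ℝ := fun m ω => ‖leaderGrad 𝒦 α δ r K x₀ f u x z m ω‖ ^ 2 with hg
  set ε : ℕ → ℝ := fun m => 4 * R / √K + X / ((m : ℝ) * α * K) with hε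
  have hpred : ∀ m ∈ Finset.Icc 1 N, ∃ m', m = m' + 1 ∧ (m' + 1) * K ≤ T ∧ m' * K ≤ T := by
    intro m hm
    rw [Finset.mem_Icc] at hm
    refine ⟨m - 1, by omega, Nat.mul_le_of_le_div _ _ _ (by omega),
      Nat.mul_le_of_le_div _ _ _ (by omega)⟩
  have hAI : ∀ m ∈ Finset.Icc 1 N, ∀ j, Integrable (A m j) μ := fun m hm j => by
    obtain ⟨m, rfl, h1, h2⟩ := hpred m hm
    exact (H.integral_block_loss_le h1 j hy'S).1
  have hBI : ∀ m ∈ Finset.Icc 1 N, ∀ j, Integrable (B m j) μ := fun m hm j => by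
    obtain ⟨m, rfl, h1, h2⟩ := hpred m hm
    exact (H.integral_block_loss_le h1 j hy'S).2.1
  have hAB : ∀ m ∈ Finset.Icc 1 N, ∀ j, ∫ ω, A m j ω ∂μ ≤ ∫ ω, B m j ω ∂μ + K * (2 * C * δ) :=
    fun m hm j => by
      obtain ⟨m, rfl, h1, h2⟩ := hpred m hm
      exact (H.integral_block_loss_le h1 j hy'S).2.2
  have hDI : ∀ m ∈ Finset.Icc 1 N, ∀ j, Integrable (D m j) μ := fun m hm j => by
    obtain ⟨m, rfl, h1, h2⟩ := hpred m hm
    exact (H.integral_inner_leader_le h1 j).1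
  have hDe : ∀ m ∈ Finset.Icc 1 N, ∀ j, ∫ ω, D m j ω ∂μ ≤ K * C * ∫ ω, e m j ω ∂μ :=
    fun m hm j => by
      obtain ⟨m, rfl, h1, h2⟩ := hpred m hm
      exact (H.integral_inner_leader_le h1 j).2
  have heI : ∀ m ∈ Finset.Icc 1 N, ∀ j, Integrable (e m j) μ := fun m hm j => by
    obtain ⟨m, rfl, h1, h2⟩ := hpred m hm
    exact (H.integral_norm_sub_leader_le h2 hM j).1
  have heε : ∀ m ∈ Finset.Icc 1 N, ∀ j, ∫ ω, e m j ω ∂μ ≤ ε m := fun m hm j => by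
    obtain ⟨m, rfl, h1, h2⟩ := hpred m hm
    have := (H.integral_norm_sub_leader_le h2 hM j).2
    simp only [hε, hX]
    push_cast
    exact this
  have hgI : ∀ m ∈ Finset.Icc 1 N, Integrable (g m) μ := fun m hm => by
    obtain ⟨m, rfl, h1, h2⟩ := hpred m hm
    exact (H.integral_leaderGrad_le h1 hM).1
  have hgρ : ∀ m ∈ Finset.Icc 1 N, ∫ ω, g m ω ∂μ ≤ ρ ^ 2 := fun m hm => by
    obtain ⟨m, rfl, h1, h2⟩ := hpred m hm
    exact (H.integral_leaderGrad_le h1 hM).2.1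
  have hKC : 0 ≤ (K : ℝ) * C := by positivity
  have hαK := H.alpha_block_pos
  -- the linearized regret of the learners, in expectation
  have hBsum : ∑ m ∈ Finset.Icc 1 N, ∑ j, ∫ ω, B m j ω ∂μ ≤
      ∑ m ∈ Finset.Icc 1 N, (n * (K * C * ε m) + n * (ρ ^ 2 / (2 * ((m : ℝ) * α * K)))) +
        n * (4 * (α * K) * R ^ 2) := by
    have hBI' : Integrable (fun ω => ∑ m ∈ Finset.Icc 1 N, ∑ j, B m j ω) μ :=
      integrable_finsetSum _ fun m hm => integrable_finsetSum _ fun j _ => hBI m hm j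
    have hDI' : Integrable (fun ω => ∑ m ∈ Finset.Icc 1 N, ∑ j, D m j ω) μ :=
      integrable_finsetSum _ fun m hm => integrable_finsetSum _ fun j _ => hDI m hm j
    have hDI'' : Integrable (fun ω => ∑ m ∈ Finset.Icc 1 N, ∑ j, D m j ω +
        n * (4 * (α * K) * R ^ 2)) μ := hDI'.add (integrable_const _)
    have hgI'' : ∀ m ∈ Finset.Icc 1 N,
        Integrable (fun ω => n * (g m ω / (2 * (((m : ℝ) + 1) * α * K)))) μ := fun m hm =>
      ((hgI m hm).div_const _).const_mul _
    have hgI' : Integrable (fun ω => ∑ m ∈ Finset.Icc 1 N,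
        n * (g m ω / (2 * (((m : ℝ) + 1) * α * K)))) μ :=
      integrable_finsetSum _ hgI''
    have h := integral_mono hBI' (hDI''.add hgI') fun ω => H.sum_linearized_le ω hy'S
    simp only [Pi.add_apply] at h
    rw [integral_add hDI'' hgI', integral_add hDI' (integrable_const _),
      integral_finsetSum _ fun m hm => integrable_finsetSum _ fun j _ => hBI m hm j,
      integral_finsetSum _ fun m hm => integrable_finsetSum _ fun j _ => hDI m hm j,
      integral_finsetSum _ hgI''] at h
    have e1 : ∑ m ∈ Finset.Icc 1 N, ∑ j, ∫ ω, B m j ω ∂μ =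
        ∑ m ∈ Finset.Icc 1 N, ∫ ω, ∑ j, B m j ω ∂μ :=
      Finset.sum_congr rfl fun m hm => (integral_finsetSum _ fun j _ => hBI m hm j).symm
    have e2 : ∑ m ∈ Finset.Icc 1 N, ∫ ω, ∑ j, D m j ω ∂μ ≤
        ∑ m ∈ Finset.Icc 1 N, n * (K * C * ε m) := by
      refine Finset.sum_le_sum fun m hm => ?_
      rw [integral_finsetSum _ fun j _ => hDI m hm j]
      refine (Finset.sum_le_card_nsmul _ _ (K * C * ε m) fun j _ => ?_).trans (le_of_eq (by simp))
      exact (hDe m hm j).trans (mul_le_mul_of_nonneg_left (heε m hm j) hKC)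
    have e3 : ∑ m ∈ Finset.Icc 1 N, ∫ ω, n * (g m ω / (2 * (((m : ℝ) + 1) * α * K))) ∂μ ≤
        ∑ m ∈ Finset.Icc 1 N, n * (ρ ^ 2 / (2 * ((m : ℝ) * α * K))) := by
      refine Finset.sum_le_sum fun m hm => ?_
      have hm0 : (0 : ℝ) < m := by exact_mod_cast (Finset.mem_Icc.1 hm).1
      have hα := H.alpha_pos
      have hK : (0 : ℝ) < K := by exact_mod_cast H.block_pos
      rw [integral_const_mul, integral_div]
      have h1 : ∫ ω, g m ω ∂μ ≤ ρ ^ 2 := hgρ m hm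
      gcongr
      linarith
    rw [e1, Finset.sum_add_distrib]
    simp only [integral_const, probReal_univ, smul_eq_mul, one_mul] at h
    linarith
  -- the pathwise decomposition, in expectation
  have hQI : ∀ m ∈ Finset.Icc 1 N, ∀ j,
      Integrable (fun ω => A m j ω + K * C * (e m i ω + e m j ω)) μ := fun m hm j =>
    (hAI m hm j).add (((heI m hm i).add (heI m hm j)).const_mul _)
  have hQ : ∀ m ∈ Finset.Icc 1 N, ∀ j, ∫ ω, (A m j ω + K * C * (e m i ω + e m j ω)) ∂μ ≤
      ∫ ω, B m j ω ∂μ + (K * (2 * C * δ) + 2 * (K * C * ε m)) := fun m hm j => by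
    have heI' : Integrable (fun ω => e m i ω + e m j ω) μ := (heI m hm i).add (heI m hm j)
    rw [integral_add (hAI m hm j) (heI'.const_mul _),
      integral_const_mul, integral_add (heI m hm i) (heI m hm j)]
    have h1 := mul_le_mul_of_nonneg_left (add_le_add (heε m hm i) (heε m hm j)) hKC
    have h2 := hAB m hm j
    linarith
  have hQI' : Integrable (fun ω => ∑ m ∈ Finset.Icc 1 N, ∑ j,
      (A m j ω + K * C * (e m i ω + e m j ω))) μ :=
    integrable_finsetSum _ fun m hm => integrable_finsetSum _ fun j _ => hQI m hm j
  have hdom : Integrable (fun ω => ∑ m ∈ Finset.Icc 1 N, ∑ j,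
      (A m j ω + K * C * (e m i ω + e m j ω)) + (n * T * (C * δ * (1 + R / r)) +
        n * K * (2 * C * R))) μ := hQI'.add (integrable_const _)
  have hmain := integral_mono (H.integrable_sum_loss_sub i hy) hdom fun ω =>
    (H.sum_loss_sub_le i ω hy).trans (le_of_eq (add_assoc _ _ _))
  rw [integral_add hQI' (integrable_const _),
    integral_finsetSum _ fun m hm => integrable_finsetSum _ fun j _ => hQI m hm j] at hmain
  refine hmain.trans ?_
  have hQsum : ∑ m ∈ Finset.Icc 1 N, ∫ ω, ∑ j, (A m j ω + K * C * (e m i ω + e m j ω)) ∂μ ≤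
      ∑ m ∈ Finset.Icc 1 N, ∑ j, ∫ ω, B m j ω ∂μ +
        ∑ m ∈ Finset.Icc 1 N, (n * (2 * (K * C * ε m)) + n * (K * (2 * C * δ))) := by
    rw [← Finset.sum_add_distrib]
    refine Finset.sum_le_sum fun m hm => ?_
    rw [integral_finsetSum _ fun j _ => hQI m hm j]
    refine (Finset.sum_le_sum fun j _ => hQ m hm j).trans (le_of_eq ?_)
    rw [Finset.sum_add_distrib, Finset.sum_const, Finset.card_univ, Fintype.card_fin,
      nsmul_eq_mul]
    ring
  have hδsum : ∑ m ∈ Finset.Icc 1 N, (n : ℝ) * (K * (2 * C * δ)) ≤ n * T * (2 * C * δ) := by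
    rw [Finset.sum_const, Nat.card_Icc, nsmul_eq_mul, Nat.add_sub_cancel]
    have h1 : (N : ℝ) * K ≤ T := by exact_mod_cast hNK
    have hδ := H.delta_pos
    calc (N : ℝ) * (n * (K * (2 * C * δ))) = n * (N * K) * (2 * C * δ) := by ring
      _ ≤ _ := by gcongr
  rw [Finset.sum_add_distrib] at hQsum
  have hfinal : ∑ m ∈ Finset.Icc 1 N, (3 * n * (K * C * ε m) +
      n * (ρ ^ 2 / (2 * ((m : ℝ) * α * K)))) =
      ∑ m ∈ Finset.Icc 1 N, (n * (K * C * ε m) + n * (ρ ^ 2 / (2 * ((m : ℝ) * α * K)))) +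
      ∑ m ∈ Finset.Icc 1 N, n * (2 * (K * C * ε m)) := by
    rw [← Finset.sum_add_distrib]
    exact Finset.sum_congr rfl fun m _ => by ring
  simp only [integral_const, probReal_univ, smul_eq_mul, one_mul]
  have hexp : n * T * (C * δ * (3 + R / r)) =
      n * T * (C * δ * (1 + R / r)) + n * T * (2 * C * δ) := by ring
  rw [hexp, hfinal]
  linarith

end Regret

end RegularRun

end DBBCG

namespace DBBCG

open Filter Topology Metric

/-! ### The choice of the parameters -/

theorem sum_inv_Icc_le (N : ℕ) : ∑ m ∈ Finset.Icc 1 N, ((m : ℝ))⁻¹ ≤ 1 + Real.log N := by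
  have h := harmonic_le_one_add_log N
  rw [harmonic_eq_sum_Icc] at h
  push_cast at h
  exact h

/-- The explicit regret bound with block size of order `s ^ 2` and smoothing radius `c / s`,
for a horizon `T = s ^ 3 * Λ`, is of order `s ^ 2 * Λ`. -/
theorem regret_bound_of_scale {s Λ α c C M R r γ δ : ℝ} {d n K N T : ℕ} (hs : 1 ≤ s)
    (hΛ : 1 / 2 ≤ Λ) (hα : 0 < α) (hc : 0 < c) (hC : 0 ≤ C) (hM : 0 ≤ M) (hR : 0 ≤ R)
    (hr : 0 < r) (hγ : 1 ≤ γ) (hn : 1 ≤ n) (hK1 : 1 ≤ K) (hKs : K ≤ s ^ 2)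
    (hsK : s ^ 2 ≤ 2 * K) (hNK : N * K ≤ T) (hT : (T : ℝ) = s ^ 3 * Λ) (hδ : δ = c / s)
    (hH : ∑ m ∈ Finset.Icc 1 N, ((m : ℝ))⁻¹ ≤ 3 * Λ) :
    ∑ m ∈ Finset.Icc 1 N, (3 * n * (K * C * (4 * R / √K +
        (√n * γ + 2) * (K * C + √K * (d / δ * M) + α * K * (2 * R)) / ((m : ℝ) * α * K))) +
        n * ((K * C + √K * (d / δ * M) + α * K * (2 * R)) ^ 2 / (2 * ((m : ℝ) * α * K)))) +
      n * (4 * (α * K) * R ^ 2) + n * T * (C * δ * (3 + R / r)) + n * K * (2 * C * R) ≤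
    (24 * C * R + 27 * C * (C + d * M / c + 2 * α * R) / α +
      3 * (C + d * M / c + 2 * α * R) ^ 2 / α + 8 * α * R ^ 2 + C * c * (3 + R / r) +
      4 * C * R) * (n * √n * γ * (s ^ 2 * Λ)) := by
  have hs0 : 0 < s := by linarith
  have hΛ0 : 0 < Λ := by linarith
  have hK0 : (0 : ℝ) < K := by exact_mod_cast hK1
  have hn1 : (1 : ℝ) ≤ n := by exact_mod_cast hn
  have hNK' : (N : ℝ) * K ≤ s ^ 3 * Λ := by rw [← hT]; exact_mod_cast hNK
  set B := C + d * M / c + 2 * α * R with hB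
  have hB0 : 0 ≤ B := by positivity
  set ρ := K * C + √K * (d / δ * M) + α * K * (2 * R) with hρ
  set Q := s ^ 2 * Λ with hQ
  have hQ0 : 0 < Q := by positivity
  set ν := n * √n * γ with hν
  have hsqrtn : 1 ≤ √(n : ℝ) := Real.one_le_sqrt.2 hn1
  have hnν : (n : ℝ) ≤ ν := by
    have h1 : (1 : ℝ) ≤ √n * γ := one_le_mul_of_one_le_of_one_le hsqrtn hγ
    rw [hν, mul_assoc]
    exact le_mul_of_one_le_right (by linarith) h1
  have hν3 : n * (√n * γ + 2) ≤ 3 * ν := by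
    have : n * (√n * γ + 2) = ν + 2 * n := by rw [hν]; ring
    linarith
  have hsqrtK : √(K : ℝ) ≤ s := by
    rw [← Real.sqrt_sq hs0.le]
    exact Real.sqrt_le_sqrt hKs
  have hsqrtK0 : 0 < √(K : ℝ) := Real.sqrt_pos.2 hK0
  have hsK' : s ≤ 2 * √(K : ℝ) := by
    refine le_of_sq_le_sq ?_ (by positivity)
    rw [mul_pow, Real.sq_sqrt hK0.le]
    linarith
  have hδ0 : 0 < δ := by rw [hδ]; positivity
  have hρ0 : 0 ≤ ρ := by positivity
  have hρB : ρ ≤ s ^ 2 * B := by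
    have h1 : √(K : ℝ) * (d / δ * M) ≤ s * (d / δ * M) := by gcongr
    have h2 : s * (d / δ * M) = s ^ 2 * (d * M / c) := by
      rw [hδ]; field_simp
    have h3 : K * C ≤ s ^ 2 * C := by gcongr
    have h4 : α * K * (2 * R) ≤ α * s ^ 2 * (2 * R) := by gcongr
    rw [hρ, hB]
    linarith
  have hsQ : s ^ 2 ≤ 2 * Q := by
    rw [hQ]
    nlinarith [sq_nonneg s]
  -- the optimization errors
  have h1 : (N : ℝ) * (3 * n * (K * C * (4 * R / √K))) ≤ 24 * C * R * (ν * Q) := by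
    have e1 : (K : ℝ) = √K * √K := (Real.mul_self_sqrt hK0.le).symm
    have e2 : (N : ℝ) * (3 * n * (K * C * (4 * R / √K))) = 12 * C * R * n * (N * √K) := by
      rw [mul_div_assoc', mul_div_assoc', mul_div_assoc', div_eq_iff hsqrtK0.ne']
      nth_rewrite 1 [e1]
      ring
    have h2 : (N : ℝ) * √K ≤ 2 * Q := by
      have h3 : s * (N * √K) ≤ s * (2 * Q) := by
        calc s * (N * √K) ≤ 2 * √K * (N * √K) := by gcongr
          _ = 2 * (N * K) := by nth_rewrite 3 [e1]; ring
          _ ≤ 2 * (s ^ 3 * Λ) := by gcongr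
          _ = s * (2 * Q) := by rw [hQ]; ring
      exact le_of_mul_le_mul_left h3 hs0
    rw [e2]
    calc 12 * C * R * n * (N * √K) ≤ 12 * C * R * ν * (2 * Q) := by gcongr
      _ = _ := by ring
  -- the consensus errors and the drift of the leader
  have h2 : 3 * C * (n * (√n * γ + 2)) * ρ / α * ∑ m ∈ Finset.Icc 1 N, ((m : ℝ))⁻¹ ≤
      27 * C * B / α * (ν * Q) := by
    calc 3 * C * (n * (√n * γ + 2)) * ρ / α * ∑ m ∈ Finset.Icc 1 N, ((m : ℝ))⁻¹
        ≤ 3 * C * (3 * ν) * (s ^ 2 * B) / α * (3 * Λ) := by gcongr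
      _ = _ := by rw [hQ]; ring
  -- the stability of the leader
  have h3 : n * ρ ^ 2 / (2 * α * K) * ∑ m ∈ Finset.Icc 1 N, ((m : ℝ))⁻¹ ≤
      3 * B ^ 2 / α * (ν * Q) := by
    have e1 : n * ρ ^ 2 / (2 * α * K) ≤ ν * (s ^ 2 * B ^ 2) / α := by
      rw [div_le_div_iff₀ (by positivity) hα]
      have e2 : ρ ^ 2 ≤ (s ^ 2 * B) ^ 2 := pow_le_pow_left₀ hρ0 hρB 2
      calc n * ρ ^ 2 * α ≤ ν * (s ^ 2 * B) ^ 2 * α := by gcongr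
        _ = ν * (s ^ 2 * B ^ 2) * (α * s ^ 2) := by ring
        _ ≤ ν * (s ^ 2 * B ^ 2) * (α * (2 * K)) := by gcongr
        _ = _ := by ring
    calc n * ρ ^ 2 / (2 * α * K) * ∑ m ∈ Finset.Icc 1 N, ((m : ℝ))⁻¹
        ≤ ν * (s ^ 2 * B ^ 2) / α * (3 * Λ) := by gcongr
      _ = _ := by rw [hQ]; ring
  have h4 : n * (4 * (α * K) * R ^ 2) ≤ 8 * α * R ^ 2 * (ν * Q) := by
    calc n * (4 * (α * K) * R ^ 2) ≤ ν * (4 * (α * (2 * Q)) * R ^ 2) := by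
          gcongr
          exact hKs.trans hsQ
      _ = _ := by ring
  have h5 : n * T * (C * δ * (3 + R / r)) ≤ C * c * (3 + R / r) * (ν * Q) := by
    have e1 : n * T * (C * δ * (3 + R / r)) = C * c * (3 + R / r) * (n * Q) := by
      rw [hT, hδ, hQ]; field_simp
    rw [e1]
    gcongr
  have h6 : n * K * (2 * C * R) ≤ 4 * C * R * (ν * Q) := by
    calc n * K * (2 * C * R) ≤ ν * (2 * Q) * (2 * C * R) := by
          gcongr
          exact hKs.trans hsQ
      _ = _ := by ring
  have hsum : ∑ m ∈ Finset.Icc 1 N, (3 * n * (K * C * (4 * R / √K +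
        (√n * γ + 2) * ρ / ((m : ℝ) * α * K))) + n * (ρ ^ 2 / (2 * ((m : ℝ) * α * K)))) =
      N * (3 * n * (K * C * (4 * R / √K))) +
      3 * C * (n * (√n * γ + 2)) * ρ / α * ∑ m ∈ Finset.Icc 1 N, ((m : ℝ))⁻¹ +
      n * ρ ^ 2 / (2 * α * K) * ∑ m ∈ Finset.Icc 1 N, ((m : ℝ))⁻¹ := by
    generalize 4 * R / √(K : ℝ) = a
    rw [Finset.mul_sum, Finset.mul_sum, add_assoc, ← Finset.sum_add_distrib]
    have e1 : (N : ℝ) * (3 * n * (K * C * a)) = ∑ m ∈ Finset.Icc 1 N, 3 * n * (K * C * a) := by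
      rw [Finset.sum_const, Nat.card_Icc, nsmul_eq_mul, Nat.add_sub_cancel]
    rw [e1, ← Finset.sum_add_distrib]
    refine Finset.sum_congr rfl fun m hm => ?_
    have hm0 : (0 : ℝ) < m := by exact_mod_cast (Finset.mem_Icc.1 hm).1
    field_simp
    ring
  rw [hsum]
  linarith

end DBBCG

namespace DBBCG

open Filter Topology Metric

/-! ### The theorem for the given losses -/

/-- The natural scale `s = (T / log T) ^ (1 / 3)`, in which the block size is `⌊s ^ 2⌋` and the
smoothing radius is proportional to `1 / s`. -/
theorem exists_scale {T : ℕ} (hT : 2 ≤ T) :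
    ∃ s : ℝ, 1 ≤ s ∧ (T : ℝ) = s ^ 3 * Real.log T ∧
      (T : ℝ) ^ (2 / 3 : ℝ) * Real.log T ^ (-(2 / 3) : ℝ) = s ^ 2 ∧
      (T : ℝ) ^ (-(1 / 3) : ℝ) * Real.log T ^ (1 / 3 : ℝ) = s⁻¹ ∧
      (T : ℝ) ^ (2 / 3 : ℝ) * Real.log T ^ (1 / 3 : ℝ) = s ^ 2 * Real.log T := by
  have hT1 : (1 : ℝ) < T := by exact_mod_cast hT
  have hT0 : (0 : ℝ) < T := by linarith
  have hΛ : 0 < Real.log T := Real.log_pos hT1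
  have hle : Real.log T ≤ T := (Real.log_le_sub_one_of_pos hT0).trans (by linarith)
  set Λ := Real.log T
  have hq : 0 < T / Λ := by positivity
  have hpow : ∀ p : ℝ, (T / Λ) ^ p = (T : ℝ) ^ p * Λ ^ (-p) := fun p => by
    rw [Real.div_rpow hT0.le hΛ.le, Real.rpow_neg hΛ.le, div_eq_mul_inv]
  have h2 : ((T / Λ) ^ (1 / 3 : ℝ)) ^ 2 = (T : ℝ) ^ (2 / 3 : ℝ) * Λ ^ (-(2 / 3) : ℝ) := by
    rw [← Real.rpow_natCast, ← Real.rpow_mul hq.le, ← hpow]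
    norm_num
  refine ⟨(T / Λ) ^ (1 / 3 : ℝ), Real.one_le_rpow ((one_le_div hΛ).2 hle) (by norm_num), ?_,
    h2.symm, ?_, ?_⟩
  · rw [← Real.rpow_natCast, ← Real.rpow_mul hq.le]
    norm_num
    rw [div_mul_cancel₀ _ hΛ.ne']
  · rw [← Real.rpow_neg hq.le, hpow, neg_neg]
  · rw [h2, mul_assoc]
    congr 1
    nth_rewrite 3 [← Real.rpow_one Λ]
    rw [← Real.rpow_add hΛ]
    norm_num

theorem floor_sq_bounds {s : ℝ} (hs : 1 ≤ s) :
    1 ≤ ⌊s ^ 2⌋₊ ∧ (⌊s ^ 2⌋₊ : ℝ) ≤ s ^ 2 ∧ s ^ 2 ≤ 2 * ⌊s ^ 2⌋₊ := by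
  have h1 : 1 ≤ s ^ 2 := one_le_pow₀ hs
  have h2 : 1 ≤ ⌊s ^ 2⌋₊ := Nat.le_floor (by simpa using h1)
  refine ⟨h2, Nat.floor_le (by positivity), ?_⟩
  have h3 : (1 : ℝ) ≤ ⌊s ^ 2⌋₊ := by exact_mod_cast h2
  linarith [Nat.lt_floor_add_one (s ^ 2)]

theorem half_le_log {T : ℕ} (hT : 2 ≤ T) : 1 / 2 ≤ Real.log T := by
  have h1 : Real.log 2 ≤ Real.log T := Real.log_le_log (by norm_num) (by exact_mod_cast hT)
  linarith [Real.log_two_gt_d9]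

theorem sum_inv_Icc_le_log {T N : ℕ} (hT : 2 ≤ T) (hN : N ≤ T) :
    ∑ m ∈ Finset.Icc 1 N, ((m : ℝ))⁻¹ ≤ 3 * Real.log T := by
  have h1 := half_le_log hT
  have h2 := sum_inv_Icc_le N
  rcases Nat.eq_zero_or_pos N with rfl | h0
  · simp; linarith
  · have h3 : Real.log N ≤ Real.log T :=
      Real.log_le_log (by exact_mod_cast h0) (by exact_mod_cast hN)
    linarith

theorem sigma2_nonneg {n : ℕ} (P : Matrix (Fin n) (Fin n) ℝ) : 0 ≤ sigma2 P :=
  LinearMap.singularValues_nonneg _ _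

theorem globalLoss_congr {d n : ℕ} {f g : ℕ → Fin n → Vec d → ℝ} {t : ℕ} {a : Vec d}
    (h : ∀ j, f t j a = g t j a) : globalLoss f t a = globalLoss g t a :=
  Finset.sum_congr rfl fun j _ => h j

theorem regret_congr {d n : ℕ} {𝒦 : Set (Vec d)} {f g : ℕ → Fin n → Vec d → ℝ} {T : ℕ}
    (h : ∀ t ∈ Finset.Icc 1 T, ∀ j, Set.EqOn (f t j) (g t j) 𝒦) {y : ℕ → Vec d}
    (hy : ∀ t ∈ Finset.Icc 1 T, y t ∈ 𝒦) : regret 𝒦 f T y = regret 𝒦 g T y := by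
  rw [regret, regret]
  congr 1
  · exact Finset.sum_congr rfl fun t ht => globalLoss_congr fun j => h t ht j (hy t ht)
  · congr 1
    exact Set.image_congr fun a ha =>
      Finset.sum_congr rfl fun t ht => globalLoss_congr fun j => h t ht j ha

/-- The best fixed decision in hindsight is attained on a compact set. -/
theorem exists_regret_eq {d n : ℕ} {𝒦 : Set (Vec d)} {f : ℕ → Fin n → Vec d → ℝ} {T : ℕ}
    (hK : IsCompact 𝒦) (hne : 𝒦.Nonempty) (hf : ∀ t j, Continuous (f t j)) :
    ∃ y' ∈ 𝒦, ∀ y : ℕ → Vec d, regret 𝒦 f T y =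
      ∑ t ∈ Finset.Icc 1 T, (globalLoss f t (y t) - globalLoss f t y') := by
  have hcont : Continuous fun a => ∑ t ∈ Finset.Icc 1 T, globalLoss f t a :=
    continuous_finsetSum _ fun t _ => continuous_finsetSum _ fun j _ => hf t j
  obtain ⟨y', hy', hmin⟩ := hK.exists_isMinOn hne hcont.continuousOn
  refine ⟨y', hy', fun y => ?_⟩
  have hleast : IsLeast ((fun a => ∑ t ∈ Finset.Icc 1 T, globalLoss f t a) '' 𝒦)
      (∑ t ∈ Finset.Icc 1 T, globalLoss f t y') :=
    ⟨⟨y', hy', rfl⟩, by rintro _ ⟨a, ha, rfl⟩; exact hmin ha⟩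
  rw [regret, hleast.csInf_eq, Finset.sum_sub_distrib]

theorem strongConvexOn_congr {d : ℕ} {𝒦 : Set (Vec d)} {α : ℝ} {f g : Vec d → ℝ}
    (hf : StrongConvexOn 𝒦 α f) (h : Set.EqOn f g 𝒦) : StrongConvexOn 𝒦 α g := by
  refine ⟨hf.1, fun a ha b hb s t hs ht hst => ?_⟩
  rw [← h ha, ← h hb, ← h (hf.1 ha hb hs ht hst)]
  exact hf.2 ha hb hs ht hst

/-- Losses that are Lipschitz on `𝒦` in the rounds of the game agree there with globally
Lipschitz functions. -/
theorem exists_lipschitz_losses {d n : ℕ} {𝒦 : Set (Vec d)} {G : ℝ} {T : ℕ}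
    {f : ℕ → Fin n → Vec d → ℝ}
    (hf : ∀ t ∈ Finset.Icc 1 T, ∀ i, ∀ a ∈ 𝒦, ∀ b ∈ 𝒦, |f t i a - f t i b| ≤ G * ‖a - b‖) :
    ∃ g : ℕ → Fin n → Vec d → ℝ, (∀ t i, LipschitzWith G.toNNReal (g t i)) ∧
      ∀ t ∈ Finset.Icc 1 T, ∀ i, Set.EqOn (f t i) (g t i) 𝒦 := by
  have h : ∀ t i, ∃ g : Vec d → ℝ, LipschitzWith G.toNNReal g ∧
      (t ∈ Finset.Icc 1 T → Set.EqOn (f t i) g 𝒦) := by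
    intro t i
    by_cases ht : t ∈ Finset.Icc 1 T
    · have hL : LipschitzOnWith G.toNNReal (f t i) 𝒦 := by
        refine LipschitzOnWith.of_dist_le_mul fun a ha b hb => ?_
        rw [Real.dist_eq, dist_eq_norm]
        exact (hf t ht i a ha b hb).trans
          (mul_le_mul_of_nonneg_right (Real.le_coe_toNNReal G) (norm_nonneg _))
      obtain ⟨g, hg, he⟩ := hL.extend_real
      exact ⟨g, hg, fun _ => he⟩
    · exact ⟨fun _ => 0, LipschitzWith.const' 0, fun h => absurd h ht⟩
  choose g hg he using h
  exact ⟨g, hg, fun t ht i => he t i ht⟩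

/-- A run only evaluates the losses in `𝒦`, so that it is also a run for any losses that agree
with the given ones there. -/
theorem IsRun.congr {Ω : Type*} {d n : ℕ} {𝒦 : Set (Vec d)} {E : Set (Fin n × Fin n)}
    {P : Matrix (Fin n) (Fin n) ℝ} {r α h δ : ℝ} {K L T : ℕ} {x₀ : Vec d}
    {f g : ℕ → Fin n → Vec d → ℝ} {u : ℕ → Fin n → Ω → UnitSphere d}
    {x z : ℕ → Fin n → Ω → Vec d} {v w : ℕ → Fin n → ℕ → Ω → Vec d}
    (H : IsRun 𝒦 E P r α h δ K L T x₀ f u x z v w) (hc : Convex ℝ 𝒦) (hr : 0 < r) (hδ : 0 ≤ δ)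
    (hδr : δ ≤ r) (hball : closedBall 0 r ⊆ 𝒦)
    (hfg : ∀ t ∈ Finset.Icc 1 T, ∀ j, Set.EqOn (f t j) (g t j) 𝒦) :
    IsRun 𝒦 E P r α h δ K L T x₀ g u x z v w where
  init_mem := H.init_mem
  x_one := H.x_one
  z_one := H.z_one
  cg := H.cg
  x_succ := H.x_succ
  nonanticipating := H.nonanticipating
  z_succ := by
    intro m hm hmT i ω
    rw [H.z_succ m hm hmT i ω]
    congr 2
    refine Finset.sum_congr rfl fun t ht => ?_
    have htT : t ∈ Finset.Icc 1 T := by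
      rw [block, Finset.mem_Icc] at ht
      rw [Finset.mem_Icc]
      omega
    obtain ⟨m, rfl⟩ : ∃ k, m = k + 1 := ⟨m - 1, by omega⟩
    have hx := H.x_mem hc (le_trans (Nat.mul_le_mul_right K (Nat.le_succ m)) hmT) i ω
    rw [onePoint, onePoint, hfg t htT i
      (add_smul_mem_of_mem_shrink hc hr hδ hδr hball hx (by simp))]

end DBBCG

theorem theorem7 (d : ℕ) (hd : 1 ≤ d) (α G M R r c : ℝ)
    (hα : 0 < α) (hR : 0 < R) (hr : 0 < r) (hc : 0 < c) :
    ∃ C : ℝ, ∀ (n : ℕ) (E : Set (Fin n × Fin n)) (P : Matrix (Fin n) (Fin n) ℝ)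
      (𝒦 : Set (DBBCG.Vec d)) (T K L : ℕ) (δ h : ℝ)
      (f : ℕ → Fin n → DBBCG.Vec d → ℝ) (x₀ : DBBCG.Vec d)
      (Ω : Type*) [MeasurableSpace Ω] (μ : Measure Ω) [IsProbabilityMeasure μ]
      (u : ℕ → Fin n → Ω → DBBCG.UnitSphere d)
      (x z : ℕ → Fin n → Ω → DBBCG.Vec d)
      (v w : ℕ → Fin n → ℕ → Ω → DBBCG.Vec d),
      -- the network
      DBBCG.IsWeightMatrix E P → DBBCG.sigma2 P < 1 →
      -- the decision set
      Convex ℝ 𝒦 → IsClosed 𝒦 →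
      Metric.closedBall 0 r ⊆ 𝒦 → 𝒦 ⊆ Metric.closedBall 0 R →
      -- the parameters
      2 ≤ T →
      K = ⌊(T : ℝ) ^ (2 / 3 : ℝ) * Real.log T ^ (-(2 / 3) : ℝ)⌋₊ →
      L = K →
      δ = c * (T : ℝ) ^ (-(1 / 3) : ℝ) * Real.log T ^ (1 / 3 : ℝ) →
      δ ≤ r →
      h = α * K →
      -- the losses
      (∀ t ∈ Finset.Icc 1 T, ∀ i, ∀ a ∈ 𝒦, ∀ b ∈ 𝒦, |f t i a - f t i b| ≤ G * ‖a - b‖) →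
      (∀ t ∈ Finset.Icc 1 T, ∀ i, StrongConvexOn 𝒦 α (f t i)) →
      (∀ t ∈ Finset.Icc 1 T, ∀ i, ∀ a ∈ 𝒦, |f t i a| ≤ M) →
      -- the random directions: independent and uniform on the unit sphere
      (∀ t ∈ Finset.Icc 1 T, ∀ i, Measurable (u t i)) →
      (∀ t ∈ Finset.Icc 1 T, ∀ i, μ.map (u t i) = DBBCG.uniformSphere d) →
      iIndepFun (fun (p : Finset.Icc 1 T × Fin n) => u p.1 p.2) μ →
      -- the algorithm
      DBBCG.IsRun 𝒦 E P r α h δ K L T x₀ f u x z v w →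
      -- the regret bound
      ∀ i : Fin n,
        Integrable (fun ω => DBBCG.regret 𝒦 f T (fun t => DBBCG.played δ K u x i t ω)) μ ∧
        ∫ ω, DBBCG.regret 𝒦 f T (fun t => DBBCG.played δ K u x i t ω) ∂μ
          ≤ C * ((n : ℝ) ^ (3 / 2 : ℝ) * (1 - DBBCG.sigma2 P)⁻¹
              * (T : ℝ) ^ (2 / 3 : ℝ) * Real.log T ^ (1 / 3 : ℝ)) := by
  have : NeZero d := ⟨by omega⟩
  -- the Lipschitz constant of the extended losses and, in units of the squared scale, the size of
  -- the vectors exchanged in one block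
  set C : ℝ := (G.toNNReal : ℝ)
  set B := C + d * M / c + 2 * α * R
  refine ⟨24 * C * R + 27 * C * B / α + 3 * B ^ 2 / α + 8 * α * R ^ 2 + C * c * (3 + R / r) +
    4 * C * R, ?_⟩
  intro n E P 𝒦 T K L δ h f x₀ Ω _ μ _ u x z v w hP hσ hconv hclosed hball hsub hT hK hL hδ hδr hh
    hlip hsc hbdd hmeas hlaw hind hrun i
  have : NeZero n := ⟨i.pos.ne'⟩
  subst hL hh
  obtain ⟨s, hs, hTs, h2, h1, h3⟩ := DBBCG.exists_scale hT
  have hs0 : 0 < s := by linarith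
  rw [h2] at hK
  rw [mul_assoc, h1, ← div_eq_mul_inv] at hδ
  obtain ⟨hK1, hKs, hsK⟩ := DBBCG.floor_sq_bounds hs
  rw [← hK] at hK1 hKs hsK
  have hδ0 : 0 < δ := by rw [hδ]; positivity
  have h0 : (0 : DBBCG.Vec d) ∈ 𝒦 := hball (Metric.mem_closedBall_self hr.le)
  have hM : 0 ≤ M := (abs_nonneg _).trans (hbdd 1 (Finset.mem_Icc.2 ⟨le_rfl, by omega⟩) i 0 h0)
  obtain ⟨g, hg, hfg⟩ := DBBCG.exists_lipschitz_losses hlip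
  have H : DBBCG.RegularRun 𝒦 E P α G.toNNReal M R r L T δ x₀ μ g u x z v w :=
    { run := hrun.congr hconv hr hδ0.le hδr hball hfg
      weight := hP
      sigma2_lt := hσ
      convex := hconv
      closed := hclosed
      ball_subset := hball
      subset_ball := hsub
      block_pos := hK1
      alpha_pos := hα
      delta_pos := hδ0
      radius_pos := hr
      delta_le := hδr
      lipschitz := hg
      strongConvex := fun t ht j => DBBCG.strongConvexOn_congr (hsc t ht j) (hfg t ht j)
      bounded := fun t ht j a ha => by rw [← hfg t ht j ha]; exact hbdd t ht j a ha
      measurable_dir := hmeas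
      law_dir := hlaw
      indep_dir := hind }
  have hplayed : ∀ ω, ∀ t ∈ Finset.Icc 1 T, DBBCG.played δ L u x i t ω ∈ 𝒦 := by
    intro ω t ht
    rw [Finset.mem_Icc] at ht
    obtain ⟨m, hm, htm⟩ := H.exists_block ht.1 ht.2
    exact H.played_mem hm htm i ω
  obtain ⟨y, hy, hreg⟩ := DBBCG.exists_regret_eq (T := T)
    (Metric.isCompact_of_isClosed_isBounded hclosed (Metric.isBounded_closedBall.subset hsub))
    ⟨0, h0⟩ fun t j => (hg t j).continuous
  have e : (fun ω => DBBCG.regret 𝒦 f T fun t => DBBCG.played δ L u x i t ω) = fun ω =>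
      ∑ t ∈ Finset.Icc 1 T, (DBBCG.globalLoss g t (DBBCG.played δ L u x i t ω) -
        DBBCG.globalLoss g t y) := by
    funext ω
    rw [DBBCG.regret_congr hfg (hplayed ω), hreg]
  have hγ : 1 ≤ (1 - DBBCG.sigma2 P)⁻¹ :=
    (one_le_inv₀ (by linarith)).2 (by linarith [DBBCG.sigma2_nonneg P])
  have hn : (n : ℝ) ^ (3 / 2 : ℝ) = n * √n := by
    rw [Real.sqrt_eq_rpow, ← Real.rpow_one_add' (by positivity) (by norm_num)]
    norm_num
  rw [e, hn, mul_assoc (_ * _ * _) (_ ^ _), h3]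
  exact ⟨H.integrable_sum_loss_sub i hy, (H.integral_sum_loss_sub_le hM i hy).trans
    (DBBCG.regret_bound_of_scale hs (DBBCG.half_le_log hT) hα hc NNReal.zero_le_coe hM hR.le hr hγ
      (NeZero.one_le) hK1 hKs hsK (Nat.div_mul_le_self T L) hTs hδ
      (DBBCG.sum_inv_Icc_le_log hT (Nat.div_le_self T L)))⟩
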